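/- Fix integers $K\ge 1$, an even integer $r>0$ and a real $d>0$. **Instances.** A *reduced NAE-$K$-SAT instance* consists of Boolean variables and finitely many clauses; each clause is a set of at most $K$ literals on distinct variables together with a sign in $\{+,-,0\}$, the sign being $0$ iff the clause has exactly $K$ literals. An assignment satisfies a clause of sign $0$ if the clause has a literal of value $0$ and a literal of value $1$, a clause of sign $+$ if it has a literal of value $0$, and a clause of sign $-$ if it has a literal of value $1$; $\mathbb{SAT}(\Phi)$ is the set of assignments satisfying all clauses of $\Phi$. The complement $\bar\Phi$ is obtained by exchanging the signs $+$ and $-$. The factor graph of $\Phi$ is the bipartite graph on variables and clauses (edges labelled by polarity, clauses by sign) joining a variable to the clauses containing it; $B_\Phi(x,r)$ is the instance, rooted at $x$, given by the depth-$r$ neighbourhood of $x$ in it. Let $\mathcal{SAT}_r$ be the set of reduced instances with a root variable from which every variable has distance at most $r$ in the factor graph. A *local rule of radius $r$* is a function $\tau:\mathcal{SAT}_r\to[0,1]$ whose value depends only on the rooted labelled factor graph up to isomorphism (not on the names of variables and clauses). It is *balanced* if $\tau(\bar\Psi)=1-\tau(\Psi)$ for all $\Psi\in\mathcal{SAT}_r$.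 **Random instance.** $\mathbf\Phi(n,dn)$ has variables $x_1,\dots,x_n$ and $\lfloor dn\rfloor$ independent clauses of sign $0$, each on $K$ distinct variables chosen uniformly at random, each variable being negated independently with probability $1/2$. **Algorithm.** Let $Z_1,\dots,Z_n,U_1,\dots,U_n$ be i.i.d. uniform on $[0,1]$, independent of $\mathbf\Phi(n,dn)$. The $\tau$-local algorithm processes the variables in decreasing order of $Z_i$. When $x_i$ is processed and $\Phi'$ is the current reduced instance, it sets $\sigma(x_i)=1$ if $U_i<\tau(B_{\Phi'}(x_i,r))$ and $\sigma(x_i)=0$ otherwise. It then removes $x_i$ from the instance and deletes all clauses that have become satisfied or violated. Every remaining clause that contained $x_i$ gets sign $+$ if its literal of $x_i$ took the value $1$, and sign $-$ if it took the value $0$. Let $\alpha_n$ be the probability that the output $\sigma$ lies in $\mathbb{SAT}(\mathbf\Phi(n,dn))$. **Claim.** Let $\tau$ be a balanced local rule of radius $r$ with $\limsup_{n\to\infty}\alpha_n>0$. Then for all reals $0<\eta<\beta$ with $[\beta-\eta,\beta]\subset[0,1/2]$ and every integer $m\ge 1$, $$\liminf_{n\to\infty}\ \mathbb{P}\bigl(\mathbb{SAT}(\mathbf\Phi(n,dn);\beta,\eta,m)\neq\emptyset\bigr)>0,$$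 where $\mathbb{SAT}(\Phi;\beta,\eta,m)$ is the set of $m$-tuples $(\sigma^1,\dots,\sigma^m)$ of elements of $\mathbb{SAT}(\Phi)$ whose Hamming distances satisfy $(\beta-\eta)n\le\rho(\sigma^j,\sigma^k)\le\beta n$ for all $j\ne k$. -/

import Mathlib

open MeasureTheory ProbabilityTheory Filter

namespace NAESAT

/-! ### Reduced and non-reduced NAE-K-SAT instances -/

/-- A (possibly reduced) instance.  Its variables are the elements of `vars` and its clauses the
elements of `clauses` (clauses are indexed, so that equal clauses may be repeated).
For `j ∈ clauses` and `i ∈ vars`, `lit j i = some true` means that clause `j` contains the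
literal `x_i`, `lit j i = some false` that it contains the negated literal, and
`lit j i = none` that it does not contain the variable `x_i`.
`sign j` is the decoration `+`, `-` or `0` of clause `j`.  The values of `lit` and `sign` at
indices outside `vars` and `clauses` carry no meaning. -/
structure Formula (n m : ℕ) where
  vars : Finset (Fin n)
  clauses : Finset (Fin m)
  lit : Fin m → Fin n → Option Bool
  sign : Fin m → SignType

namespace Formula

variable {n m : ℕ}

/-- The variables that appear in clause `j`. -/
def scope (Φ : Formula n m) (j : Fin m) : Finset (Fin n) :=
  Φ.vars.filter fun i => Φ.lit j i ≠ none

/-- Every clause has at most `K` literals, and exactly `K` iff its sign is `0`. -/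
def IsReduced (K : ℕ) (Φ : Formula n m) : Prop :=
  ∀ j ∈ Φ.clauses, (Φ.scope j).card ≤ K ∧ ((Φ.scope j).card = K ↔ Φ.sign j = 0)

/-- The complementary instance: all signs are flipped. -/
def compl (Φ : Formula n m) : Formula n m :=
  { Φ with sign := fun j => -Φ.sign j }

/-- Clause `j` has a literal with value `1` under `σ`. -/
def HasTrueLit (Φ : Formula n m) (σ : Fin n → Bool) (j : Fin m) : Prop :=
  ∃ i ∈ Φ.scope j, Φ.lit j i = some (σ i)

/-- Clause `j` has a literal with value `0` under `σ`. -/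
def HasFalseLit (Φ : Formula n m) (σ : Fin n → Bool) (j : Fin m) : Prop :=
  ∃ i ∈ Φ.scope j, Φ.lit j i = some (!σ i)

/-- `σ` satisfies clause `j`: a clause with sign `0` needs a literal of each value, a clause with
sign `+` a literal of value `0`, and a clause with sign `-` a literal of value `1`. -/
def SatisfiesClause (Φ : Formula n m) (σ : Fin n → Bool) (j : Fin m) : Prop :=
  (0 ≤ Φ.sign j → Φ.HasFalseLit σ j) ∧ (Φ.sign j ≤ 0 → Φ.HasTrueLit σ j)

/-- The set of satisfying assignments. -/
def SAT (Φ : Formula n m) : Set (Fin n → Bool) :=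
  {σ | ∀ j ∈ Φ.clauses, Φ.SatisfiesClause σ j}

/-- The `k`-tuples of satisfying assignments all of whose pairwise Hamming distances lie in
`[(β - η) n, β n]`. -/
def overlapSAT (Φ : Formula n m) (β η : ℝ) (k : ℕ) : Set (Fin k → Fin n → Bool) :=
  {s | (∀ a, s a ∈ Φ.SAT) ∧ ∀ a b, a ≠ b →
    (β - η) * n ≤ (hammingDist (s a) (s b) : ℝ) ∧ (hammingDist (s a) (s b) : ℝ) ≤ β * n}

/-- The factor graph: variable nodes `Sum.inl i`, clause nodes `Sum.inr j`, and an edge whenever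
the variable appears in the clause. -/
def factorGraph (Φ : Formula n m) : SimpleGraph (Fin n ⊕ Fin m) :=
  SimpleGraph.fromRel fun a b => ∃ i j, a = Sum.inl i ∧ b = Sum.inr j ∧
    j ∈ Φ.clauses ∧ i ∈ Φ.scope j

open Classical in
/-- The depth-`r` neighbourhood of the variable `x` in the factor graph, as an instance. -/
noncomputable def ball (Φ : Formula n m) (x : Fin n) (r : ℕ) : Formula n m where
  vars := Φ.vars.filter fun i => Φ.factorGraph.edist (Sum.inl x) (Sum.inl i) ≤ r
  clauses := Φ.clauses.filter fun j => Φ.factorGraph.edist (Sum.inl x) (Sum.inr j) ≤ r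
  lit := Φ.lit
  sign := Φ.sign

/-- The decoration that clause `j` carries, if it survives, after its variable `x` has received
the value `v`: it is `+` if the literal of `x` in the clause gets value `1`, and `-` if it gets
value `0`. -/
noncomputable def newSign (Φ : Formula n m) (x : Fin n) (v : Bool) (j : Fin m) : SignType :=
  if Φ.lit j x = some v then 1 else -1

/-- The reduced instance after fixing `x = v`.  A clause `j` that contains `x` becomes satisfied
iff its sign is nonzero and different from `newSign x v j`, and becomes violated iff `x` is its
only variable and it is not satisfied; satisfied and violated clauses are removed, and the
remaining clauses containing `x` lose this literal and carry the sign `newSign x v j`. -/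
noncomputable def assign (Φ : Formula n m) (x : Fin n) (v : Bool) : Formula n m where
  vars := Φ.vars.erase x
  clauses := Φ.clauses.filter fun j => x ∈ Φ.scope j →
    (Φ.sign j = 0 ∨ Φ.sign j = Φ.newSign x v j) ∧ Φ.scope j ≠ {x}
  lit := Φ.lit
  sign := fun j => if x ∈ Φ.scope j then Φ.newSign x v j else Φ.sign j

end Formula

/-! ### Local rules -/

/-- An instance with a designated root variable. -/
structure RootedFormula where
  {n m : ℕ}
  formula : Formula n m
  root : Fin n

namespace RootedFormula

/-- Isomorphism of rooted instances, i.e. of their factor graphs with all labels: a renaming of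
the variables and clauses which preserves the root, the literals and the signs. -/
def Iso (Ψ Ψ' : RootedFormula) : Prop :=
  ∃ (e : Ψ.formula.vars ≃ Ψ'.formula.vars) (f : Ψ.formula.clauses ≃ Ψ'.formula.clauses),
    (∀ i, i.1 = Ψ.root ↔ (e i).1 = Ψ'.root) ∧
    (∀ j i, Ψ'.formula.lit (f j) (e i) = Ψ.formula.lit j i) ∧
    ∀ j, Ψ'.formula.sign (f j) = Ψ.formula.sign j

/-- The complement of a rooted instance. -/
def compl (Ψ : RootedFormula) : RootedFormula := ⟨Ψ.formula.compl, Ψ.root⟩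

end RootedFormula

/-- The set `SAT_r`: reduced and non-reduced NAE-`K`-SAT instances with a root variable such that
every variable is at distance at most `r` from the root in the factor graph. -/
def RootedSAT (K r : ℕ) : Set RootedFormula :=
  {Ψ | Ψ.root ∈ Ψ.formula.vars ∧ Ψ.formula.IsReduced K ∧
    ∀ i ∈ Ψ.formula.vars, Ψ.formula.factorGraph.edist (Sum.inl Ψ.root) (Sum.inl i) ≤ r}

theorem compl_mem_rootedSAT {K r : ℕ} {Ψ : RootedFormula} (h : Ψ ∈ RootedSAT K r) :
    Ψ.compl ∈ RootedSAT K r := by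
  obtain ⟨h1, h2, h3⟩ := h
  refine ⟨h1, fun j hj => ⟨(h2 j hj).1, ?_⟩, h3⟩
  have := (h2 j hj).2
  change (Ψ.formula.scope j).card = K ↔ -Ψ.formula.sign j = 0
  rw [this]
  cases Ψ.formula.sign j <;> decide

/-- A local rule `τ : SAT_r → [0,1]`.  Its value depends only on the labelled factor graph of the
rooted instance, and not on how variables and clauses are named. -/
structure LocalRule (K r : ℕ) where
  toFun : RootedSAT K r → unitInterval
  iso_invariant : ∀ Ψ Ψ' : RootedSAT K r, Ψ.1.Iso Ψ'.1 → toFun Ψ = toFun Ψ'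

/-- `τ` is balanced: `τ` of the complement of `Ψ` is `1 - τ Ψ`. -/
def LocalRule.IsBalanced {K r : ℕ} (τ : LocalRule K r) : Prop :=
  ∀ Ψ : RootedSAT K r, (τ.toFun ⟨Ψ.1.compl, compl_mem_rootedSAT Ψ.2⟩ : ℝ) = 1 - τ.toFun Ψ

/-! ### The sequential local algorithm -/

section Algorithm

variable {K r n m : ℕ}

open Classical in
/-- The probability `τ(B_Φ(x,r))` with which `x` is set to `1`.  For even `r` the neighbourhood of
an unset variable of a reduced instance always lies in `SAT_r`, see `ball_mem_rootedSAT`. -/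
noncomputable def LocalRule.prob (τ : LocalRule K r) (Φ : Formula n m) (x : Fin n) : ℝ :=
  if h : (⟨Φ.ball x r, x⟩ : RootedFormula) ∈ RootedSAT K r then τ.toFun ⟨_, h⟩ else 0

open Classical in
/-- One step of the algorithm on a state (current reduced instance, values decided so far):
set `x` to `1` iff `u x < τ(B(x,r))`, and reduce the instance. -/
noncomputable def LocalRule.step (τ : LocalRule K r) (u : Fin n → unitInterval)
    (s : Formula n m × (Fin n → Bool)) (x : Fin n) : Formula n m × (Fin n → Bool) :=
  let v : Bool := decide ((u x : ℝ) < τ.prob s.1 x)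
  (s.1.assign x v, Function.update s.2 x v)

/-- The order in which variables are set: by decreasing labels `z`. -/
noncomputable def order (z : Fin n → unitInterval) : List (Fin n) :=
  List.ofFn (Tuple.sort fun i => OrderDual.toDual (z i))

/-- The output `σ_{Φ,z,u}` of the `τ`-local algorithm with labels `z` and seeds `u`.  Every
variable is set exactly once, so the initial values play no role. -/
noncomputable def LocalRule.output (τ : LocalRule K r) (Φ : Formula n m) (z u : Fin n → unitInterval) :
    Fin n → Bool :=
  ((order z).foldl (τ.step u) (Φ, fun _ => false)).2

end Algorithm

/-! ### The random instance -/

/-- Clauses on exactly `K` distinct variables among `x_1, …, x_n`, each of which is negated or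
not. -/
def KClause (n K : ℕ) : Type :=
  {c : Fin n → Option Bool // (Finset.univ.filter fun i => c i ≠ none).card = K}

instance (n K : ℕ) : MeasurableSpace (KClause n K) := ⊤

/-- The non-reduced instance with variables `x_1, …, x_n` and clauses `C_1, …, C_m`. -/
def toFormula {n m K : ℕ} (C : Fin m → KClause n K) : Formula n m where
  vars := Finset.univ
  clauses := Finset.univ
  lit := fun j => (C j).1
  sign := fun _ => 0

/-- The law of the random instance `Φ(n, dn)`: `⌊dn⌋` independent uniformly random clauses. -/
noncomputable def formulaLaw (K : ℕ) (d : ℝ) (n : ℕ) :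
    Measure (Fin ⌊d * n⌋₊ → KClause n K) :=
  Measure.pi fun _ => uniformOn Set.univ

/-- The probability `α_n` that the `τ`-local algorithm, run with independent uniform labels and
seeds, finds a satisfying assignment of `Φ(n, dn)`. -/
noncomputable def successProb {K r : ℕ} (τ : LocalRule K r) (d : ℝ) (n : ℕ) : ENNReal :=
  ((formulaLaw K d n).prod
      ((volume : Measure (Fin n → unitInterval)).prod (volume : Measure (Fin n → unitInterval))))
    {ω | τ.output (toFormula ω.1) ω.2.1 ω.2.2 ∈ (toFormula ω.1).SAT}

/-- The probability that `SAT(Φ(n, dn); β, η, k)` is nonempty. -/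
noncomputable def overlapProb (K : ℕ) (d β η : ℝ) (k n : ℕ) : ENNReal :=
  formulaLaw K d n {C | ((toFormula C).overlapSAT β η k).Nonempty}

/-! ### The neighbourhoods seen by the algorithm lie in `SAT_r` -/

section Facts

variable {K r n m : ℕ}

theorem isReduced_toFormula (C : Fin m → KClause n K) : (toFormula C).IsReduced K := by
  intro j _
  have h : ((toFormula C).scope j).card = K := (C j).2
  exact ⟨h.le, iff_of_true h rfl⟩

theorem Formula.isReduced_assign {Φ : Formula n m} (h : Φ.IsReduced K) (x : Fin n) (v : Bool) :
    (Φ.assign x v).IsReduced K := by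
  intro j hj
  have hj' : j ∈ Φ.clauses := (Finset.mem_filter.1 hj).1
  have hs : (Φ.assign x v).scope j = (Φ.scope j).erase x := by
    ext i; simp [Formula.scope, Formula.assign, and_assoc]
  obtain ⟨h1, h2⟩ := h j hj'
  rw [hs]
  by_cases hx : x ∈ Φ.scope j
  · have hc := Finset.card_erase_lt_of_mem hx
    have hsg : (Φ.assign x v).sign j = Φ.newSign x v j := by simp [Formula.assign, hx]
    refine ⟨by omega, iff_of_false (by omega) ?_⟩
    rw [hsg, Formula.newSign]; split <;> decide
  · have hsg : (Φ.assign x v).sign j = Φ.sign j := by simp [Formula.assign, hx]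
    rw [Finset.erase_eq_of_notMem hx, hsg]; exact ⟨h1, h2⟩

theorem Formula.adj_factorGraph {Φ : Formula n m} {i : Fin n} {j : Fin m} :
    Φ.factorGraph.Adj (Sum.inl i) (Sum.inr j) ↔ j ∈ Φ.clauses ∧ i ∈ Φ.scope j := by
  simp [Formula.factorGraph, SimpleGraph.fromRel_adj]

/-- Walks between two variables have even length, walks from a variable to a clause odd length. -/
theorem Formula.walk_parity {Φ : Formula n m} {a b : Fin n ⊕ Fin m} (p : Φ.factorGraph.Walk a b) :
    (Even p.length ↔ (a.isLeft = b.isLeft)) := by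
  induction p with
  | nil => simp
  | @cons u v w h p ih =>
    have : u.isLeft = !v.isLeft := by
      rcases u with u | u <;> rcases v with v | v <;>
        simp [Formula.factorGraph, SimpleGraph.fromRel_adj] at h ⊢
    rw [SimpleGraph.Walk.length_cons, Nat.even_add_one, ih, this]
    cases v.isLeft <;> cases w.isLeft <;> decide

theorem Formula.mem_ball_vars_of_adj {Φ : Formula n m} (hr : Even r) {x i : Fin n} {j : Fin m}
    (hj : Φ.factorGraph.edist (Sum.inl x) (Sum.inr j) ≤ r) (h : Φ.factorGraph.Adj (.inl i) (.inr j)) :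
    Φ.factorGraph.edist (Sum.inl x) (Sum.inl i) ≤ r := by
  obtain ⟨p, hp⟩ := SimpleGraph.exists_walk_of_edist_ne_top
    (ne_top_of_le_ne_top (ENat.natCast_ne_top r) hj)
  have hodd := Formula.walk_parity p
  have hle : p.length ≤ r := by rw [← hp] at hj; exact_mod_cast hj
  have hlt : p.length + 1 ≤ r := by
    rcases hle.eq_or_lt with e | e
    · rw [e] at hodd; simp [hr] at hodd
    · exact e
  refine (SimpleGraph.edist_le (p.concat h.symm)).trans ?_
  rw [SimpleGraph.Walk.length_concat]; exact_mod_cast hlt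

theorem Formula.scope_ball {Φ : Formula n m} (hr : Even r) {x : Fin n} {j : Fin m}
    (hj : j ∈ (Φ.ball x r).clauses) : (Φ.ball x r).scope j = Φ.scope j := by
  obtain ⟨hj1, hj2⟩ := Finset.mem_filter.1 hj
  ext i
  constructor
  · intro h
    obtain ⟨h1, h2⟩ := Finset.mem_filter.1 h
    exact Finset.mem_filter.2 ⟨(Finset.mem_filter.1 h1).1, h2⟩
  · intro h
    obtain ⟨h1, h2⟩ := Finset.mem_filter.1 h
    exact Finset.mem_filter.2 ⟨Finset.mem_filter.2
      ⟨h1, Formula.mem_ball_vars_of_adj hr hj2 (Formula.adj_factorGraph.2 ⟨hj1, h⟩)⟩, h2⟩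

theorem Formula.edist_ball_le {Φ : Formula n m} (hr : Even r) {x : Fin n} {b : Fin n ⊕ Fin m}
    (p : Φ.factorGraph.Walk b (Sum.inl x)) (hp : p.length ≤ r) :
    (Φ.ball x r).factorGraph.edist b (Sum.inl x) ≤ p.length := by
  have key : ∀ {b c : Fin n ⊕ Fin m} (p : Φ.factorGraph.Walk b c), c = Sum.inl x → p.length ≤ r →
      (Φ.ball x r).factorGraph.edist b c ≤ p.length := by
    intro b c p hc
    induction p with
    | nil => simp
    | @cons u v w h p ih =>
      intro hp
      rw [SimpleGraph.Walk.length_cons] at hp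
      have hadj : (Φ.ball x r).factorGraph.Adj u v := by
        subst hc
        have hin : ∀ j, Φ.factorGraph.edist (Sum.inr j) (Sum.inl x) ≤ r → j ∈ Φ.clauses →
            j ∈ (Φ.ball x r).clauses := fun j h1 h2 =>
          Finset.mem_filter.2 ⟨h2, by rwa [SimpleGraph.edist_comm]⟩
        rcases u with u | u <;> rcases v with v | v
        · simp [Formula.factorGraph, SimpleGraph.fromRel_adj] at h
        · obtain ⟨h1, h2⟩ := Formula.adj_factorGraph.1 h
          have hv := hin v ((SimpleGraph.edist_le p).trans (by exact_mod_cast (by omega))) h1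
          exact Formula.adj_factorGraph.2 ⟨hv, by rwa [Formula.scope_ball hr hv]⟩
        · obtain ⟨h1, h2⟩ := Formula.adj_factorGraph.1 h.symm
          have hv := hin u ((SimpleGraph.edist_le (p.cons h)).trans
            (by rw [SimpleGraph.Walk.length_cons]; exact_mod_cast hp)) h1
          exact (Formula.adj_factorGraph.2 ⟨hv, by rwa [Formula.scope_ball hr hv]⟩).symm
        · simp [Formula.factorGraph, SimpleGraph.fromRel_adj] at h
      have h1 : (Φ.ball x r).factorGraph.edist u v = 1 := SimpleGraph.edist_eq_one_iff_adj.2 hadj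
      refine (SimpleGraph.edist_triangle (v := v)).trans ?_
      rw [h1, SimpleGraph.Walk.length_cons, add_comm]
      push_cast
      gcongr
      exact ih hc (by omega)
  exact key p rfl hp

theorem ball_mem_rootedSAT (hr : Even r) {Φ : Formula n m} (hΦ : Φ.IsReduced K) {x : Fin n}
    (hx : x ∈ Φ.vars) : (⟨Φ.ball x r, x⟩ : RootedFormula) ∈ RootedSAT K r := by
  refine ⟨Finset.mem_filter.2 ⟨hx, by simp⟩, ?_, ?_⟩
  · intro j hj
    change j ∈ (Φ.ball x r).clauses at hj
    change ((Φ.ball x r).scope j).card ≤ K ∧ (((Φ.ball x r).scope j).card = K ↔ Φ.sign j = 0)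
    rw [Formula.scope_ball hr hj]
    exact hΦ j (Finset.mem_filter.1 hj).1
  · intro i hi
    have hi' := (Finset.mem_filter.1 hi).2
    change Φ.factorGraph.edist (Sum.inl x) (Sum.inl i) ≤ r at hi'
    rw [SimpleGraph.edist_comm] at hi'
    obtain ⟨p, hp⟩ := SimpleGraph.exists_walk_of_edist_ne_top
      (ne_top_of_le_ne_top (ENat.natCast_ne_top r) hi')
    have hle : p.length ≤ r := by rw [← hp] at hi'; exact_mod_cast hi'
    change (Φ.ball x r).factorGraph.edist (Sum.inl x) (Sum.inl i) ≤ r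
    rw [SimpleGraph.edist_comm]
    exact (Formula.edist_ball_le hr p hle).trans (by exact_mod_cast hle)

end Facts

end NAESAT

/-!
The theorem holds because a rule that succeeds with probability bounded away from `0` infinitely
often cannot err locally, and a rule that does not err locally can be run several times with
correlated seeds.

*Success forces perfection on trees.* Suppose that, on some hypertree, some order and some seeds
make the rule violate a clause. For each ordering of the variables, the random clauses contain
linearly many isolated copies of this hypertree in expectation, since its number of vertices exceeds
`K - 1` times its number of edges by one. The copies are disjoint, so that changing one clause
changes their number by at most `2 K`, and the variance bound `variance_le_sum_sq` shows that there
are many with high probability. On each copy the seeds reproduce the error with a fixed positive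
probability, independently for different copies, so the algorithm fails with high probability. Hence
the hypothesis on the limes superior implies `TreePerfect τ`; this is `treePerfect_of_limsup_pos`.

*Perfection on trees extends to clauses without short cycles.* If no cycle is so short that it fits
in the neighbourhoods seen by the rule, a run on the given clauses lifts to a run on a finite piece
of their universal cover, which is a hypertree. So on such clauses the algorithm finds a satisfying
assignment for every order and all seeds (`TreePerfect.satisfies`). The absence of short cycles has
probability bounded away from `0` (`exists_le_acyclicCount`): one more clause creates a short cycle
with probability `O(1/n)`, conditionally on there being none before.

*Interpolation.* Fix clauses without short cycles in which the number of pairs of nearby variables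
is linear. An order that processes the variables colour by colour, for a proper colouring of nearby
variables with boundedly many colours, makes the output at most variables a function of the seeds
within a bounded distance. Take `k` runs that share the seeds outside an initial segment of
variables and use independent seeds on it. As the segment grows, the expected distance of two
outputs moves by small steps from `0` to about `n / 2`, the latter because a balanced rule commutes
with negation, and it is concentrated. So for some segment all pairwise distances lie in the
prescribed interval (`exists_seeds_of_local`, `overlapSAT_nonempty`).
-/

namespace NAESAT

/-! ### Neighbourhoods in terms of hops between variables -/

/-- `Within R x h v`: the vertex `v` can be reached from `x` by at most `h` steps along `R`. -/
def Within {α : Type*} (R : α → α → Prop) (x : α) : ℕ → α → Prop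
  | 0, v => v = x
  | h + 1, v => Within R x h v ∨ ∃ u, Within R x h u ∧ R u v

section Within

variable {α β : Type*} {R : α → α → Prop}

theorem Within.refl (x : α) (h : ℕ) : Within R x h x := by
  induction h with
  | zero => rfl
  | succ h ih => exact Or.inl ih

theorem Within.step {x u v : α} {h : ℕ} (hu : Within R x h u) (huv : R u v) :
    Within R x (h + 1) v := Or.inr ⟨u, hu, huv⟩

theorem Within.mono {x v : α} {h h' : ℕ} (hh : h ≤ h') (hv : Within R x h v) :
    Within R x h' v := by
  induction hh with
  | refl => exact hv
  | step _ ih => exact Or.inl ih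

theorem Within.trans {x u v : α} {h h' : ℕ} (hu : Within R x h u) (hv : Within R u h' v) :
    Within R x (h + h') v := by
  induction h' generalizing v with
  | zero => cases hv; exact hu
  | succ h' ih =>
    rcases hv with hv | ⟨w, hw, hwv⟩
    · exact Or.inl (ih hv)
    · exact Or.inr ⟨w, ih hw, hwv⟩

theorem Within.symm (hR : ∀ a b, R a b → R b a) {x v : α} {h : ℕ} (hv : Within R x h v) :
    Within R v h x := by
  induction h generalizing v with
  | zero => cases hv; rfl
  | succ h ih =>
    rcases hv with hv | ⟨w, hw, hwv⟩
    · exact Or.inl (ih hv)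
    · have h1 : Within R v 1 w := Or.inr ⟨v, rfl, hR _ _ hwv⟩
      have := h1.trans (ih hw)
      rwa [add_comm] at this

theorem Within.map {S : β → β → Prop} {f : α → β} {x v : α} {h : ℕ} (hv : Within R x h v)
    (hf : ∀ a b, R a b → S (f a) (f b)) : Within S (f x) h (f v) := by
  induction h generalizing v with
  | zero => cases hv; rfl
  | succ h ih =>
    rcases hv with hv | ⟨w, hw, hwv⟩
    · exact Or.inl (ih hv)
    · exact Or.inr ⟨f w, ih hw, hf _ _ hwv⟩

end Within

namespace Formula

variable {n m n' m' : ℕ}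

/-- Two variables of an instance are a hop apart if they appear in a common clause. -/
def Hop (Ψ : Formula n m) (u v : Fin n) : Prop :=
  ∃ j ∈ Ψ.clauses, u ∈ Ψ.scope j ∧ v ∈ Ψ.scope j

theorem Hop.symm {Ψ : Formula n m} (u v : Fin n) (h : Ψ.Hop u v) : Ψ.Hop v u := by
  obtain ⟨j, hj, h1, h2⟩ := h
  exact ⟨j, hj, h2, h1⟩

theorem edist_le_of_within {Ψ : Formula n m} {x v : Fin n} {h : ℕ} (hv : Within Ψ.Hop x h v) :
    Ψ.factorGraph.edist (Sum.inl x) (Sum.inl v) ≤ ((2 * h : ℕ) : ℕ∞) := by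
  induction h generalizing v with
  | zero => cases hv; simp
  | succ h ih =>
    rcases hv with hv | ⟨u, hu, j, hj, h1, h2⟩
    · exact (ih hv).trans (by exact_mod_cast (by omega))
    · have e1 : Ψ.factorGraph.edist (Sum.inl u) (Sum.inr j) = 1 :=
        SimpleGraph.edist_eq_one_iff_adj.2 (adj_factorGraph.2 ⟨hj, h1⟩)
      have e2 : Ψ.factorGraph.edist (Sum.inr j) (Sum.inl v) = 1 :=
        SimpleGraph.edist_eq_one_iff_adj.2 (adj_factorGraph.2 ⟨hj, h2⟩).symm
      calc _ ≤ _ := SimpleGraph.edist_triangle (v := Sum.inl u)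
        _ ≤ ((2 * h : ℕ) : ℕ∞) + (Ψ.factorGraph.edist (Sum.inl u) (Sum.inr j) +
            Ψ.factorGraph.edist (Sum.inr j) (Sum.inl v)) :=
          add_le_add (ih hu) SimpleGraph.edist_triangle
        _ = _ := by rw [e1, e2]; push_cast; ring

theorem within_of_walk {Ψ : Formula n m} {h : ℕ} {x v : Fin n}
    (p : Ψ.factorGraph.Walk (Sum.inl x) (Sum.inl v)) (hp : p.length ≤ 2 * h) :
    Within Ψ.Hop x h v := by
  induction h generalizing x with
  | zero =>
    have h1 := SimpleGraph.Walk.eq_of_length_eq_zero (Nat.le_zero.1 hp)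
    cases h1
    rfl
  | succ h ih =>
    cases p with
    | nil => exact Within.refl _ _
    | @cons _ a _ hxa q =>
      rcases a with a | j
      · simp [Formula.factorGraph, SimpleGraph.fromRel_adj] at hxa
      · cases q with
        | @cons _ b _ hjb q' =>
          rcases b with y | b
          · obtain ⟨hj, h1⟩ := adj_factorGraph.1 hxa
            obtain ⟨_, h2⟩ := adj_factorGraph.1 hjb.symm
            simp only [SimpleGraph.Walk.length_cons] at hp
            have h3 : Within Ψ.Hop x 1 y := Or.inr ⟨x, rfl, j, hj, h1, h2⟩
            have h4 := h3.trans (ih q' (by omega))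
            rwa [add_comm] at h4
          · simp [Formula.factorGraph, SimpleGraph.fromRel_adj] at hjb

theorem edist_le_iff_within {Ψ : Formula n m} {x v : Fin n} {h : ℕ} :
    Ψ.factorGraph.edist (Sum.inl x) (Sum.inl v) ≤ ((2 * h : ℕ) : ℕ∞) ↔ Within Ψ.Hop x h v := by
  refine ⟨fun hd => ?_, edist_le_of_within⟩
  obtain ⟨p, hp⟩ := SimpleGraph.exists_walk_of_edist_ne_top
    (ne_top_of_le_ne_top (ENat.natCast_ne_top _) hd)
  rw [← hp] at hd
  exact within_of_walk p (by exact_mod_cast hd)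

theorem edist_clause_le_iff {Ψ : Formula n m} {x : Fin n} {j : Fin m} {h : ℕ}
    (hj : j ∈ Ψ.clauses) :
    Ψ.factorGraph.edist (Sum.inl x) (Sum.inr j) ≤ ((2 * (h + 1) : ℕ) : ℕ∞) ↔
      ∃ u, Within Ψ.Hop x h u ∧ u ∈ Ψ.scope j := by
  constructor
  · intro hd
    rw [SimpleGraph.edist_comm] at hd
    obtain ⟨p, hp⟩ := SimpleGraph.exists_walk_of_edist_ne_top
      (ne_top_of_le_ne_top (ENat.natCast_ne_top _) hd)
    rw [← hp] at hd
    have hl : p.length ≤ 2 * (h + 1) := by exact_mod_cast hd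
    cases p with
    | @cons _ a _ hja q =>
      rcases a with u | a
      · have hpar := (walk_parity q).2 rfl
        simp only [SimpleGraph.Walk.length_cons] at hl
        have hq : q.length ≤ 2 * h := by
          obtain ⟨t, ht⟩ := hpar
          omega
        exact ⟨u, (within_of_walk q hq).symm Hop.symm, (adj_factorGraph.1 hja.symm).2⟩
      · simp [Formula.factorGraph, SimpleGraph.fromRel_adj] at hja
  · rintro ⟨u, hu, huj⟩
    have e1 : Ψ.factorGraph.edist (Sum.inl u) (Sum.inr j) = 1 :=
      SimpleGraph.edist_eq_one_iff_adj.2 (adj_factorGraph.2 ⟨hj, huj⟩)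
    calc _ ≤ _ := SimpleGraph.edist_triangle (v := Sum.inl u)
      _ ≤ ((2 * h : ℕ) : ℕ∞) + 1 := add_le_add (edist_le_of_within hu) e1.le
      _ ≤ _ := by exact_mod_cast (by omega)

theorem mem_ball_vars {Ψ : Formula n m} {x v : Fin n} {ρ : ℕ} :
    v ∈ (Ψ.ball x (2 * ρ)).vars ↔ v ∈ Ψ.vars ∧ Within Ψ.Hop x ρ v := by
  rw [← edist_le_iff_within]
  exact Finset.mem_filter

theorem mem_ball_clauses {Ψ : Formula n m} {x : Fin n} {j : Fin m} {ρ : ℕ} :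
    j ∈ (Ψ.ball x (2 * (ρ + 1))).clauses ↔
      j ∈ Ψ.clauses ∧ ∃ u, Within Ψ.Hop x ρ u ∧ u ∈ Ψ.scope j := by
  constructor
  · intro h
    obtain ⟨h1, h2⟩ := Finset.mem_filter.1 h
    exact ⟨h1, (edist_clause_le_iff h1).1 h2⟩
  · rintro ⟨h1, h2⟩
    exact Finset.mem_filter.2 ⟨h1, (edist_clause_le_iff h1).2 h2⟩

/-- A pair of maps between the variables and the clauses of two instances which is locally a
covering, and which is injective on the depth-`2 (ρ + 1)` neighbourhood of `x`, restricts to an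
isomorphism between the neighbourhoods of `x` and of its image. -/
theorem ball_iso {Ψ : Formula n m} {Ψ' : Formula n' m'} {ρ : ℕ} {x : Fin n}
    (π : Fin n → Fin n') (κ : Fin m → Fin m') (hx : x ∈ Ψ.vars) (hx' : π x ∈ Ψ'.vars)
    (hmap : ∀ u, Within Ψ.Hop x ρ u → ∀ j ∈ Ψ.clauses, u ∈ Ψ.scope j →
      κ j ∈ Ψ'.clauses ∧ Ψ'.sign (κ j) = Ψ.sign j ∧
      (∀ v ∈ Ψ.scope j, π v ∈ Ψ'.scope (κ j) ∧ Ψ'.lit (κ j) (π v) = Ψ.lit j v) ∧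
      ∀ v' ∈ Ψ'.scope (κ j), ∃ v ∈ Ψ.scope j, π v = v')
    (hlift : ∀ u, Within Ψ.Hop x ρ u → ∀ j' ∈ Ψ'.clauses, π u ∈ Ψ'.scope j' →
      ∃ j ∈ Ψ.clauses, u ∈ Ψ.scope j ∧ κ j = j')
    (hπ : ∀ u v, Within Ψ.Hop x (ρ + 1) u → Within Ψ.Hop x (ρ + 1) v → π u = π v → u = v)
    (hκ : ∀ j j', j ∈ Ψ.clauses → j' ∈ Ψ.clauses →
      (∃ u, Within Ψ.Hop x ρ u ∧ u ∈ Ψ.scope j) → (∃ u, Within Ψ.Hop x ρ u ∧ u ∈ Ψ.scope j') →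
      κ j = κ j' → j = j') :
    RootedFormula.Iso ⟨Ψ.ball x (2 * (ρ + 1)), x⟩ ⟨Ψ'.ball (π x) (2 * (ρ + 1)), π x⟩ := by
  have hsub : ∀ {j v}, v ∈ Ψ.scope j → v ∈ Ψ.vars := fun h => (Finset.mem_filter.1 h).1
  have hsub' : ∀ {j v}, v ∈ Ψ'.scope j → v ∈ Ψ'.vars := fun h => (Finset.mem_filter.1 h).1
  -- paths from `x` are mapped to paths from `π x`
  have hfwd : ∀ h ≤ ρ + 1, ∀ v, Within Ψ.Hop x h v →
      Within Ψ'.Hop (π x) h (π v) ∧ v ∈ Ψ.vars ∧ π v ∈ Ψ'.vars := by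
    intro h
    induction h with
    | zero => intro _ v hv; cases hv; exact ⟨rfl, hx, hx'⟩
    | succ h ih =>
      intro hh v hv
      rcases hv with hv | ⟨u, hu, j, hj, h1, h2⟩
      · obtain ⟨h1, h2⟩ := ih (by omega) v hv
        exact ⟨Or.inl h1, h2⟩
      · obtain ⟨a, -, b, -⟩ := hmap u (hu.mono (by omega)) j hj h1
        exact ⟨(ih (by omega) u hu).1.step ⟨κ j, a, (b u h1).1, (b v h2).1⟩, hsub h2,
          hsub' (b v h2).1⟩
  -- paths from `π x` lift to paths from `x`
  have hbwd : ∀ h ≤ ρ + 1, ∀ v', Within Ψ'.Hop (π x) h v' → ∃ v, Within Ψ.Hop x h v ∧ π v = v' := by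
    intro h
    induction h with
    | zero => intro _ v' hv; cases hv; exact ⟨x, rfl, rfl⟩
    | succ h ih =>
      intro hh v' hv
      rcases hv with hv | ⟨u', hu', j', hj', h1, h2⟩
      · obtain ⟨v, h1, h2⟩ := ih (by omega) v' hv
        exact ⟨v, Or.inl h1, h2⟩
      · obtain ⟨u, hu, rfl⟩ := ih (by omega) u' hu'
        obtain ⟨j, hj, huj, rfl⟩ := hlift u (hu.mono (by omega)) j' hj' h1
        obtain ⟨v, hv, rfl⟩ := (hmap u (hu.mono (by omega)) j hj huj).2.2.2 v' h2
        exact ⟨v, hu.step ⟨j, hj, huj, hv⟩, rfl⟩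
  let fv : (Ψ.ball x (2 * (ρ + 1))).vars → (Ψ'.ball (π x) (2 * (ρ + 1))).vars := fun v =>
    ⟨π v, mem_ball_vars.2 (hfwd _ le_rfl v (mem_ball_vars.1 v.2).2 |> fun h => ⟨h.2.2, h.1⟩)⟩
  let fc : (Ψ.ball x (2 * (ρ + 1))).clauses → (Ψ'.ball (π x) (2 * (ρ + 1))).clauses := fun j =>
    ⟨κ j, by
      obtain ⟨h1, u, h2, h3⟩ := mem_ball_clauses.1 j.2
      obtain ⟨a, -, b, -⟩ := hmap u h2 j h1 h3
      exact mem_ball_clauses.2 ⟨a, π u, (hfwd ρ (by omega) u h2).1, (b u h3).1⟩⟩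
  have hfv : Function.Bijective fv := by
    constructor
    · intro u v h
      exact Subtype.ext (hπ u v (mem_ball_vars.1 u.2).2 (mem_ball_vars.1 v.2).2
        (congrArg Subtype.val h))
    · rintro ⟨v', hv'⟩
      obtain ⟨v, h1, h2⟩ := hbwd _ le_rfl v' (mem_ball_vars.1 hv').2
      exact ⟨⟨v, mem_ball_vars.2 ⟨(hfwd _ le_rfl v h1).2.1, h1⟩⟩, Subtype.ext h2⟩
  have hfc : Function.Bijective fc := by
    constructor
    · intro j j' h
      obtain ⟨h1, h2⟩ := mem_ball_clauses.1 j.2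
      obtain ⟨h1', h2'⟩ := mem_ball_clauses.1 j'.2
      exact Subtype.ext (hκ j j' h1 h1' h2 h2' (congrArg Subtype.val h))
    · rintro ⟨j', hj'⟩
      obtain ⟨h1, u', h2, h3⟩ := mem_ball_clauses.1 hj'
      obtain ⟨u, hu, rfl⟩ := hbwd ρ (by omega) u' h2
      obtain ⟨j, hj, huj, rfl⟩ := hlift u hu j' h1 h3
      exact ⟨⟨j, mem_ball_clauses.2 ⟨hj, u, hu, huj⟩⟩, rfl⟩
  refine ⟨Equiv.ofBijective fv hfv, Equiv.ofBijective fc hfc, ?_, ?_, ?_⟩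
  · rintro ⟨i, hi⟩
    change i = x ↔ π i = π x
    exact ⟨fun h => h ▸ rfl, fun h => hπ i x (mem_ball_vars.1 hi).2 (Within.refl _ _) h⟩
  · rintro ⟨j, hj⟩ ⟨i, hi⟩
    change Ψ'.lit (κ j) (π i) = Ψ.lit j i
    obtain ⟨h1, u, h2, h3⟩ := mem_ball_clauses.1 hj
    obtain ⟨hi1, hi2⟩ := mem_ball_vars.1 hi
    obtain ⟨-, -, b, c⟩ := hmap u h2 j h1 h3
    by_cases h : i ∈ Ψ.scope j
    · exact (b i h).2
    · have hn : Ψ.lit j i = none := by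
        by_contra hne
        exact h (Finset.mem_filter.2 ⟨hi1, hne⟩)
      rw [hn]
      by_contra hne
      obtain ⟨v, hv, hvi⟩ := c (π i) (Finset.mem_filter.2 ⟨(hfwd _ le_rfl i hi2).2.2, hne⟩)
      have := hπ v i (h2.step ⟨j, h1, h3, hv⟩) hi2 hvi
      exact h (this ▸ hv)
  · rintro ⟨j, hj⟩
    obtain ⟨h1, u, h2, h3⟩ := mem_ball_clauses.1 hj
    exact (hmap u h2 j h1 h3).2.1

end Formula

/-! ### Reduced instances in closed form, and runs of the algorithm -/

section Residual

variable {n m n' m' K ρ : ℕ}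

/-- Two variables are linked by the clauses `C` if they appear in a common clause. -/
def Linked (C : Fin m → Fin n → Option Bool) (u v : Fin n) : Prop :=
  ∃ j, C j u ≠ none ∧ C j v ≠ none

theorem Linked.symm {C : Fin m → Fin n → Option Bool} (u v : Fin n) (h : Linked C u v) :
    Linked C v u := by
  obtain ⟨j, h1, h2⟩ := h
  exact ⟨j, h2, h1⟩

/-- Every clause of `C` has exactly `K` literals. -/
def IsUniform (K : ℕ) (C : Fin m → Fin n → Option Bool) : Prop :=
  ∀ j, (Finset.univ.filter fun i => C j i ≠ none).card = K

/-- The reduced instance that remains of the clauses `C` (of sign `0`) once the variables in `P`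
have received their values under `σ`.  A clause survives iff it has an unset variable and its set
literals do not take both values; its sign records the common value of its set literals. -/
def residual (C : Fin m → Fin n → Option Bool) (P : Finset (Fin n)) (σ : Fin n → Bool) :
    Formula n m where
  vars := Pᶜ
  clauses := {j | (∃ i ∉ P, C j i ≠ none) ∧
    ¬((∃ i ∈ P, C j i = some (σ i)) ∧ ∃ i ∈ P, C j i = some (!σ i))}
  lit := C
  sign := fun j => if ∃ i ∈ P, C j i = some (σ i) then 1
    else if ∃ i ∈ P, C j i = some (!σ i) then -1 else 0

variable {C : Fin m → Fin n → Option Bool} {C' : Fin m' → Fin n' → Option Bool}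
  {P : Finset (Fin n)} {P' : Finset (Fin n')} {σ : Fin n → Bool} {σ' : Fin n' → Bool}

theorem mem_residual_clauses {j : Fin m} : j ∈ (residual C P σ).clauses ↔
    (∃ i ∉ P, C j i ≠ none) ∧
      ¬((∃ i ∈ P, C j i = some (σ i)) ∧ ∃ i ∈ P, C j i = some (!σ i)) := by
  simp [residual]

theorem mem_residual_scope {j : Fin m} {i : Fin n} :
    i ∈ (residual C P σ).scope j ↔ i ∉ P ∧ C j i ≠ none := by
  simp [residual, Formula.scope]

theorem eq_some_or_eq_some_not {o : Option Bool} (h : o ≠ none) (b : Bool) :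
    o = some b ∨ o = some (!b) := by
  rcases o with - | o
  · exact absurd rfl h
  · cases o <;> cases b <;> simp

theorem isReduced_residual (hC : IsUniform K C) : (residual C P σ).IsReduced K := by
  intro j _
  have hs : (residual C P σ).scope j ⊆ Finset.univ.filter fun i => C j i ≠ none := fun i hi =>
    Finset.mem_filter.2 ⟨Finset.mem_univ _, (mem_residual_scope.1 hi).2⟩
  have hle := Finset.card_le_card hs
  rw [hC j] at hle
  refine ⟨hle, ?_⟩
  have hiff : ((residual C P σ).scope j).card = K ↔ ∀ i ∈ P, C j i = none := by
    constructor
    · intro h i hi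
      by_contra hne
      have := Finset.eq_of_subset_of_card_le hs (by rw [hC j, h])
      have h2 : i ∈ (residual C P σ).scope j := this ▸ Finset.mem_filter.2 ⟨Finset.mem_univ _, hne⟩
      exact (mem_residual_scope.1 h2).1 hi
    · intro h
      rw [← hC j]
      congr 1
      refine Finset.Subset.antisymm hs fun i hi => mem_residual_scope.2 ?_
      have := (Finset.mem_filter.1 hi).2
      exact ⟨fun hP => this (h i hP), this⟩
  rw [hiff]
  simp only [residual]
  constructor
  · intro h
    rw [if_neg, if_neg]
    · rintro ⟨i, hi, h2⟩; rw [h i hi] at h2; cases h2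
    · rintro ⟨i, hi, h2⟩; rw [h i hi] at h2; cases h2
  · intro h i hi
    by_contra hne
    rcases eq_some_or_eq_some_not hne (σ i) with h1 | h1
    · rw [if_pos ⟨i, hi, h1⟩] at h; cases h
    · split_ifs at h with h2 h3
      exact h3 ⟨i, hi, h1⟩

theorem LocalRule.prob_eq_of_iso (τ : LocalRule K (2 * (ρ + 1))) {Ψ : Formula n m}
    {Ψ' : Formula n' m'} (h : Ψ.IsReduced K) (h' : Ψ'.IsReduced K) {x : Fin n} {x' : Fin n'}
    (hx : x ∈ Ψ.vars) (hx' : x' ∈ Ψ'.vars)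
    (hiso : RootedFormula.Iso ⟨Ψ.ball x (2 * (ρ + 1)), x⟩ ⟨Ψ'.ball x' (2 * (ρ + 1)), x'⟩) :
    τ.prob Ψ x = τ.prob Ψ' x' := by
  have h1 := ball_mem_rootedSAT (r := 2 * (ρ + 1)) (even_two_mul _) h hx
  have h2 := ball_mem_rootedSAT (r := 2 * (ρ + 1)) (even_two_mul _) h' hx'
  rw [LocalRule.prob, dif_pos h1, LocalRule.prob, dif_pos h2, τ.iso_invariant ⟨_, h1⟩ ⟨_, h2⟩ hiso]

theorem LocalRule.prob_mem_Icc {r : ℕ} (τ : LocalRule K r) (Ψ : Formula n m) (x : Fin n) :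
    τ.prob Ψ x ∈ Set.Icc (0 : ℝ) 1 := by
  rw [LocalRule.prob]
  split_ifs with h
  · exact (τ.toFun _).2
  · exact ⟨le_rfl, zero_le_one⟩

theorem within_linked_of_hop {x v : Fin n} {h : ℕ}
    (hv : Within (residual C P σ).Hop x h v) : Within (Linked C) x h v := by
  refine hv.map (f := id) ?_
  rintro a b ⟨j, -, h1, h2⟩
  exact ⟨j, (mem_residual_scope.1 h1).2, (mem_residual_scope.1 h2).2⟩

/-- The locality of the algorithm: the probability used at `x` is not changed by a pair of maps
which is a covering of the clauses near `x`, is injective near `x`, and respects which of the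
variables near `x` have been set and their values. -/
theorem prob_residual_eq (τ : LocalRule K (2 * (ρ + 1))) (hC : IsUniform K C)
    (hC' : IsUniform K C') {x : Fin n} (π : Fin n → Fin n') (κ : Fin m → Fin m')
    (hxP : x ∉ P)
    (hmap : ∀ u, Within (Linked C) x ρ u → ∀ j, C j u ≠ none →
      (∀ v, C j v ≠ none → C' (κ j) (π v) = C j v) ∧
      ∀ v', C' (κ j) v' ≠ none → ∃ v, C j v ≠ none ∧ π v = v')
    (hlift : ∀ u, Within (Linked C) x ρ u → ∀ j', C' j' (π u) ≠ none →
      ∃ j, C j u ≠ none ∧ κ j = j')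
    (hπ : ∀ u v, Within (Linked C) x (ρ + 1) u → Within (Linked C) x (ρ + 1) v →
      π u = π v → u = v)
    (hκ : ∀ j j', (∃ u, Within (Linked C) x ρ u ∧ C j u ≠ none) →
      (∃ u, Within (Linked C) x ρ u ∧ C j' u ≠ none) → κ j = κ j' → j = j')
    (hP : ∀ v, Within (Linked C) x (ρ + 1) v → (v ∈ P ↔ π v ∈ P'))
    (hσ : ∀ v, Within (Linked C) x (ρ + 1) v → v ∈ P → σ' (π v) = σ v) :
    τ.prob (residual C P σ) x = τ.prob (residual C' P' σ') (π x) := by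
  have hxP' : π x ∉ P' := fun h => hxP ((hP x (Within.refl _ _)).2 h)
  have hx : x ∈ (residual C P σ).vars := Finset.mem_compl.2 hxP
  have hx' : π x ∈ (residual C' P' σ').vars := Finset.mem_compl.2 hxP'
  -- literals of set variables correspond
  have key : ∀ u, Within (Linked C) x ρ u → ∀ j, C j u ≠ none → ∀ f : Bool → Bool,
      (∃ i ∈ P, C j i = some (f (σ i))) ↔ ∃ i ∈ P', C' (κ j) i = some (f (σ' i)) := by
    intro u hu j hj f
    obtain ⟨h1, h2⟩ := hmap u hu j hj
    constructor
    · rintro ⟨i, hi, hji⟩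
      have hne : C j i ≠ none := by rw [hji]; simp
      have hw := hu.step (v := i) ⟨j, hj, hne⟩
      refine ⟨π i, (hP i hw).1 hi, ?_⟩
      rw [h1 i hne, hσ i hw hi, hji]
    · rintro ⟨i', hi, hji⟩
      obtain ⟨i, hne, rfl⟩ := h2 i' (by rw [hji]; simp)
      have hw := hu.step (v := i) ⟨j, hj, hne⟩
      have hiP := (hP i hw).2 hi
      refine ⟨i, hiP, ?_⟩
      rw [← h1 i hne, ← hσ i hw hiP, hji]
  have key2 : ∀ u, Within (Linked C) x ρ u → ∀ j, C j u ≠ none →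
      ((∃ i ∉ P, C j i ≠ none) ↔ ∃ i ∉ P', C' (κ j) i ≠ none) := by
    intro u hu j hj
    obtain ⟨h1, h2⟩ := hmap u hu j hj
    constructor
    · rintro ⟨i, hi, hne⟩
      have hw := hu.step (v := i) ⟨j, hj, hne⟩
      exact ⟨π i, fun h => hi ((hP i hw).2 h), by rwa [h1 i hne]⟩
    · rintro ⟨i', hi, hji⟩
      obtain ⟨i, hne, rfl⟩ := h2 i' hji
      have hw := hu.step (v := i) ⟨j, hj, hne⟩
      exact ⟨i, fun h => hi ((hP i hw).1 h), hne⟩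
  have key3 : ∀ u, Within (Linked C) x ρ u → ∀ j, C j u ≠ none →
      (j ∈ (residual C P σ).clauses ↔ κ j ∈ (residual C' P' σ').clauses) := by
    intro u hu j hj
    have e1 := key u hu j hj id
    have e2 := key u hu j hj not
    simp only [id] at e1
    rw [mem_residual_clauses, mem_residual_clauses, key2 u hu j hj, e1, e2]
  refine τ.prob_eq_of_iso (isReduced_residual hC) (isReduced_residual hC') hx hx'
    (Formula.ball_iso π κ hx hx' ?_ ?_ ?_ ?_)
  · intro u hu j hj huj
    have hw := within_linked_of_hop hu
    have hju := (mem_residual_scope.1 huj).2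
    obtain ⟨h1, h2⟩ := hmap u hw j hju
    refine ⟨(key3 u hw j hju).1 hj, ?_, ?_, ?_⟩
    · have e1 := key u hw j hju id
      have e2 := key u hw j hju not
      simp only [id] at e1
      simp only [residual, e1, e2]
    · intro v hv
      obtain ⟨hvP, hjv⟩ := mem_residual_scope.1 hv
      have hw' := hw.step (v := v) ⟨j, hju, hjv⟩
      exact ⟨mem_residual_scope.2 ⟨fun h => hvP ((hP v hw').2 h), by rwa [h1 v hjv]⟩, h1 v hjv⟩
    · intro v' hv'
      obtain ⟨hvP, hjv⟩ := mem_residual_scope.1 hv'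
      obtain ⟨v, hv, rfl⟩ := h2 v' hjv
      have hw' := hw.step (v := v) ⟨j, hju, hv⟩
      exact ⟨v, mem_residual_scope.2 ⟨fun h => hvP ((hP v hw').1 h), hv⟩, rfl⟩
  · intro u hu j' hj' huj
    have hw := within_linked_of_hop hu
    obtain ⟨j, hju, rfl⟩ := hlift u hw j' (mem_residual_scope.1 huj).2
    refine ⟨j, (key3 u hw j hju).2 hj', mem_residual_scope.2 ⟨fun h => ?_, hju⟩, rfl⟩
    exact (mem_residual_scope.1 huj).1 ((hP u (Or.inl hw)).1 h)
  · exact fun u v hu hv => hπ u v (within_linked_of_hop hu) (within_linked_of_hop hv)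
  · rintro j j' - - ⟨u, hu, huj⟩ ⟨u', hu', huj'⟩
    exact hκ j j' ⟨u, within_linked_of_hop hu, (mem_residual_scope.1 huj).2⟩
      ⟨u', within_linked_of_hop hu', (mem_residual_scope.1 huj').2⟩

/-- The probability used at `x` depends only on the values of the set variables near `x`. -/
theorem prob_residual_congr (τ : LocalRule K (2 * (ρ + 1))) (hC : IsUniform K C) {x : Fin n}
    (hxP : x ∉ P) {σ₁ σ₂ : Fin n → Bool}
    (hσ : ∀ v, Within (Linked C) x (ρ + 1) v → v ∈ P → σ₁ v = σ₂ v) :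
    τ.prob (residual C P σ₁) x = τ.prob (residual C P σ₂) x :=
  prob_residual_eq τ hC hC id id hxP (fun _ _ _ _ => ⟨fun _ _ => rfl, fun v hv => ⟨v, hv, rfl⟩⟩)
    (fun _ _ j hj => ⟨j, hj, rfl⟩) (fun _ _ _ _ h => h) (fun _ _ _ _ h => h)
    (fun _ _ => Iff.rfl) fun v hv hvP => (hσ v hv hvP).symm

theorem compl_residual_iso {x : Fin n} (hxP : x ∉ P) :
    RootedFormula.Iso ⟨(residual C P fun i => !σ i).ball x (2 * (ρ + 1)), x⟩
      ⟨(residual C P σ).compl.ball x (2 * (ρ + 1)), x⟩ := by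
  have hx : x ∈ (residual C P σ).vars := Finset.mem_compl.2 hxP
  refine Formula.ball_iso id id hx hx ?_ ?_ (fun _ _ _ _ h => h) (fun _ _ _ _ _ _ h => h)
  · intro u _ j hj _
    obtain ⟨h1, h2⟩ := mem_residual_clauses.1 hj
    refine ⟨?_, ?_, fun v hv => ⟨hv, rfl⟩, fun v hv => ⟨v, hv, rfl⟩⟩
    · refine mem_residual_clauses.2 ⟨h1, fun h => h2 ⟨h.2, ?_⟩⟩
      simpa using h.1
    · change -(residual C P σ).sign j = (residual C P fun i => !σ i).sign j
      simp only [residual, Bool.not_not] at h2 ⊢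
      split_ifs with h3 h4 h4
      · exact absurd ⟨h4, h3⟩ h2
      · rfl
      · rfl
      · rfl
  · intro u _ j hj huj
    refine ⟨j, ?_, huj, rfl⟩
    obtain ⟨h1, h2⟩ := mem_residual_clauses.1 hj
    refine mem_residual_clauses.2 ⟨h1, fun h => h2 ⟨?_, h.1⟩⟩
    simpa using h.2

theorem isReduced_compl {Ψ : Formula n m} (h : Ψ.IsReduced K) : Ψ.compl.IsReduced K := by
  intro j hj
  refine ⟨(h j hj).1, ((h j hj).2).trans ?_⟩
  change Ψ.sign j = 0 ↔ -Ψ.sign j = 0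
  cases Ψ.sign j <;> decide

theorem LocalRule.IsBalanced.prob_not {τ : LocalRule K (2 * (ρ + 1))} (hτ : τ.IsBalanced)
    (hC : IsUniform K C) {x : Fin n} (hxP : x ∉ P) :
    τ.prob (residual C P fun i => !σ i) x = 1 - τ.prob (residual C P σ) x := by
  have hx : x ∈ (residual C P σ).vars := Finset.mem_compl.2 hxP
  have hr := isReduced_residual (P := P) (σ := σ) hC
  have hr' := isReduced_residual (P := P) (σ := fun i => !σ i) hC
  have e := τ.prob_eq_of_iso hr' (isReduced_compl hr) (x := x) (x' := x) hx hx
    (compl_residual_iso hxP)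
  have h1 := ball_mem_rootedSAT (r := 2 * (ρ + 1)) (even_two_mul _) hr hx
  have h2 := ball_mem_rootedSAT (r := 2 * (ρ + 1)) (even_two_mul _) (isReduced_compl hr)
    (x := x) hx
  have e1 : τ.prob (residual C P σ).compl x = τ.toFun ⟨_, h2⟩ := dif_pos h2
  have e2 : τ.prob (residual C P σ) x = τ.toFun ⟨_, h1⟩ := dif_pos h1
  rw [e, e1, e2]
  exact hτ ⟨_, h1⟩

/-- The variables that come before `x` in the order given by the ranks `ord`. -/
def before (ord : Fin n → ℕ) (x : Fin n) : Finset (Fin n) := {y | ord y < ord x}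

theorem mem_before {ord : Fin n → ℕ} {x y : Fin n} : y ∈ before ord x ↔ ord y < ord x := by
  simp [before]

theorem notMem_before_self {ord : Fin n → ℕ} {x : Fin n} : x ∉ before ord x := by
  simp [before]

/-- `σ` is the output of the sequential algorithm on the clauses `C` when the variables are
processed by increasing `ord` and `x` receives the value `dec x p`, where `p` is the probability
assigned by `τ` to the neighbourhood of `x` in the current reduced instance. -/
def IsRun {r : ℕ} (τ : LocalRule K r) (C : Fin m → Fin n → Option Bool) (ord : Fin n → ℕ)
    (dec : Fin n → ℝ → Bool) (σ : Fin n → Bool) : Prop :=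
  ∀ x, σ x = dec x (τ.prob (residual C (before ord x) σ) x)

theorem residual_congr {σ₁ σ₂ : Fin n → Bool} (h : ∀ v ∈ P, σ₁ v = σ₂ v) :
    residual C P σ₁ = residual C P σ₂ := by
  have h1 : ∀ (j : Fin m) (f : Bool → Bool), (∃ i ∈ P, C j i = some (f (σ₁ i))) ↔
      ∃ i ∈ P, C j i = some (f (σ₂ i)) := fun j f =>
    exists_congr fun i => and_congr_right fun hi => by rw [h i hi]
  have h2 := fun j => h1 j id
  have h3 := fun j => h1 j not
  simp only [id] at h2
  simp only [residual, h2, h3]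

theorem exists_isRun {r : ℕ} (τ : LocalRule K r) (C : Fin m → Fin n → Option Bool)
    (ord : Fin n → ℕ) (dec : Fin n → ℝ → Bool) : ∃ σ, IsRun τ C ord dec σ := by
  classical
  have wf : WellFounded fun y x : Fin n => ord y < ord x := InvImage.wf ord Nat.lt_wfRel.wf
  let F : ∀ x : Fin n, (∀ y : Fin n, ord y < ord x → Bool) → Bool := fun x rec =>
    dec x (τ.prob
      (residual C (before ord x) fun y => if h : ord y < ord x then rec y h else false) x)
  refine ⟨wf.fix F, fun x => ?_⟩
  rw [wf.fix_eq]
  change dec x _ = dec x _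
  congr 2
  refine residual_congr fun v hv => ?_
  rw [dif_pos (mem_before.1 hv)]

theorem IsRun.ext {r : ℕ} {τ : LocalRule K r} {ord : Fin n → ℕ} {dec : Fin n → ℝ → Bool}
    {σ₁ σ₂ : Fin n → Bool} (h1 : IsRun τ C ord dec σ₁) (h2 : IsRun τ C ord dec σ₂) : σ₁ = σ₂ := by
  have : ∀ t x, ord x = t → σ₁ x = σ₂ x := by
    intro t
    induction t using Nat.strong_induction_on with
    | _ t ih =>
      intro x hx
      rw [h1 x, h2 x, residual_congr fun v hv => ih (ord v) (hx ▸ mem_before.1 hv) v rfl]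
  exact funext fun x => this _ x rfl

/-- `σ` leaves no clause of `C` without a true or without a false literal. -/
def Satisfies (C : Fin m → Fin n → Option Bool) (σ : Fin n → Bool) : Prop :=
  ∀ j, (∃ i, C j i = some (σ i)) ∧ ∃ i, C j i = some (!σ i)

theorem mem_SAT_toFormula {C : Fin m → KClause n K} :
    σ ∈ (toFormula C).SAT ↔ Satisfies (fun j => (C j).1) σ := by
  have h1 : ∀ j i (b : Bool), (i ∈ (toFormula C).scope j ∧ (toFormula C).lit j i = some b) ↔
      (C j).1 i = some b := by
    intro j i b
    refine ⟨fun h => h.2, fun h => ⟨Finset.mem_filter.2 ⟨Finset.mem_univ _, fun h' => ?_⟩, h⟩⟩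
    exact Option.some_ne_none b (h.symm.trans h')
  have h2 : ∀ j (b : Bool), (∃ i ∈ (toFormula C).scope j, (toFormula C).lit j i = some (b ^^ σ i)) ↔
      ∃ i, (C j).1 i = some (b ^^ σ i) := fun j b => exists_congr fun i => h1 j i _
  constructor
  · intro h j
    obtain ⟨ha, hb⟩ := h j (Finset.mem_univ _)
    refine ⟨?_, ?_⟩
    · have := (h2 j false).1 (by simpa [Formula.HasTrueLit] using hb le_rfl)
      simpa using this
    · have := (h2 j true).1 (by simpa [Formula.HasFalseLit] using ha le_rfl)
      simpa using this
  · intro h j _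
    obtain ⟨ha, hb⟩ := h j
    refine ⟨fun _ => ?_, fun _ => ?_⟩
    · have := (h2 j true).2 (by simpa using hb)
      simpa [Formula.HasFalseLit] using this
    · have := (h2 j false).2 (by simpa using ha)
      simpa [Formula.HasTrueLit] using this

/-- The decision with seed `b`: the value is `b` unless `τ` forces it. -/
noncomputable def seedDec (b : Bool) (p : ℝ) : Bool :=
  if 1 ≤ p then true else if p ≤ 0 then false else b

theorem seedDec_not {b : Bool} {p : ℝ} : seedDec (!b) (1 - p) = !seedDec b p := by
  unfold seedDec
  by_cases h1 : 1 ≤ p <;> by_cases h2 : p ≤ 0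
  · linarith
  · rw [if_neg (by linarith), if_pos (by linarith), if_pos h1]; rfl
  · rw [if_pos (by linarith), if_neg h1, if_pos h2]; rfl
  · rw [if_neg (by linarith), if_neg (by linarith), if_neg h1, if_neg h2]

/-- Negating all seeds negates the output of a balanced rule. -/
theorem IsRun.not {τ : LocalRule K (2 * (ρ + 1))} (hτ : τ.IsBalanced) (hC : IsUniform K C)
    {ord : Fin n → ℕ} {b : Fin n → Bool} (h : IsRun τ C ord (fun x => seedDec (b x)) σ) :
    IsRun τ C ord (fun x => seedDec (!b x)) fun x => !σ x := by
  intro x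
  change (!σ x) = seedDec (!b x) _
  rw [hτ.prob_not hC notMem_before_self, seedDec_not]
  exact congrArg _ (h x)

end Residual

/-! ### Short cycles and immersions -/

section Immersion

variable {ι α V E : Type*}

/-- The clauses `C` contain a cycle of length `h`: distinct clauses `c 0, …, c (h - 1)` and a
closed walk `v 0, …, v h = v 0` of variables, any two consecutive ones different, such that `v i`
and `v (i + 1)` appear in `c i`. -/
def HasCycle (C : ι → α → Option Bool) (h : ℕ) : Prop :=
  ∃ (c : Fin h → ι) (v : ℕ → α), Function.Injective c ∧ v h = v 0 ∧
    ∀ i : Fin h, v i ≠ v (i + 1) ∧ C (c i) (v i) ≠ none ∧ C (c i) (v (i + 1)) ≠ none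

/-- There are no cycles of length at most `g`. -/
def NoShortCycle (C : ι → α → Option Bool) (g : ℕ) : Prop :=
  ∀ h, 0 < h → h ≤ g → ¬HasCycle C h

theorem Within.exists_path {R : α → α → Prop} {x v : α} {h : ℕ} (hv : Within R x h v) :
    ∃ h' ≤ h, ∃ w : ℕ → α, w 0 = x ∧ w h' = v ∧ ∀ i < h', R (w i) (w (i + 1)) := by
  induction h generalizing v with
  | zero => exact ⟨0, le_rfl, fun _ => x, rfl, Eq.symm hv, by simp⟩
  | succ h ih =>
    rcases hv with hv | ⟨u, hu, huv⟩
    · obtain ⟨h', h1, h2⟩ := ih hv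
      exact ⟨h', by omega, h2⟩
    · obtain ⟨h', h1, w, w0, wh, hw⟩ := ih hu
      refine ⟨h' + 1, by omega, fun i => if i ≤ h' then w i else v, by simp [w0], by simp, ?_⟩
      intro i hi
      rcases Nat.lt_succ_iff_lt_or_eq.1 hi with h3 | rfl
      · simp only [h3.le, if_true, Nat.succ_le_of_lt h3]
        exact hw i h3
      · simpa [wh] using huv

theorem Within.of_path {R : α → α → Prop} {w : ℕ → α} {h i j : ℕ}
    (hw : ∀ i < h, R (w i) (w (i + 1))) (hij : i ≤ j) (hj : j ≤ h) :
    Within R (w i) (j - i) (w j) := by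
  induction j, hij using Nat.le_induction with
  | base => exact Within.refl _ _
  | succ j hij ih =>
    rw [Nat.succ_sub hij]
    exact (ih (by omega)).step (hw j (by omega))

/-- Two variables are joined by a clause of `T`. -/
def Joined (T : E → V → Option Bool) (u v : V) : Prop :=
  ∃ q, T q u ≠ none ∧ T q v ≠ none

/-- The maps `π` on variables and `κ` on clauses form an immersion of the clauses `T` into the
clauses `C`: the scope of each clause is mapped bijectively, preserving literals, and different
clauses around a variable have different images. -/
structure IsImmersion (T : E → V → Option Bool) (C : ι → α → Option Bool) (π : V → α)
    (κ : E → ι) : Prop where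
  lit : ∀ q u, T q u ≠ none → C (κ q) (π u) = T q u
  scope_inj : ∀ q u u', T q u ≠ none → T q u' ≠ none → π u = π u' → u = u'
  scope_surj : ∀ q v, C (κ q) v ≠ none → ∃ u, T q u ≠ none ∧ π u = v
  star_inj : ∀ u q q', T q u ≠ none → T q' u ≠ none → κ q = κ q' → q = q'

/-- An immersion into clauses without short cycles is injective on short distances: a shortest
pair of different variables with the same image would project to a cycle. -/
theorem IsImmersion.eq_of_within {T : E → V → Option Bool} {C : ι → α → Option Bool} {π : V → α}
    {κ : E → ι} (hI : IsImmersion T C π κ) {g : ℕ} (hg : NoShortCycle C g) (h : ℕ) (hh : h ≤ g)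
    (u u' : V) (huu : Within (Joined T) u h u') (hπ : π u = π u') : u = u' := by
  induction h using Nat.strong_induction_on generalizing u u' with
  | _ h ih =>
    by_contra hne
    obtain ⟨h', hle, w, w0, wh, hw⟩ := huu.exists_path
    have no : ∀ t < h, ¬Within (Joined T) u t u' := fun t ht hc =>
      hne (ih t ht (by omega) u u' hc hπ)
    have hh' : h' = h := by
      by_contra hlt
      have := Within.of_path hw (Nat.zero_le h') le_rfl
      rw [w0, wh] at this
      exact no _ (by omega) this
    subst hh'
    have hpos : 0 < h' := by
      rcases Nat.eq_zero_or_pos h' with h0 | h0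
      · exact absurd huu (by rw [h0]; exact fun h => hne (Eq.symm h))
      · exact h0
    have : Nonempty E := ⟨(hw 0 hpos).choose⟩
    choose! q hq1 hq2 using hw
    have hw : ∀ i < h', Joined T (w i) (w (i + 1)) := fun i hi => ⟨q i, hq1 i hi, hq2 i hi⟩
    -- a clause cannot be used to cut the path short
    have cut : ∀ i j p, i ≤ j → j < h' → T p (w i) ≠ none → T p (w (j + 1)) ≠ none → i = j := by
      intro i j p hij hj h1 h2
      by_contra hlt
      have a := Within.of_path hw (Nat.zero_le i) (by omega)
      have b := Within.of_path hw (i := j + 1) (j := h') (by omega) le_rfl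
      rw [w0] at a
      rw [wh] at b
      exact no _ (by omega) ((a.step ⟨p, h1, h2⟩).trans b)
    refine hg h' hpos hh ⟨fun i => κ (q i), fun i => π (w i), ?_, ?_, ?_⟩
    · have key : ∀ i j, i < j → j < h' → κ (q i) ≠ κ (q j) := by
        intro i j hij hj he
        obtain ⟨u₁, hu₁, he₁⟩ := hI.scope_surj (q i) (π (w j)) (by
          rw [he, hI.lit _ _ (hq1 j hj)]; exact hq1 j hj)
        have hw1 := Within.of_path hw (i := i + 1) (j := j) (by omega) (by omega)
        have hw2 : Within (Joined T) u₁ 1 (w (i + 1)) :=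
          Or.inr ⟨u₁, rfl, q i, hu₁, hq2 i (by omega)⟩
        have heq := ih _ (by omega) (by omega) _ _ (hw2.trans hw1) he₁
        subst heq
        have := hI.star_inj _ _ _ hu₁ (hq1 j hj) he
        have := cut i j (q i) hij.le hj (hq1 i (by omega)) (this ▸ hq2 j hj)
        omega
      intro i j he
      rcases lt_trichotomy i j with hij | hij | hij
      · exact absurd he (key i j hij j.2)
      · exact hij
      · exact absurd he.symm (key j i hij i.2)
    · change π (w h') = π (w 0)
      rw [w0, wh, hπ]
    · intro i
      refine ⟨fun he => ?_, ?_, ?_⟩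
      · have h1 := hI.scope_inj _ _ _ (hq1 i i.2) (hq2 i i.2) he
        have a := Within.of_path hw (Nat.zero_le (i : ℕ)) (by omega)
        have b := Within.of_path hw (i := i + 1) (j := h') (by omega) le_rfl
        rw [w0, h1] at a
        rw [wh] at b
        exact no _ (by omega) (a.trans b)
      · rw [hI.lit _ _ (hq1 i i.2)]; exact hq1 i i.2
      · rw [hI.lit _ _ (hq2 i i.2)]; exact hq2 i i.2

end Immersion

/-! ### The truncated universal cover -/

section Cover

variable {n m : ℕ}

/-- The clauses `T` are the clauses of a hypertree with edges of size `K`: they are `K`-uniform,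
connected, and span the number of variables that this forces in the absence of cycles. -/
structure IsHypertree (K : ℕ) {s e : ℕ} (T : Fin e → Fin s → Option Bool) : Prop where
  uniform : IsUniform K T
  card : s = (K - 1) * e + 1
  connected : ∀ S : Set (Fin s), S.Nonempty →
    (∀ q u u', T q u ≠ none → T q u' ≠ none → u ∈ S → u' ∈ S) → ∀ u, u ∈ S

/-- The last clause of a word, which is a sequence of steps `(v, c)` from a clause through the
variable `v` to the clause `c`, most recent step first, starting from the clause `j₀`. -/
def wordClause (j₀ : Fin m) : List (Fin n × Fin m) → Fin m
  | [] => j₀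
  | p :: _ => p.2

/-- The variable through which the last clause of a word was entered. -/
def wordEntry : List (Fin n × Fin m) → Option (Fin n)
  | [] => none
  | p :: _ => some p.1

/-- A word is valid if it is a non-backtracking walk in the factor graph. -/
def ValidWord (C : Fin m → Fin n → Option Bool) (j₀ : Fin m) : List (Fin n × Fin m) → Prop
  | [] => True
  | p :: q => ValidWord C j₀ q ∧ C (wordClause j₀ q) p.1 ≠ none ∧ wordEntry q ≠ some p.1 ∧
      C p.2 p.1 ≠ none ∧ p.2 ≠ wordClause j₀ q

/-- The clauses of the universal cover of depth `D`: non-backtracking walks from `j₀`. -/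
abbrev CoverClause (C : Fin m → Fin n → Option Bool) (j₀ : Fin m) (D : ℕ) : Type :=
  {q : List (Fin n × Fin m) // ValidWord C j₀ q ∧ q.length ≤ D}

/-- The variables of the universal cover: a clause of the cover together with one of its
variables other than the one through which it was entered. -/
abbrev CoverVar (C : Fin m → Fin n → Option Bool) (j₀ : Fin m) (D : ℕ) : Type :=
  Σ q : CoverClause C j₀ D, {v : Fin n // C (wordClause j₀ q.1) v ≠ none ∧ wordEntry q.1 ≠ some v}

variable {C : Fin m → Fin n → Option Bool} {j₀ : Fin m} {D : ℕ}

instance : Finite (CoverClause C j₀ D) :=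
  ((List.finite_length_le (Fin n × Fin m) D).subset fun _ h => h.2).to_subtype

/-- The incidence relation of the universal cover: a variable belongs to the clause that
introduces it and to those entered through it. -/
def CoverInc (q : CoverClause C j₀ D) (p : CoverVar C j₀ D) : Prop :=
  p.1.1 = q.1 ∨ ∃ c, q.1 = (p.2.1, c) :: p.1.1

open Classical in
/-- The clauses of the universal cover with their literals. -/
noncomputable def coverLit (q : CoverClause C j₀ D) (p : CoverVar C j₀ D) : Option Bool :=
  if CoverInc q p then C (wordClause j₀ q.1) p.2.1 else none

theorem coverLit_ne_none {q : CoverClause C j₀ D} {p : CoverVar C j₀ D} :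
    coverLit q p ≠ none ↔ CoverInc q p := by
  unfold coverLit
  split_ifs with h
  · refine iff_of_true ?_ h
    rcases h with h | ⟨c, h⟩
    · rw [← h]; exact p.2.2.1
    · have hq := q.2.1
      rw [h] at hq ⊢
      exact hq.2.2.2.1
  · simpa using h

theorem isImmersion_cover :
    IsImmersion (coverLit (C := C) (j₀ := j₀) (D := D)) C (fun p => p.2.1)
      (fun q => wordClause j₀ q.1) where
  lit q p h := by
    rw [coverLit, if_pos (coverLit_ne_none.1 h)]
  scope_inj := by
    rintro q ⟨⟨p, hp⟩, v, hv⟩ ⟨⟨p', hp'⟩, v', hv'⟩ h h' he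
    rw [coverLit_ne_none] at h h'
    obtain rfl : v = v' := he
    simp only [CoverInc] at h h'
    rcases h with rfl | ⟨c, hc⟩ <;> rcases h' with rfl | ⟨c', hc'⟩
    · rfl
    · exact absurd (by rw [hc']; rfl) hv.2
    · exact absurd (by rw [hc]; rfl) hv'.2
    · rw [hc] at hc'
      obtain rfl := (List.cons.inj hc').2
      rfl
  scope_surj := by
    rintro ⟨q, hq, hD⟩ v hv
    by_cases he : wordEntry q = some v
    · rcases q with - | ⟨⟨v', c⟩, q⟩
      · cases he
      · obtain rfl : v' = v := Option.some.inj he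
        exact ⟨⟨⟨q, hq.1, by simp at hD; omega⟩, v', hq.2.1, hq.2.2.1⟩,
          coverLit_ne_none.2 (Or.inr ⟨c, rfl⟩), rfl⟩
    · exact ⟨⟨⟨q, hq, hD⟩, v, hv, he⟩, coverLit_ne_none.2 (Or.inl rfl), rfl⟩
  star_inj := by
    rintro ⟨⟨p, hp⟩, v, hv⟩ ⟨q, hq⟩ ⟨q', hq'⟩ h h' he
    rw [coverLit_ne_none] at h h'
    simp only [CoverInc] at h h' he
    rcases h with rfl | ⟨c, rfl⟩ <;> rcases h' with rfl | ⟨c', rfl⟩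
    · rfl
    · exact absurd he.symm hq'.1.2.2.2.2
    · exact absurd he hq.1.2.2.2.2
    · obtain rfl : c = c' := he
      rfl

theorem cover_lift {p : CoverVar C j₀ D} (hp : p.1.1.length < D) {c : Fin m}
    (hc : C c p.2.1 ≠ none) :
    ∃ q : CoverClause C j₀ D, coverLit q p ≠ none ∧ wordClause j₀ q.1 = c := by
  by_cases h : c = wordClause j₀ p.1.1
  · exact ⟨p.1, coverLit_ne_none.2 (Or.inl rfl), h.symm⟩
  · exact ⟨⟨(p.2.1, c) :: p.1.1, ⟨p.1.2.1, p.2.2.1, p.2.2.2, hc, h⟩, hp⟩,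
      coverLit_ne_none.2 (Or.inr ⟨c, rfl⟩), rfl⟩

theorem cover_length_le {p p' : CoverVar C j₀ D} {q : CoverClause C j₀ D}
    (h : coverLit q p ≠ none) (h' : coverLit q p' ≠ none) :
    p'.1.1.length ≤ p.1.1.length + 1 := by
  rw [coverLit_ne_none] at h h'
  rcases h with h | ⟨c, h⟩ <;> rcases h' with h' | ⟨c', h'⟩
  · rw [h, h']; omega
  · rw [h, h']; simp only [List.length_cons]; omega
  · rw [h', h]; simp
  · have := congrArg List.length (h.symm.trans h')
    simp only [List.length_cons] at this
    omega

theorem cover_connected (S : Set (CoverVar C j₀ D))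
    (hS : S.Nonempty)
    (hcl : ∀ q u u', coverLit q u ≠ none → coverLit q u' ≠ none → u ∈ S → u' ∈ S) (u) : u ∈ S := by
  let In : CoverClause C j₀ D → Prop := fun q => ∀ u, coverLit q u ≠ none → u ∈ S
  have touch : ∀ q u, coverLit q u ≠ none → u ∈ S → In q := fun q u h hu u' h' => hcl q u u' h h' hu
  let root : CoverClause C j₀ D := ⟨[], trivial, Nat.zero_le _⟩
  have hroot : ∀ q : List (Fin n × Fin m), ∀ hq, In ⟨q, hq⟩ ↔ In root := by
    intro q
    induction q with
    | nil => intro hq; rfl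
    | cons a q ih =>
      intro hq
      have hq' : ValidWord C j₀ q ∧ q.length ≤ D := ⟨hq.1.1, by have := hq.2; simp at this; omega⟩
      rw [← ih hq']
      let p : CoverVar C j₀ D := ⟨⟨q, hq'⟩, a.1, hq.1.2.1, hq.1.2.2.1⟩
      have h1 : coverLit ⟨q, hq'⟩ p ≠ none := coverLit_ne_none.2 (Or.inl rfl)
      have h2 : coverLit ⟨a :: q, hq⟩ p ≠ none := coverLit_ne_none.2 (Or.inr ⟨a.2, rfl⟩)
      exact ⟨fun h => touch _ p h1 (h p h2), fun h => touch _ p h2 (h p h1)⟩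
  obtain ⟨p, hp⟩ := hS
  have h1 : In root := (hroot p.1.1 p.1.2).1 (touch p.1 p (coverLit_ne_none.2 (Or.inl rfl)) hp)
  exact (hroot u.1.1 u.1.2).2 h1 u (coverLit_ne_none.2 (Or.inl rfl))

theorem card_cover [Fintype (CoverClause C j₀ D)] {K : ℕ} (hK : 0 < K) (hC : IsUniform K C) :
    Nat.card (CoverVar C j₀ D) = (K - 1) * Nat.card (CoverClause C j₀ D) + 1 := by
  classical
  have hfib : ∀ q : CoverClause C j₀ D,
      Fintype.card {v : Fin n // C (wordClause j₀ q.1) v ≠ none ∧ wordEntry q.1 ≠ some v} =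
        (K - 1) + if q.1 = [] then 1 else 0 := by
    rintro ⟨q, hq⟩
    rw [Fintype.card_subtype]
    rcases q with - | ⟨⟨v, c⟩, q⟩
    · simp only [wordEntry, if_true]
      rw [← hC (wordClause j₀ ([] : List (Fin n × Fin m)))] at hK ⊢
      simp only [ne_eq, reduceCtorEq, not_false_eq_true, and_true] at hK ⊢
      omega
    · simp only [wordEntry, reduceCtorEq, if_false, add_zero]
      have hv : v ∈ Finset.univ.filter fun i => C c i ≠ none := by
        simpa using hq.1.2.2.2.1
      rw [← hC c, ← Finset.card_erase_of_mem hv]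
      congr 1
      ext i
      simp only [wordClause, Finset.mem_filter, Finset.mem_univ, true_and, Finset.mem_erase, ne_eq,
        Option.some.injEq, and_comm, eq_comm]
  rw [Nat.card_eq_fintype_card, Nat.card_eq_fintype_card, Fintype.card_sigma]
  simp only [hfib, Finset.sum_add_distrib, Finset.sum_const, smul_eq_mul]
  congr 1
  · rw [Finset.card_univ, mul_comm]
  · rw [Finset.sum_eq_single (⟨[], trivial, Nat.zero_le _⟩ : CoverClause C j₀ D)]
    · simp
    · intro q _ hq
      rw [if_neg fun h => hq (Subtype.ext h)]
    · simp

theorem IsImmersion.isUniform {s e : ℕ} {T : Fin e → Fin s → Option Bool} {π : Fin s → Fin n}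
    {κ : Fin e → Fin m} (hI : IsImmersion T C π κ) {K : ℕ} (hC : IsUniform K C) :
    IsUniform K T := by
  intro q
  rw [← hC (κ q)]
  refine Finset.card_bij (fun u _ => π u) ?_ ?_ ?_
  · intro u hu
    have hu := (Finset.mem_filter.1 hu).2
    simp only [Finset.mem_filter, Finset.mem_univ, true_and]
    rwa [hI.lit q u hu]
  · intro u hu u' hu' he
    exact hI.scope_inj q u u' (Finset.mem_filter.1 hu).2 (Finset.mem_filter.1 hu').2 he
  · intro v hv
    obtain ⟨u, h1, h2⟩ := hI.scope_surj q v (Finset.mem_filter.1 hv).2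
    exact ⟨u, by simpa using h1, h2⟩

/-- Finite uniform clauses have a hypertree covering them, complete up to any depth `D`
around a chosen clause; its variables may be numbered compatibly with a given order. -/
theorem exists_hypertree_cover {K : ℕ} (hK : 0 < K) (hC : IsUniform K C) (j₀ : Fin m) (D : ℕ)
    (ord : Fin n → ℕ) :
    ∃ (s e : ℕ) (T : Fin e → Fin s → Option Bool) (π : Fin s → Fin n) (κ : Fin e → Fin m)
      (dep : Fin s → ℕ) (root : Fin e), IsHypertree K T ∧ IsImmersion T C π κ ∧ κ root = j₀ ∧
      (∀ u, T root u ≠ none → dep u = 0) ∧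
      (∀ u c, dep u < D → C c (π u) ≠ none → ∃ q, T q u ≠ none ∧ κ q = c) ∧
      (∀ q u u', T q u ≠ none → T q u' ≠ none → dep u' ≤ dep u + 1) ∧
      ∀ u u', u ≤ u' → ord (π u) ≤ ord (π u') := by
  classical
  have : Fintype (CoverClause C j₀ D) := Fintype.ofFinite _
  let ε₀ := (Fintype.equivFin (CoverVar C j₀ D)).symm
  let ε : Fin (Fintype.card (CoverVar C j₀ D)) ≃ CoverVar C j₀ D :=
    (Tuple.sort fun i => ord (ε₀ i).2.1).trans ε₀
  have hmono : Monotone fun i => ord (ε i).2.1 := Tuple.monotone_sort fun i => ord (ε₀ i).2.1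
  let δ := (Fintype.equivFin (CoverClause C j₀ D)).symm
  have hI := isImmersion_cover (C := C) (j₀ := j₀) (D := D)
  have hI' : IsImmersion (fun q u => coverLit (δ q) (ε u)) C (fun u => (ε u).2.1)
      (fun q => wordClause j₀ (δ q).1) :=
    { lit := fun q u => hI.lit _ _
      scope_inj := fun q u u' h h' he => ε.injective (hI.scope_inj _ _ _ h h' he)
      scope_surj := fun q v hv => by
        obtain ⟨u, h1, h2⟩ := hI.scope_surj (δ q) v hv
        exact ⟨ε.symm u, by simpa using h1,
          (congrArg (fun p => p.2.1) (ε.apply_symm_apply u)).trans h2⟩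
      star_inj := fun u q q' h h' he => δ.injective (hI.star_inj _ _ _ h h' he) }
  refine ⟨_, _, fun q u => coverLit (δ q) (ε u), fun u => (ε u).2.1,
    fun q => wordClause j₀ (δ q).1, fun u => (ε u).1.1.length,
    δ.symm ⟨[], trivial, Nat.zero_le _⟩, ⟨hI'.isUniform hC, ?_, ?_⟩, hI', ?_, ?_, ?_, ?_, hmono⟩
  · rw [← Nat.card_eq_fintype_card, ← Nat.card_eq_fintype_card, card_cover hK hC]
  · intro S hS hcl u
    have := cover_connected (ε '' S) (hS.image _) (fun q a a' h h' ha => by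
      obtain ⟨b, hb, rfl⟩ := ha
      refine ⟨ε.symm a', ?_, by simp⟩
      exact hcl (δ.symm q) b _ (by simpa using h) (by simpa using h') hb) (ε u)
    obtain ⟨b, hb, he⟩ := this
    exact ε.injective he ▸ hb
  · simp [wordClause]
  · intro u hu
    rw [coverLit_ne_none] at hu
    simp only [CoverInc, Equiv.apply_symm_apply] at hu
    rcases hu with hu | ⟨c, hu⟩
    · simp only [hu, List.length_nil]
    · cases hu
  · intro u c hd hc
    obtain ⟨q, h1, h2⟩ := cover_lift hd hc
    exact ⟨δ.symm q, by simpa using h1, by simpa using h2⟩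
  · intro q u u' h h'
    exact cover_length_le h h'

end Cover

/-! ### Rules that never fail on hypertrees -/

section TreePerfect

variable {n m K ρ : ℕ}

/-- On hypertrees, whatever the order and the seeds, the rule `τ` finds satisfying assignments.
(The order is encoded in the numbering of the variables.) -/
def TreePerfect {r : ℕ} (τ : LocalRule K r) : Prop :=
  ∀ (s e : ℕ) (T : Fin e → Fin s → Option Bool), IsHypertree K T → ∀ (b σ : Fin s → Bool),
    IsRun τ T (fun i => i) (fun x => seedDec (b x)) σ → Satisfies T σ

theorem seedDec_seedDec {b : Bool} {p : ℝ} : seedDec (seedDec b p) p = seedDec b p := by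
  unfold seedDec
  split_ifs <;> rfl

/-- A rule that never fails on hypertrees never fails on clauses without short cycles: near the
root of the truncated universal cover, its run is the lift of the run below, so that a clause
violated below would be violated in the cover. -/
theorem TreePerfect.satisfies {τ : LocalRule K (2 * (ρ + 1))} (hτ : TreePerfect τ) (hK : 0 < K)
    {C : Fin m → Fin n → Option Bool} (hC : IsUniform K C)
    (hcyc : NoShortCycle C (2 * (ρ + 1))) {ord : Fin n → ℕ} (hord : Function.Injective ord)
    {b σ : Fin n → Bool} (hσ : IsRun τ C ord (fun x => seedDec (b x)) σ) : Satisfies C σ := by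
  intro j₀
  obtain ⟨s, e, T, π, κ, dep, root, hT, hI, hroot, hdep0, hlift, hdep, hmono⟩ :=
    exists_hypertree_cover hK hC j₀ ((ρ + 1) * (n + 1)) ord
  obtain ⟨σT, hσT⟩ := exists_isRun τ T (fun i => i) fun x => seedDec (σ (π x))
  have hsat := hτ s e T hT _ σT hσT root
  have hdepW : ∀ x h v, Within (Linked T) x h v → dep v ≤ dep x + h := by
    intro x h
    induction h with
    | zero => rintro v rfl; simp
    | succ h ih =>
      rintro v (hv | ⟨u, hu, q, h1, h2⟩)
      · exact (ih v hv).trans (by omega)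
      · exact (hdep q u v h1 h2).trans (by have := ih u hu; omega)
  have hinj : ∀ x u v, Within (Linked T) x (ρ + 1) u → Within (Linked T) x (ρ + 1) v →
      π u = π v → u = v := fun x u v hu hv he =>
    hI.eq_of_within hcyc _ (by omega) u v ((hu.symm Linked.symm).trans hv) he
  -- a decision depends only on earlier ones at most `ρ + 1` hops away, so that with `t` earlier
  -- variables the chains of dependent decisions are too short to reach the truncation of the cover
  have key : ∀ t u, (before ord (π u)).card = t →
      dep u + (ρ + 1) * (t + 1) ≤ (ρ + 1) * (n + 1) → σT u = σ (π u) := by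
    intro t
    induction t using Nat.strong_induction_on with
    | _ t ih =>
      intro u ht hD
      have hp : τ.prob (residual T (before (fun i => i) u) σT) u =
          τ.prob (residual C (before ord (π u)) σ) (π u) := by
        refine prob_residual_eq τ hT.uniform hC π κ notMem_before_self ?_ ?_ (hinj u) ?_ ?_ ?_
        · exact fun w _ q _ => ⟨fun v hv => hI.lit q v hv, hI.scope_surj q⟩
        · intro w hw c hc
          have := hdepW _ _ _ hw
          exact hlift w c (by nlinarith) hc
        · rintro q q' ⟨w, hw, hqw⟩ ⟨w', hw', hqw'⟩ he
          obtain ⟨v, hv, hvw⟩ := hI.scope_surj q (π w') (by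
            rw [he, hI.lit _ _ hqw']; exact hqw')
          have := hinj u v w' (hw.step ⟨q, hqw, hv⟩) (Or.inl hw') hvw
          subst this
          exact hI.star_inj _ _ _ hv hqw' he
        · intro v hv
          rw [mem_before, mem_before]
          constructor
          · intro h
            refine lt_of_le_of_ne (hmono v u h.le) fun he => ?_
            have := hinj u v u hv (Within.refl _ _) (hord he)
            subst this
            exact lt_irrefl _ h
          · intro h
            by_contra hle
            exact absurd (hmono u v (not_lt.1 hle)) (not_le.2 h)
        · intro v hv hvb
          have hlt : ord (π v) < ord (π u) := by
            refine lt_of_le_of_ne (hmono v u (mem_before.1 hvb).le) fun he => ?_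
            have := hinj u v u hv (Within.refl _ _) (hord he)
            subst this
            exact notMem_before_self hvb
          have hss : (before ord (π v)).card < t := by
            rw [← ht]
            refine Finset.card_lt_card ⟨fun y hy => ?_, fun hsub => ?_⟩
            · exact mem_before.2 ((mem_before.1 hy).trans hlt)
            · exact notMem_before_self (hsub (mem_before.2 hlt))
          have := hdepW _ _ _ hv
          refine (ih _ hss v rfl ?_).symm
          calc _ ≤ dep u + (ρ + 1) + (ρ + 1) * t := by
                have : (ρ + 1) * ((before ord (π v)).card + 1) ≤ (ρ + 1) * t :=
                  Nat.mul_le_mul_left _ hss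
                omega
            _ = dep u + (ρ + 1) * (t + 1) := by ring
            _ ≤ _ := hD
      have h1 := hσT u
      have h2 := hσ (π u)
      simp only [hp] at h1
      rw [h1, h2, seedDec_seedDec]
  have hval : ∀ u, T root u ≠ none → σT u = σ (π u) := by
    intro u hu
    refine key _ u rfl ?_
    rw [hdep0 u hu, zero_add]
    refine Nat.mul_le_mul_left _ (Nat.succ_le_succ ?_)
    exact (Finset.card_le_univ _).trans (by simp)
  obtain ⟨⟨u, hu⟩, u', hu'⟩ := hsat
  have hne : T root u ≠ none := by rw [hu]; simp
  have hne' : T root u' ≠ none := by rw [hu']; simp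
  rw [← hroot]
  exact ⟨⟨π u, by rw [hI.lit _ _ hne, hu, hval u hne]⟩,
    π u', by rw [hI.lit _ _ hne', hu', hval u' hne']⟩

end TreePerfect

/-! ### The variance of functions with bounded differences -/

section Variance

open Finset
open scoped BigOperators

variable {S : Type*} [Fintype S]

theorem expect_fin_succ {n : ℕ} (F : (Fin (n + 1) → S) → ℝ) :
    𝔼 x, F x = 𝔼 s, 𝔼 y, F (Fin.cons s y) := by
  rw [← expect_product' univ univ fun s (y : Fin n → S) => F (Fin.cons s y)]
  exact (Fintype.expect_equiv (Fin.consEquiv fun _ => S) _ _ fun _ => rfl).symm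

/-- If changing the coordinate `i` changes `F` by at most `D i`, then the variance of `F` under
the uniform distribution is at most `∑ i, D i ^ 2`. -/
theorem variance_le_sum_sq [Nonempty S] {n : ℕ} (F : (Fin n → S) → ℝ) (D : Fin n → ℝ)
    (hF : ∀ x i s, |F (Function.update x i s) - F x| ≤ D i) :
    𝔼 x, (F x - 𝔼 y, F y) ^ 2 ≤ ∑ i, D i ^ 2 := by
  induction n with
  | zero =>
    have h : ∀ x, F x = F default := fun x => congrArg F (Subsingleton.elim _ _)
    simp [h]
  | succ n ih =>
    let μ : S → ℝ := fun s => 𝔼 y, F (Fin.cons s y)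
    have hμ : 𝔼 x, F x = 𝔼 s, μ s := expect_fin_succ F
    have h1 : ∀ s, 𝔼 y, (F (Fin.cons s y) - μ s) ^ 2 ≤ ∑ i : Fin n, D i.succ ^ 2 := by
      intro s
      refine ih (fun y => F (Fin.cons s y)) (fun i => D i.succ) fun y i t => ?_
      have := hF (Fin.cons s y) i.succ t
      rwa [← Fin.cons_update] at this
    have hD : ∀ s t, |μ s - μ t| ≤ D 0 := by
      intro s t
      have h2 : μ s - μ t = 𝔼 y : Fin n → S, (F (Fin.cons s y) - F (Fin.cons t y)) :=
        (Finset.expect_sub_distrib _ _ _).symm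
      rw [h2]
      refine (Finset.abs_expect_le _ _).trans (Finset.expect_le univ_nonempty fun y _ => ?_)
      have := hF (Fin.cons t y) 0 s
      rwa [Fin.update_cons_zero] at this
    have h3 : ∀ s, |μ s - 𝔼 t, μ t| ≤ D 0 := by
      intro s
      have h4 : μ s - 𝔼 t, μ t = 𝔼 t, (μ s - μ t) := by
        rw [Finset.expect_sub_distrib, Fintype.expect_const]
      rw [h4]
      exact (Finset.abs_expect_le _ _).trans (Finset.expect_le univ_nonempty fun t _ => hD s t)
    rw [hμ, expect_fin_succ, Fin.sum_univ_succ]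
    refine Finset.expect_le univ_nonempty fun s _ => ?_
    have h5 : 𝔼 y : Fin n → S, (F (Fin.cons s y) - 𝔼 t, μ t) ^ 2 =
        𝔼 y : Fin n → S, (F (Fin.cons s y) - μ s) ^ 2 + (μ s - 𝔼 t, μ t) ^ 2 := by
      have e : ∀ y : Fin n → S, (F (Fin.cons s y) - 𝔼 t, μ t) ^ 2 =
          (F (Fin.cons s y) - μ s) ^ 2 + (2 * (μ s - 𝔼 t, μ t)) * (F (Fin.cons s y) - μ s) +
            (μ s - 𝔼 t, μ t) ^ 2 := fun y => by ring
      have e0 : 𝔼 y : Fin n → S, (F (Fin.cons s y) - μ s) = 0 := by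
        rw [Finset.expect_sub_distrib, Fintype.expect_const, sub_self]
      simp only [e]
      rw [Finset.expect_add_distrib, Finset.expect_add_distrib, ← Finset.mul_expect, e0,
        Fintype.expect_const]
      ring
    rw [h5, add_comm]
    exact add_le_add (sq_le_sq' (abs_le.1 (h3 s)).1 (abs_le.1 (h3 s)).2) (h1 s)

end Variance

/-! ### Interpolating between independent runs -/

section Interpolation

open Finset
open scoped BigOperators

variable {n k : ℕ}

/-- The number of coordinates outside `H` at which two assignments differ. -/
def distOff (H : Finset (Fin n)) (a b : Fin n → Bool) : ℕ :=
  (univ.filter fun x => x ∉ H ∧ a x ≠ b x).card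

/-- The seeds of the `i`-th copy: independent for the variables below `A`, and common to all
copies for the others. -/
def copySeed (A : ℕ) (ω : Fin n → Option (Fin k) → Bool) (i : Fin k) (x : Fin n) : Bool :=
  ω x (if (x : ℕ) < A then some i else none)

theorem exists_abs_sub_le_of_steps {f : ℕ → ℝ} {N : ℕ} {t Δ : ℝ} (h0 : f 0 = 0) (ht : 0 ≤ t)
    (hN : t ≤ f N) (hΔ : 0 ≤ Δ) (hstep : ∀ i < N, f (i + 1) - f i ≤ Δ) :
    ∃ i, |f i - t| ≤ Δ := by
  classical
  have hex : ∃ i, t ≤ f i := ⟨N, hN⟩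
  have h1 := Nat.find_spec hex
  have h2 := Nat.find_min' hex hN
  rcases Nat.eq_zero_or_pos (Nat.find hex) with h | h
  · refine ⟨0, ?_⟩
    rw [h, h0] at h1
    rw [h0, le_antisymm h1 ht]
    simpa using hΔ
  · have h3 := Nat.find_min hex (Nat.sub_one_lt h.ne')
    have h4 := hstep (Nat.find hex - 1) (by omega)
    rw [Nat.sub_add_cancel h] at h4
    refine ⟨Nat.find hex, ?_⟩
    rw [abs_of_nonneg (by linarith)]
    linarith

/-- Let `σ` be a function of the seeds `b` which is negated when all seeds are negated, and
whose value at each `x` outside `H` depends only on the seeds at the `y` with `N x y`, where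
each `y` influences at most `D y` such `x`.  Then for every `k` there are `k` choices of seeds
whose images are pairwise at nearly any prescribed distance `t` between `0` and half the maximum.
The seeds are those of copies that share some of their random seeds: with all
seeds shared the distance is `0`, with independent seeds its mean is half the maximum by symmetry,
and sharing one seed less changes the mean by little. -/
theorem exists_seeds_of_local (σ : (Fin n → Bool) → Fin n → Bool)
    (hneg : ∀ b, σ (fun x => !b x) = fun x => !σ b x) (H : Finset (Fin n))
    (N : Fin n → Fin n → Prop)
    (hloc : ∀ x ∉ H, ∀ b b' : Fin n → Bool, (∀ y, N x y → b y = b' y) → σ b x = σ b' x)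
    (D : Fin n → ℝ)
    (hD : ∀ y, ∀ s : Finset (Fin n), (∀ x ∈ s, x ∉ H ∧ N x y) → (s.card : ℝ) ≤ D y)
    {Δ t ε : ℝ} (hΔ : ∀ y, D y ≤ Δ) (hΔ0 : 0 ≤ Δ) (ht0 : 0 ≤ t)
    (ht : t ≤ (n - H.card : ℝ) / 2) (hε : 0 < ε) (hvar : (k : ℝ) ^ 2 * ∑ y, D y ^ 2 < ε ^ 2) :
    ∃ b : Fin k → Fin n → Bool, ∀ i j, i ≠ j →
      |(distOff H (σ (b i)) (σ (b j)) : ℝ) - t| ≤ Δ + ε := by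
  classical
  by_cases hk : ∃ i₀ j₀ : Fin k, i₀ ≠ j₀
  swap
  · exact ⟨fun _ _ => false, fun i j hij => absurd ⟨i, j, hij⟩ hk⟩
  obtain ⟨i₀, j₀, hij₀⟩ := hk
  -- changing the seeds at `y` changes the distance by at most `D y`
  have hchange' : ∀ y (a a' b b' : Fin n → Bool), (∀ x, x ≠ y → a x = a' x) →
      (∀ x, x ≠ y → b x = b' x) →
      (distOff H (σ a) (σ b) : ℝ) ≤ distOff H (σ a') (σ b') + D y := by
    intro y a a' b b' ha hb
    have hsub : (univ.filter fun x => x ∉ H ∧ σ a x ≠ σ b x) ⊆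
        (univ.filter fun x => x ∉ H ∧ σ a' x ≠ σ b' x) ∪ univ.filter fun x => x ∉ H ∧ N x y := by
      intro x hx
      obtain ⟨hxH, hne⟩ := (mem_filter.1 hx).2
      by_cases hN : N x y
      · exact mem_union_right _ (by simp [hxH, hN])
      · refine mem_union_left _ (mem_filter.2 ⟨mem_univ _, hxH, ?_⟩)
        have hz : ∀ z, N x z → z ≠ y := fun z hz h => hN (h ▸ hz)
        rwa [← hloc x hxH a a' fun z h => ha z (hz z h), ← hloc x hxH b b' fun z h => hb z (hz z h)]
    have h1 := (card_le_card hsub).trans (card_union_le _ _)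
    have h2 := hD y (univ.filter fun x => x ∉ H ∧ N x y) fun x hx => (mem_filter.1 hx).2
    have h3 : (distOff H (σ a) (σ b) : ℝ) ≤ distOff H (σ a') (σ b') +
        ((univ.filter fun x => x ∉ H ∧ N x y).card : ℝ) := by
      exact_mod_cast h1
    linarith
  have hchange : ∀ y (a a' b b' : Fin n → Bool), (∀ x, x ≠ y → a x = a' x) →
      (∀ x, x ≠ y → b x = b' x) →
      |(distOff H (σ a) (σ b) : ℝ) - distOff H (σ a') (σ b')| ≤ D y := by
    intro y a a' b b' ha hb
    have h1 := hchange' y a a' b b' ha hb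
    have h2 := hchange' y a' a b' b (fun x h => (ha x h).symm) fun x h => (hb x h).symm
    rw [abs_le]
    constructor <;> linarith
  let G : ℕ → Fin k → Fin k → (Fin n → Option (Fin k) → Bool) → ℝ := fun A i j ω =>
    (distOff H (σ (copySeed A ω i)) (σ (copySeed A ω j)) : ℝ)
  let μ : ℕ → ℝ := fun A => 𝔼 ω, G A i₀ j₀ ω
  -- the mean distance is the same for all pairs of copies
  have hsymm : ∀ A i j, i ≠ j → 𝔼 ω, G A i j ω = μ A := by
    intro A i j hij
    obtain ⟨e, he1, he2⟩ : ∃ e : Equiv.Perm (Fin k), e i = i₀ ∧ e j = j₀ := by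
      refine ⟨(Equiv.swap i i₀).trans (Equiv.swap (Equiv.swap i i₀ j) j₀), ?_, ?_⟩
      · simp only [Equiv.trans_apply, Equiv.swap_apply_left]
        refine Equiv.swap_apply_of_ne_of_ne ?_ hij₀
        intro h
        have h2 : Equiv.swap i i₀ i = Equiv.swap i i₀ j := by rw [Equiv.swap_apply_left, ← h]
        exact hij ((Equiv.swap i i₀).injective h2)
      · simp
    let E : (Fin n → Option (Fin k) → Bool) ≃ (Fin n → Option (Fin k) → Bool) :=
      Equiv.piCongrRight fun _ => (Equiv.optionCongr e).arrowCongr (Equiv.refl Bool)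
    refine Fintype.expect_equiv E _ _ fun ω => ?_
    have hE : ∀ i', copySeed A (E ω) (e i') = copySeed A ω i' := by
      intro i'
      funext x
      simp only [copySeed, E, Equiv.piCongrRight_apply, Pi.map_apply, Equiv.arrowCongr_apply,
        Equiv.coe_refl, Function.comp_apply, id]
      split_ifs with h <;> exact congrArg (ω x) ((Equiv.symm_apply_eq _).2 rfl)
    change G A i j ω = G A i₀ j₀ (E ω)
    simp only [G, ← he1, ← he2, hE]
  have hμ0 : μ 0 = 0 := by
    have : ∀ ω, G 0 i₀ j₀ ω = 0 := by
      intro ω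
      have : copySeed 0 ω i₀ = copySeed 0 ω j₀ := by funext x; simp [copySeed]
      simp [G, this, distOff]
    simp [μ, this]
  have hμn : μ n = (n - H.card : ℝ) / 2 := by
    let E : (Fin n → Option (Fin k) → Bool) ≃ (Fin n → Option (Fin k) → Bool) :=
      Function.Involutive.toPerm (fun ω x o => if o = some j₀ then !ω x o else ω x o) (by
        intro ω; funext x o; by_cases h : o = some j₀ <;> simp [h])
    have hE1 : ∀ ω, copySeed n (E ω) i₀ = copySeed n ω i₀ := by
      intro ω
      funext x
      simp [copySeed, E, Function.Involutive.toPerm, hij₀]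
    have hE2 : ∀ ω, copySeed n (E ω) j₀ = fun x => !copySeed n ω j₀ x := by
      intro ω
      funext x
      simp [copySeed, E, Function.Involutive.toPerm]
    have h1 : μ n = 𝔼 ω, ((n - H.card : ℝ) - G n i₀ j₀ ω) := by
      refine (Fintype.expect_equiv E _ _ fun ω => ?_).symm
      simp only [G, hE1, hE2, hneg]
      have hd : Disjoint (univ.filter fun x => x ∉ H ∧
          σ (copySeed n ω i₀) x ≠ σ (copySeed n ω j₀) x)
          (univ.filter fun x => x ∉ H ∧ σ (copySeed n ω i₀) x ≠ !σ (copySeed n ω j₀) x) := by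
        rw [disjoint_left]
        intro x hx hx'
        have h1 := (mem_filter.1 hx).2.2
        have h2 := (mem_filter.1 hx').2.2
        revert h1 h2
        cases σ (copySeed n ω i₀) x <;> cases σ (copySeed n ω j₀) x <;> simp
      have hu : (univ.filter fun x => x ∉ H ∧ σ (copySeed n ω i₀) x ≠ σ (copySeed n ω j₀) x) ∪
          (univ.filter fun x => x ∉ H ∧ σ (copySeed n ω i₀) x ≠ !σ (copySeed n ω j₀) x) = Hᶜ := by
        ext x
        simp only [mem_union, mem_filter, mem_univ, true_and, mem_compl]
        cases σ (copySeed n ω i₀) x <;> cases σ (copySeed n ω j₀) x <;> simp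
      have hc := card_union_of_disjoint hd
      rw [hu, card_compl, Fintype.card_fin] at hc
      have hle : H.card ≤ n := (card_le_univ H).trans (by simp)
      have hc' : ((n - H.card : ℕ) : ℝ) = distOff H (σ (copySeed n ω i₀)) (σ (copySeed n ω j₀)) +
          distOff H (σ (copySeed n ω i₀)) (fun x => !σ (copySeed n ω j₀) x) := by
        rw [hc]; push_cast; rfl
      rw [Nat.cast_sub hle] at hc'
      linarith
    rw [Finset.expect_sub_distrib, Fintype.expect_const] at h1
    have h2 : μ n = (n - H.card : ℝ) - μ n := h1
    linarith
  have hstep : ∀ A < n, μ (A + 1) - μ A ≤ Δ := by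
    intro A hA
    have h1 : μ (A + 1) - μ A = 𝔼 ω, (G (A + 1) i₀ j₀ ω - G A i₀ j₀ ω) :=
      (Finset.expect_sub_distrib _ _ _).symm
    rw [h1]
    refine Finset.expect_le univ_nonempty fun ω _ => (le_abs_self _).trans ?_
    have hs : ∀ i x, x ≠ (⟨A, hA⟩ : Fin n) → copySeed (A + 1) ω i x = copySeed A ω i x := by
      intro i x hx
      have hx' : (x : ℕ) ≠ A := fun h => hx (Fin.ext h)
      have : (x : ℕ) < A + 1 ↔ (x : ℕ) < A := by omega
      simp only [copySeed, this]
    exact (hchange ⟨A, hA⟩ _ _ _ _ (hs i₀) (hs j₀)).trans (hΔ _)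
  obtain ⟨A, hA⟩ := exists_abs_sub_le_of_steps hμ0 ht0 (ht.trans hμn.ge) hΔ0 hstep
  -- for this `A`, some sample has all distances close to their means
  have hvarij : ∀ i j, i ≠ j → 𝔼 ω, (G A i j ω - μ A) ^ 2 ≤ ∑ y, D y ^ 2 := by
    intro i j hij
    rw [← hsymm A i j hij]
    refine variance_le_sum_sq (G A i j) D fun ω y s => ?_
    have hs : ∀ i x, x ≠ y → copySeed A (Function.update ω y s) i x = copySeed A ω i x := by
      intro i x hx
      simp only [copySeed, Function.update_of_ne hx]
    exact hchange y _ _ _ _ (hs i) (hs j)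
  have hsum : 𝔼 ω, ∑ p : Fin k × Fin k, (if p.1 ≠ p.2 then (G A p.1 p.2 ω - μ A) ^ 2 else 0) <
      ε ^ 2 := by
    refine lt_of_le_of_lt ?_ hvar
    rw [Finset.expect_sum_comm]
    have h0 : 0 ≤ ∑ y, D y ^ 2 := Finset.sum_nonneg fun y _ => sq_nonneg _
    calc _ ≤ ∑ _p : Fin k × Fin k, ∑ y, D y ^ 2 := by
          refine Finset.sum_le_sum fun p _ => ?_
          by_cases hp : p.1 ≠ p.2
          · simp only [if_pos hp]
            exact hvarij _ _ hp
          · simpa only [if_neg hp, Finset.expect_const_zero] using h0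
      _ = _ := by simp [Fintype.card_prod, sq]
  obtain ⟨ω, -, hω⟩ := Finset.exists_lt_of_expect_lt univ_nonempty hsum
  refine ⟨copySeed A ω, fun i j hij => ?_⟩
  have h1 : (G A i j ω - μ A) ^ 2 < ε ^ 2 := by
    refine lt_of_le_of_lt ?_ hω
    have := Finset.single_le_sum (f := fun p : Fin k × Fin k =>
      if p.1 ≠ p.2 then (G A p.1 p.2 ω - μ A) ^ 2 else 0) (fun p _ => by
        split_ifs <;> positivity) (mem_univ (i, j))
    simpa [hij] using this
  have h2 := abs_lt_of_sq_lt_sq h1 hε.le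
  calc _ = |(G A i j ω - μ A) + (μ A - t)| := by congr 1; simp only [G]; ring
    _ ≤ |G A i j ω - μ A| + |μ A - t| := abs_add_le _ _
    _ ≤ Δ + ε := by linarith

end Interpolation

/-! ### Satisfying assignments at prescribed distances -/

section Overlap

open Finset

variable {n m K ρ : ℕ}

open Classical in
/-- The number of ordered pairs of variables that are at most `t` hops apart. -/
noncomputable def pairCount (C : Fin m → Fin n → Option Bool) (t : ℕ) : ℕ :=
  (univ.filter fun p : Fin n × Fin n => Within (Linked C) p.1 t p.2).card

open Classical in
/-- The number of variables at most `t` hops from `x`. -/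
noncomputable def ballCount (C : Fin m → Fin n → Option Bool) (t : ℕ) (x : Fin n) : ℕ :=
  (univ.filter fun y => Within (Linked C) x t y).card

theorem sum_ballCount (C : Fin m → Fin n → Option Bool) (t : ℕ) :
    ∑ x, ballCount C t x = pairCount C t := by
  classical
  rw [pairCount, card_filter, Fintype.sum_prod_type]
  exact sum_congr rfl fun x _ => card_filter _ _

theorem pairCount_mono (C : Fin m → Fin n → Option Bool) {t t' : ℕ} (h : t ≤ t') :
    pairCount C t ≤ pairCount C t' := by
  classical
  exact card_le_card fun p hp => mem_filter.2 ⟨mem_univ _, (mem_filter.1 hp).2.mono h⟩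

theorem sq_ballCount_le (C : Fin m → Fin n → Option Bool) (t : ℕ) (y : Fin n) :
    ballCount C t y ^ 2 ≤ pairCount C (2 * t) := by
  classical
  rw [sq, ballCount, ← card_product]
  refine card_le_card fun p hp => ?_
  obtain ⟨h1, h2⟩ := mem_product.1 hp
  refine mem_filter.2 ⟨mem_univ _, ?_⟩
  rw [two_mul]
  exact ((mem_filter.1 h1).2.symm Linked.symm).trans (mem_filter.1 h2).2

/-- A greedy colouring of the part of a graph where the degrees are at most `Δ`. -/
theorem exists_greedy_coloring (R : Fin n → Fin n → Prop) (hR : ∀ x y, R x y → R y x)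
    (H : Finset (Fin n)) (Δ : ℕ)
    (hΔ : ∀ x ∉ H, ∀ s : Finset (Fin n), (∀ y ∈ s, R x y) → s.card ≤ Δ) :
    ∃ col : Fin n → ℕ, (∀ x ∉ H, col x ≤ Δ) ∧ (∀ x ∈ H, col x = Δ + 1) ∧
      ∀ x ∉ H, ∀ y ∉ H, x ≠ y → R x y → col x ≠ col y := by
  classical
  have key : ∀ S : Finset (Fin n), ∃ col : Fin n → ℕ, (∀ x ∉ H, col x ≤ Δ) ∧
      ∀ x ∈ S, ∀ y ∈ S, x ∉ H → y ∉ H → x ≠ y → R x y → col x ≠ col y := by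
    intro S
    induction S using Finset.induction_on with
    | empty => exact ⟨fun _ => 0, by simp, by simp⟩
    | insert a S ha ih =>
      obtain ⟨col, h1, h2⟩ := ih
      by_cases haH : a ∈ H
      · refine ⟨col, h1, fun x hx y hy hxH hyH => ?_⟩
        have hx' := (mem_insert.1 hx).resolve_left fun h => hxH (h ▸ haH)
        have hy' := (mem_insert.1 hy).resolve_left fun h => hyH (h ▸ haH)
        exact h2 x hx' y hy' hxH hyH
      obtain ⟨c, hc, hcn⟩ : ∃ c ∈ range (Δ + 1), c ∉ (univ.filter (R a)).image col := by
        refine exists_mem_notMem_of_card_lt_card (lt_of_le_of_lt card_image_le ?_)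
        rw [card_range]
        exact Nat.lt_succ_of_le (hΔ a haH _ fun y hy => (mem_filter.1 hy).2)
      have hne : ∀ y, R a y → col y ≠ c := fun y hy h =>
        hcn (mem_image.2 ⟨y, mem_filter.2 ⟨mem_univ _, hy⟩, h⟩)
      refine ⟨Function.update col a c, fun x hx => ?_, fun x hx y hy hxH hyH hxy hRxy => ?_⟩
      · by_cases hxa : x = a
        · subst hxa
          rw [Function.update_self]
          exact Nat.lt_succ_iff.1 (mem_range.1 hc)
        · rw [Function.update_of_ne hxa]
          exact h1 x hx
      · by_cases hxa : x = a
        · subst hxa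
          rw [Function.update_self, Function.update_of_ne hxy.symm]
          exact (hne y hRxy).symm
        · by_cases hya : y = a
          · subst hya
            rw [Function.update_self, Function.update_of_ne hxa]
            exact hne x (hR _ _ hRxy)
          · rw [Function.update_of_ne hxa, Function.update_of_ne hya]
            exact h2 x ((mem_insert.1 hx).resolve_left hxa) y ((mem_insert.1 hy).resolve_left hya)
              hxH hyH hxy hRxy
  obtain ⟨col, h1, h2⟩ := key univ
  refine ⟨fun x => if x ∈ H then Δ + 1 else col x, fun x hx => ?_, fun x hx => if_pos hx,
    fun x hx y hy hxy hR' => ?_⟩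
  · simpa only [if_neg hx] using h1 x hx
  · simpa only [if_neg hx, if_neg hy] using h2 x (mem_univ _) y (mem_univ _) hx hy hxy hR'

/-- If the order sorts the variables by a colouring which is proper at distance `ρ + 1` outside
`H`, and the variables in `H` come last, then the value of a variable `x ∉ H` of colour `c` depends
only on the seeds at distance at most `(ρ + 1) (c + 1)`. -/
theorem IsRun.eq_of_seeds_eq {τ : LocalRule K (2 * (ρ + 1))} {C : Fin m → Fin n → Option Bool}
    (hC : IsUniform K C) {H : Finset (Fin n)} {Δ : ℕ} {col ord : Fin n → ℕ}
    (hcol : ∀ x ∉ H, col x ≤ Δ) (hcolH : ∀ x ∈ H, col x = Δ + 1)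
    (hproper : ∀ x ∉ H, ∀ y ∉ H, x ≠ y → Within (Linked C) x (ρ + 1) y → col x ≠ col y)
    (hord : ∀ x y, ord x < ord y → col x ≤ col y) {b b' σ σ' : Fin n → Bool}
    (hσ : IsRun τ C ord (fun x => seedDec (b x)) σ)
    (hσ' : IsRun τ C ord (fun x => seedDec (b' x)) σ') (x : Fin n) (hx : x ∉ H)
    (hb : ∀ y, Within (Linked C) x ((ρ + 1) * (col x + 1)) y → b y = b' y) : σ x = σ' x := by
  induction hq : ord x using Nat.strong_induction_on generalizing x with
  | _ q ih =>
    have hp : τ.prob (residual C (before ord x) σ) x = τ.prob (residual C (before ord x) σ') x := by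
      refine prob_residual_congr τ hC notMem_before_self fun v hv hvb => ?_
      have hlt := mem_before.1 hvb
      have hle := hord v x hlt
      have hvH : v ∉ H := fun h => by
        have := hcolH v h
        have := hcol x hx
        omega
      have hvx : x ≠ v := fun h => lt_irrefl _ (h ▸ hlt)
      have hlt' : col v < col x := lt_of_le_of_ne hle (hproper x hx v hvH hvx hv).symm
      refine ih (ord v) (hq ▸ hlt) v hvH (fun y hy => hb y ((hv.trans hy).mono ?_)) rfl
      calc (ρ + 1) + (ρ + 1) * (col v + 1) ≤ (ρ + 1) + (ρ + 1) * col x :=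
            Nat.add_le_add_left (Nat.mul_le_mul_left _ hlt') _
        _ = (ρ + 1) * (col x + 1) := by ring
    have h1 := hσ x
    have h2 := hσ' x
    simp only at h1 h2
    rw [h1, h2, hp, hb x (Within.refl _ _)]

/-- A balanced rule that never fails on hypertrees finds, on clauses without short cycles and
with few pairs of variables at bounded distance, any number of satisfying assignments at pairwise
distances in a prescribed window. -/
theorem overlapSAT_nonempty {τ : LocalRule K (2 * (ρ + 1))} (hbal : τ.IsBalanced)
    (hperf : TreePerfect τ) (hK : 0 < K) {β η : ℝ} (hη : 0 < η) (hηβ : η < β) (hβ : β ≤ 1 / 2)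
    (k : ℕ) (C₁ : ℝ) :
    ∃ L : ℕ, ∀ C₂ : ℝ, ∃ n₀ : ℕ, ∀ n ≥ n₀, ∀ (m : ℕ) (C : Fin m → KClause n K),
      NoShortCycle (fun j => (C j).1) (2 * (ρ + 1)) →
      (pairCount (fun j => (C j).1) (ρ + 1) : ℝ) ≤ C₁ * n →
      (pairCount (fun j => (C j).1) (2 * L) : ℝ) ≤ C₂ * n →
      ((toFormula C).overlapSAT β η k).Nonempty := by
  classical
  -- by the first bound, at most `η n / 8` variables have more than `Δ` variables near them
  obtain ⟨Δ, hΔ⟩ := exists_nat_gt (C₁ / (η / 8))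
  rw [div_lt_iff₀ (by positivity)] at hΔ
  refine ⟨(ρ + 1) * (Δ + 1), fun C₂ => ?_⟩
  -- by the second bound, a seed influences at most `δ n` variables for large `n`
  obtain ⟨δ, hδ0, hδ1, hδ2⟩ :
      ∃ δ : ℝ, 0 < δ ∧ δ ≤ η / 8 ∧ (k : ℝ) ^ 2 * (δ * C₂) < (η / 8) ^ 2 := by
    have hpos : 0 < (k : ℝ) ^ 2 * |C₂| + 1 := by positivity
    refine ⟨min (η / 8) ((η / 8) ^ 2 / ((k : ℝ) ^ 2 * |C₂| + 1)), by positivity,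
      min_le_left _ _, ?_⟩
    set δ := min (η / 8) ((η / 8) ^ 2 / ((k : ℝ) ^ 2 * |C₂| + 1))
    have hδ : 0 < δ := by positivity
    have h1 : δ * ((k : ℝ) ^ 2 * |C₂| + 1) ≤ (η / 8) ^ 2 :=
      (le_div_iff₀ hpos).1 (min_le_right _ _)
    have h2 : (k : ℝ) ^ 2 * (δ * C₂) ≤ (k : ℝ) ^ 2 * (δ * |C₂|) := by
      gcongr
      exact le_abs_self _
    nlinarith
  obtain ⟨n₀, hn₀⟩ := exists_nat_gt (C₂ / δ ^ 2)
  rw [div_lt_iff₀ (by positivity)] at hn₀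
  refine ⟨n₀ + 1, fun n hn m C hcyc hp1 hp2 => ?_⟩
  have hnpos : 0 < (n : ℝ) := by exact_mod_cast (by omega : 0 < n)
  have hnn₀ : (n₀ : ℝ) ≤ n := by exact_mod_cast (by omega : n₀ ≤ n)
  let B : Fin m → Fin n → Option Bool := fun j => (C j).1
  have hB : IsUniform K B := fun j => (C j).2
  -- the exceptional variables, which change distances by at most `η n / 8`
  let H : Finset (Fin n) := univ.filter fun x => Δ < ballCount B (ρ + 1) x
  have hH : (H.card : ℝ) ≤ η / 8 * n := by
    have h1 : H.card * Δ ≤ pairCount B (ρ + 1) := by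
      rw [← sum_ballCount]
      calc H.card * Δ = ∑ x ∈ H, Δ := by rw [sum_const, smul_eq_mul]
        _ ≤ ∑ x ∈ H, ballCount B (ρ + 1) x :=
          sum_le_sum fun x hx => (mem_filter.1 hx).2.le
        _ ≤ _ := sum_le_sum_of_subset (subset_univ _)
    have h2 : (H.card : ℝ) * Δ ≤ C₁ * n := le_trans (by exact_mod_cast h1) hp1
    by_contra hlt
    push Not at hlt
    rcases Nat.eq_zero_or_pos Δ with h0 | h0
    · rw [h0] at hΔ h2
      simp only [Nat.cast_zero, zero_mul, mul_zero] at hΔ h2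
      nlinarith
    · have hΔ0 : (0 : ℝ) < Δ := by exact_mod_cast h0
      nlinarith [mul_lt_mul_of_pos_right hlt hΔ0, mul_lt_mul_of_pos_right hΔ hnpos]
  obtain ⟨col, hcol1, hcol2, hcol3⟩ := exists_greedy_coloring
    (fun x y => Within (Linked B) x (ρ + 1) y) (fun x y h => h.symm Linked.symm) H Δ (by
      intro x hx s hs
      have h1 : ballCount B (ρ + 1) x ≤ Δ := by
        by_contra h
        exact hx (mem_filter.2 ⟨mem_univ _, not_le.1 h⟩)
      exact (card_le_card fun y hy => mem_filter.2 ⟨mem_univ _, hs y hy⟩).trans h1)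
  -- process the variables colour by colour
  let ord : Fin n → ℕ := fun x => col x * n + x
  have hord1 : ∀ x y, ord x < ord y → col x ≤ col y := by
    intro x y h
    by_contra hlt
    have h1 : (col y + 1) * n ≤ col x * n := Nat.mul_le_mul_right _ (not_le.1 hlt)
    have h2 : col x * n + (x : ℕ) < col y * n + (y : ℕ) := h
    have := y.2
    nlinarith
  have hord2 : Function.Injective ord := by
    intro x y h
    have h1 : (col x * n + (x : ℕ)) % n = (col y * n + (y : ℕ)) % n := congrArg (· % n) h
    rw [Nat.mul_add_mod_self_right, Nat.mul_add_mod_self_right, Nat.mod_eq_of_lt x.2,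
      Nat.mod_eq_of_lt y.2] at h1
    exact Fin.ext h1
  choose σ hσ using fun b : Fin n → Bool => exists_isRun τ B ord fun x => seedDec (b x)
  have hballs : ∀ y, (ballCount B ((ρ + 1) * (Δ + 1)) y : ℝ) ≤ δ * n := by
    intro y
    have h1 : (ballCount B ((ρ + 1) * (Δ + 1)) y : ℝ) ^ 2 ≤ C₂ * n :=
      le_trans (by exact_mod_cast sq_ballCount_le B _ y) hp2
    refine abs_le_of_sq_le_sq' ?_ (by positivity) |>.2
    nlinarith [mul_le_mul_of_nonneg_left hnn₀ (sq_nonneg δ)]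
  obtain ⟨b, hb⟩ := exists_seeds_of_local σ
    (fun b => (hσ fun x => !b x).ext ((hσ b).not hbal hB)) H
    (fun x y => Within (Linked B) x ((ρ + 1) * (Δ + 1)) y)
    (fun x hx b b' h => (hσ b).eq_of_seeds_eq hB hcol1 hcol2 hcol3 hord1 (hσ b') x hx
      fun y hy => h y (hy.mono (Nat.mul_le_mul_left _ (Nat.succ_le_succ (hcol1 x hx)))))
    (fun y => (ballCount B ((ρ + 1) * (Δ + 1)) y : ℝ))
    (fun y s hs => by
      exact_mod_cast card_le_card fun x hx =>
        mem_filter.2 ⟨mem_univ _, (hs x hx).2.symm Linked.symm⟩)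
    (k := k) (Δ := δ * n) (t := (β - η / 2) * n) (ε := η / 8 * n) hballs (by positivity)
    (mul_nonneg (by linarith) hnpos.le) (by nlinarith) (by positivity) (by
      have h1 : ∑ y, (ballCount B ((ρ + 1) * (Δ + 1)) y : ℝ) ^ 2 ≤ (δ * n) * (C₂ * n) := by
        calc _ ≤ ∑ y, (δ * n) * (ballCount B ((ρ + 1) * (Δ + 1)) y : ℝ) := by
              refine sum_le_sum fun y _ => ?_
              rw [sq]
              exact mul_le_mul_of_nonneg_right (hballs y) (Nat.cast_nonneg _)
          _ = (δ * n) * (pairCount B ((ρ + 1) * (Δ + 1)) : ℝ) := by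
              rw [← mul_sum, ← sum_ballCount, Nat.cast_sum]
          _ ≤ _ := by
              refine mul_le_mul_of_nonneg_left (le_trans ?_ hp2) (by positivity)
              exact_mod_cast pairCount_mono B (by omega)
      calc _ ≤ (k : ℝ) ^ 2 * ((δ * n) * (C₂ * n)) := by gcongr
        _ = (k : ℝ) ^ 2 * (δ * C₂) * (n : ℝ) ^ 2 := by ring
        _ < (η / 8) ^ 2 * (n : ℝ) ^ 2 := by
          exact mul_lt_mul_of_pos_right hδ2 (by positivity)
        _ = _ := by ring)
  refine ⟨fun i => σ (b i), fun i => mem_SAT_toFormula.2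
    (hperf.satisfies hK hB hcyc hord2 (hσ (b i))), fun i j hij => ?_⟩
  have h1 := abs_le.1 (hb i j hij)
  have h2 : (distOff H (σ (b i)) (σ (b j)) : ℝ) ≤ hammingDist (σ (b i)) (σ (b j)) := by
    have : distOff H (σ (b i)) (σ (b j)) ≤ hammingDist (σ (b i)) (σ (b j)) :=
      card_le_card fun x hx => mem_filter.2 ⟨mem_univ _, (mem_filter.1 hx).2.2⟩
    exact_mod_cast this
  have h3 : (hammingDist (σ (b i)) (σ (b j)) : ℝ) ≤ distOff H (σ (b i)) (σ (b j)) + H.card := by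
    have : hammingDist (σ (b i)) (σ (b j)) ≤ distOff H (σ (b i)) (σ (b j)) + H.card := by
      refine (card_le_card fun x hx => ?_).trans (card_union_le _ _)
      by_cases hxH : x ∈ H
      · exact mem_union_right _ hxH
      · exact mem_union_left _ (mem_filter.2 ⟨mem_univ _, hxH, (mem_filter.1 hx).2⟩)
    exact_mod_cast this
  have h4 : δ * n ≤ η / 8 * n := mul_le_mul_of_nonneg_right hδ1 hnpos.le
  constructor <;> nlinarith

end Overlap

/-! ### Counting random clauses -/

section Counting

open Finset

variable {n K : ℕ}

instance : Fintype (KClause n K) :=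
  inferInstanceAs (Fintype {c : Fin n → Option Bool //
    (Finset.univ.filter fun i => c i ≠ none).card = K})

instance : DecidableEq (KClause n K) :=
  inferInstanceAs (DecidableEq {c : Fin n → Option Bool //
    (Finset.univ.filter fun i => c i ≠ none).card = K})

/-- The literals of a clause, as a function with a name of its own since `KClause n K` is a subtype
only up to unfolding. -/
def KClause.lit (c : KClause n K) : Fin n → Option Bool := c.1

theorem KClause.card_lit (c : KClause n K) : (univ.filter fun i => c.lit i ≠ none).card = K := c.2

theorem KClause.lit_injective : Function.Injective (KClause.lit : KClause n K → _) :=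
  Subtype.val_injective

/-- The clauses that contain the variable `u`. -/
def clausesAt (K : ℕ) (u : Fin n) : Finset (KClause n K) := {c | c.lit u ≠ none}

/-- The clauses that contain both `u` and `v`. -/
def clausesAt₂ (K : ℕ) (u v : Fin n) : Finset (KClause n K) := {c | c.lit u ≠ none ∧ c.lit v ≠ none}

theorem mem_clausesAt {u : Fin n} {c : KClause n K} : c ∈ clausesAt K u ↔ c.lit u ≠ none := by
  simp [clausesAt]

theorem mem_clausesAt₂ {u v : Fin n} {c : KClause n K} :
    c ∈ clausesAt₂ K u v ↔ c.lit u ≠ none ∧ c.lit v ≠ none := by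
  simp [clausesAt₂]

/-- A permutation of the variables acts on clauses. -/
theorem exists_permClause (e : Equiv.Perm (Fin n)) :
    ∃ F : KClause n K → KClause n K, Function.Injective F ∧ ∀ c i, (F c).lit i = c.lit (e i) := by
  have h : ∀ c : KClause n K, (univ.filter fun i => c.lit (e i) ≠ none).card = K := by
    intro c
    refine (card_bij (fun i _ => e i) ?_ (fun a _ b _ h => e.injective h) ?_).trans c.card_lit
    · intro a ha; simpa using ha
    · intro b hb; exact ⟨e.symm b, by simpa using hb, by simp⟩
  refine ⟨fun c => ⟨fun i => c.lit (e i), h c⟩, fun c c' he => ?_, fun c i => rfl⟩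
  refine KClause.lit_injective (funext fun i => ?_)
  have := congrFun (congrArg KClause.lit he) (e.symm i)
  simpa [KClause.lit] using this

theorem card_clausesAt_mul (u : Fin n) :
    (clausesAt K u).card * n = K * Fintype.card (KClause n K) := by
  have hsymm : ∀ v w : Fin n, (clausesAt K v).card ≤ (clausesAt K w).card := by
    intro v w
    obtain ⟨F, hF, hF'⟩ := exists_permClause (K := K) (Equiv.swap w v)
    refine card_le_card_of_injOn F ?_ hF.injOn
    intro c hc
    have hc := mem_clausesAt.1 hc
    exact mem_clausesAt.2 (by rwa [hF', Equiv.swap_apply_left])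
  have h1 : ∑ v : Fin n, (clausesAt K v).card = ∑ c : KClause n K, K := by
    simp only [clausesAt, card_filter]
    rw [sum_comm]
    refine sum_congr rfl fun c _ => ?_
    rw [← card_filter]
    exact c.card_lit
  rw [sum_congr rfl fun v _ => (hsymm v u).antisymm (hsymm u v)] at h1
  simp only [sum_const, card_univ, Fintype.card_fin, smul_eq_mul] at h1
  rw [mul_comm, h1, mul_comm]

theorem card_clausesAt₂_mul {u v : Fin n} (huv : u ≠ v) :
    (clausesAt₂ K u v).card * (n * (n - 1)) = K * (K - 1) * Fintype.card (KClause n K) := by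
  have hsymm : ∀ a b a' b' : Fin n, a ≠ b → a' ≠ b' →
      (clausesAt₂ K a b).card ≤ (clausesAt₂ K a' b').card := by
    intro a b a' b' hab hab'
    obtain ⟨e, he1, he2⟩ : ∃ e : Equiv.Perm (Fin n), e a' = a ∧ e b' = b := by
      refine ⟨(Equiv.swap a' a).trans (Equiv.swap (Equiv.swap a' a b') b), ?_, ?_⟩
      · simp only [Equiv.trans_apply, Equiv.swap_apply_left]
        refine Equiv.swap_apply_of_ne_of_ne (fun h => ?_) hab
        have h2 : Equiv.swap a' a a' = Equiv.swap a' a b' := by rw [Equiv.swap_apply_left, ← h]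
        exact hab' ((Equiv.swap a' a).injective h2)
      · simp
    obtain ⟨F, hF, hF'⟩ := exists_permClause (K := K) e
    refine card_le_card_of_injOn F ?_ hF.injOn
    intro c hc
    have hc := mem_clausesAt₂.1 hc
    exact mem_clausesAt₂.2 (by rwa [hF', hF', he1, he2])
  have h1 : ∑ p ∈ (univ : Finset (Fin n)).offDiag, (clausesAt₂ K p.1 p.2).card =
      ∑ c : KClause n K, K * (K - 1) := by
    simp only [clausesAt₂, card_filter]
    rw [sum_comm]
    refine sum_congr rfl fun c _ => ?_
    rw [← card_filter]
    have h2 : ((univ : Finset (Fin n)).offDiag.filter fun p =>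
        c.lit p.1 ≠ none ∧ c.lit p.2 ≠ none) = (univ.filter fun i => c.lit i ≠ none).offDiag := by
      ext p
      simp only [mem_filter, mem_offDiag, mem_univ, true_and]
      tauto
    rw [h2, offDiag_card, c.card_lit, Nat.mul_sub, mul_one]
  rw [sum_congr rfl fun p hp => (hsymm p.1 p.2 u v (mem_offDiag.1 hp).2.2 huv).antisymm
    (hsymm u v p.1 p.2 huv (mem_offDiag.1 hp).2.2)] at h1
  simp only [sum_const, card_univ, smul_eq_mul, offDiag_card, Fintype.card_fin] at h1
  rw [Nat.mul_sub, mul_one, mul_comm, h1, mul_comm]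

theorem le_of_kClause (c : KClause n K) : K ≤ n := by
  rw [← c.card_lit]
  exact (card_le_univ _).trans (by simp)

/-- A random clause contains two given variables with probability at most `(K / n) ^ 2`. -/
theorem card_clausesAt₂_le {u v : Fin n} (huv : u ≠ v) :
    ((clausesAt₂ K u v).card : ℝ) ≤ (K : ℝ) ^ 2 / (n : ℝ) ^ 2 * Fintype.card (KClause n K) := by
  rcases isEmpty_or_nonempty (KClause n K) with h | ⟨⟨c⟩⟩
  · simp [Finset.eq_empty_of_isEmpty]
  have hKn := le_of_kClause c
  have hn : 2 ≤ n := by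
    by_contra hlt
    exact huv (Fin.ext (by have := u.2; have := v.2; omega))
  have h1 := card_clausesAt₂_mul (K := K) huv
  have hn0 : (0 : ℝ) < n := by exact_mod_cast (by omega : 0 < n)
  have hn1 : (0 : ℝ) < (n - 1 : ℕ) := by exact_mod_cast (by omega : 0 < n - 1)
  have h2 : ((clausesAt₂ K u v).card : ℝ) * (n * (n - 1 : ℕ)) =
      K * (K - 1 : ℕ) * Fintype.card (KClause n K) := by exact_mod_cast h1
  have h3 : (n : ℝ) * (K - 1 : ℕ) ≤ K * (n - 1 : ℕ) := by
    have : n * (K - 1) ≤ K * (n - 1) := by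
      rw [Nat.mul_sub, Nat.mul_sub, mul_comm n K]
      omega
    exact_mod_cast this
  rw [div_mul_eq_mul_div, le_div_iff₀ (by positivity)]
  refine le_of_mul_le_mul_right ?_ hn1
  calc ((clausesAt₂ K u v).card : ℝ) * (n : ℝ) ^ 2 * (n - 1 : ℕ)
      = ((clausesAt₂ K u v).card * (n * (n - 1 : ℕ))) * n := by ring
    _ = (n * (K - 1 : ℕ)) * (K * Fintype.card (KClause n K)) := by rw [h2]; ring
    _ ≤ (K * (n - 1 : ℕ)) * (K * Fintype.card (KClause n K)) :=
      mul_le_mul_of_nonneg_right h3 (by positivity)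
    _ = _ := by ring

/-- A bound for the number of functions with values in given sets at distinct coordinates, and with
a given property of the other coordinates. -/
theorem card_filter_le_mul_prod {ι X : Type*} [Fintype ι] [DecidableEq ι] [Fintype X]
    [DecidableEq X] {h : ℕ} (c : Fin h → ι) (t : Fin h → Finset X)
    (Q : ({i // i ∉ Set.range c} → X) → Prop) [DecidablePred Q] (p : (ι → X) → Prop)
    [DecidablePred p] (hp : ∀ C, p C → Q (fun i => C i.1) ∧ ∀ i, C (c i) ∈ t i)
    [Fintype {i // i ∉ Set.range c}] :
    (univ.filter p).card ≤ (univ.filter Q).card * ∏ i, (t i).card := by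
  rw [← Fintype.card_piFinset, ← card_product]
  refine card_le_card_of_injOn (fun C => (fun i => C i.1, fun i => C (c i))) ?_ ?_
  · intro C hC
    obtain ⟨h1, h2⟩ := hp C (mem_filter.1 hC).2
    exact mem_product.2 ⟨mem_filter.2 ⟨mem_univ _, h1⟩, Fintype.mem_piFinset.2 h2⟩
  · intro C _ C' _ he
    obtain ⟨h1, h2⟩ := Prod.mk.inj he
    funext i
    by_cases hi : i ∈ Set.range c
    · obtain ⟨j, rfl⟩ := hi
      exact congrFun h2 j
    · exact congrFun h1 ⟨i, hi⟩

theorem card_notMem_range {ι : Type*} [Fintype ι] {h : ℕ} {c : Fin h → ι}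
    (hc : Function.Injective c) [Fintype {i // i ∉ Set.range c}] :
    Fintype.card {i // i ∉ Set.range c} = Fintype.card ι - h := by
  classical
  have : Fintype {i // i ∈ Set.range c} := Fintype.ofFinite _
  rw [Fintype.card_subtype_compl fun i => i ∈ Set.range c]
  congr 1
  exact (Fintype.card_congr (Equiv.ofInjective c hc)).symm.trans (Fintype.card_fin h)

/-! ### Random clauses have no short cycles with probability bounded away from zero -/

/-- The number of sequences of clauses, indexed by `ι`, without cycles of length at most `g`. -/
noncomputable def acyclicCount (n K g : ℕ) (ι : Type*) : ℕ :=
  Nat.card {C : ι → KClause n K // NoShortCycle (fun j => (C j).lit) g}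

theorem card_filter_acyclic (g : ℕ) (ι : Type*) [Fintype ι] [DecidableEq ι]
    [DecidablePred fun C : ι → KClause n K => NoShortCycle (fun j => (C j).lit) g] :
    (univ.filter fun C : ι → KClause n K => NoShortCycle (fun j => (C j).lit) g).card =
      acyclicCount n K g ι :=
  (Nat.subtype_card _ (by simp)).symm

theorem HasCycle.comp {ι ι' α : Type*} {C : ι → α → Option Bool} {f : ι' → ι}
    (hf : Function.Injective f) {h : ℕ} (hC : HasCycle (fun j => C (f j)) h) : HasCycle C h := by
  obtain ⟨c, v, hc, hv⟩ := hC
  exact ⟨fun i => f (c i), v, hf.comp hc, hv⟩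

theorem acyclicCount_congr {g : ℕ} {ι ι' : Type*} (e : ι ≃ ι') :
    acyclicCount n K g ι = acyclicCount n K g ι' := by
  refine Nat.card_congr ((e.arrowCongr (Equiv.refl _)).subtypeEquiv fun C => ?_)
  constructor
  · intro hC h h0 hg hc
    exact hC h h0 hg (HasCycle.comp (C := fun j => (C j).lit) e.symm.injective hc)
  · intro hC h h0 hg hc
    refine hC h h0 hg (HasCycle.comp (f := e) e.injective ?_)
    simpa using hc

/-- The successor of `i` in cyclic order. -/
def cyclicSucc {h : ℕ} (i : Fin h) : Fin h := ⟨(i + 1) % h, Nat.mod_lt _ i.pos⟩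

theorem apply_cyclicSucc {α : Type*} {h : ℕ} {v : ℕ → α} (hv : v h = v 0) (i : Fin h) :
    v (cyclicSucc i : Fin h) = v (i + 1) := by
  change v ((i + 1) % h) = v (i + 1)
  rcases Nat.lt_or_ge (i + 1) h with hlt | hge
  · rw [Nat.mod_eq_of_lt hlt]
  · have : (i : ℕ) + 1 = h := by have := i.2; omega
    rw [this, Nat.mod_self, hv]

theorem card_functions_with_value {h m : ℕ} (i₀ : Fin h) (a : Fin (m + 1)) :
    (univ.filter fun c : Fin h → Fin (m + 1) => c i₀ = a).card = (m + 1) ^ (h - 1) := by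
  have h1 : (univ.filter fun c : Fin h → Fin (m + 1) => c i₀ = a) =
      Fintype.piFinset fun i => if i = i₀ then {a} else univ := by
    ext c
    simp only [mem_filter, mem_univ, true_and, Fintype.mem_piFinset]
    constructor
    · intro hc i
      split_ifs with hi
      · rw [hi, hc]; simp
      · simp
    · intro hc
      simpa using hc i₀
  rw [h1, Fintype.card_piFinset]
  have h2 : ∀ i, (if i = i₀ then ({a} : Finset (Fin (m + 1))) else univ).card =
      if i = i₀ then 1 else m + 1 := by
    intro i; split_ifs <;> simp
  simp only [h2, prod_ite, prod_const_one, one_mul, prod_const]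
  congr 1
  rw [filter_not, filter_eq' univ i₀, if_pos (mem_univ _), card_sdiff_of_subset (by simp)]
  simp

theorem card_acyclic_tail (g m : ℕ) [DecidablePred fun C : Fin (m + 1) → KClause n K =>
    NoShortCycle (fun j : Fin m => (C j.succ).lit) g] :
    (univ.filter fun C : Fin (m + 1) → KClause n K =>
      NoShortCycle (fun j : Fin m => (C j.succ).lit) g).card =
      Fintype.card (KClause n K) * acyclicCount n K g (Fin m) := by
  classical
  rw [← card_filter_acyclic, ← card_univ, ← card_product]
  refine card_bij (fun C _ => (C 0, fun j => C j.succ)) ?_ ?_ ?_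
  · intro C hC
    exact mem_product.2 ⟨mem_univ _, mem_filter.2 ⟨mem_univ _, (mem_filter.1 hC).2⟩⟩
  · intro C _ C' _ he
    obtain ⟨h1, h2⟩ := Prod.mk.inj he
    funext j
    exact Fin.cases h1 (fun j => congrFun h2 j) j
  · rintro ⟨a, C⟩ hC
    refine ⟨Fin.cons a C, mem_filter.2 ⟨mem_univ _, ?_⟩, rfl⟩
    exact (mem_filter.1 (mem_product.1 hC).2).2

/-- A cycle that appears when the clause `C 0` is added passes through it, and the clauses outside
of the cycle are still without short cycles. -/
theorem exists_cycle_through_zero {g m : ℕ} {C : Fin (m + 1) → KClause n K}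
    (htail : NoShortCycle (fun j : Fin m => (C j.succ).lit) g)
    (hC : ¬NoShortCycle (fun j => (C j).lit) g) :
    ∃ h ∈ Icc 1 g, ∃ (i₀ : Fin h) (c : Fin h → Fin (m + 1)) (v : Fin h → Fin n),
      c i₀ = 0 ∧ Function.Injective c ∧ (∀ i, v i ≠ v (cyclicSucc i)) ∧
      (∀ i, C (c i) ∈ clausesAt₂ K (v i) (v (cyclicSucc i))) ∧
      NoShortCycle (fun j : {i // i ∉ Set.range c} => (C j.1).lit) g := by
  unfold NoShortCycle at hC
  push Not at hC
  obtain ⟨h, h0, hg, c, v, hc, hv, hcv⟩ := hC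
  obtain ⟨i₀, hi₀⟩ : ∃ i₀, c i₀ = 0 := by
    by_contra hne
    push Not at hne
    refine htail h h0 hg ⟨fun i => (c i).pred (hne i), v, fun i j he => hc ?_, hv, fun i => ?_⟩
    · exact Fin.pred_inj.1 he
    · have := hcv i
      simpa only [Fin.succ_pred] using this
  refine ⟨h, mem_Icc.2 ⟨h0, hg⟩, i₀, c, fun i => v i, hi₀, hc, fun i => ?_, fun i => ?_, ?_⟩
  · have := (hcv i).1
    rwa [← apply_cyclicSucc hv] at this
  · have := (hcv i).2
    rw [← apply_cyclicSucc hv] at this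
    exact mem_clausesAt₂.2 this
  · intro h' h0' hg' hcyc
    have hne : ∀ j : {i // i ∉ Set.range c}, j.1 ≠ 0 := fun j hj => j.2 ⟨i₀, hi₀.trans hj.symm⟩
    refine htail h' h0' hg' (HasCycle.comp (C := fun j : Fin m => (C j.succ).lit)
      (f := fun j : {i // i ∉ Set.range c} => j.1.pred (hne j)) ?_ ?_)
    · intro j j' he
      exact Subtype.ext (Fin.pred_inj.1 he)
    · simpa only [Fin.succ_pred] using hcyc

/-- The number of sequences of clauses with a given cycle, and without short cycles outside of
it. -/
theorem card_with_cycle_le {g m h : ℕ} {c : Fin h → Fin m} (hc : Function.Injective c)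
    {v w : Fin h → Fin n} (hv : ∀ i, v i ≠ w i)
    (p : (Fin m → KClause n K) → Prop) [DecidablePred p]
    (hp : ∀ C, p C → (∀ i, C (c i) ∈ clausesAt₂ K (v i) (w i)) ∧
      NoShortCycle (fun j : {i // i ∉ Set.range c} => (C j.1).lit) g) :
    ((univ.filter p).card : ℝ) ≤ acyclicCount n K g (Fin (m - h)) *
      ((K : ℝ) ^ 2 / (n : ℝ) ^ 2 * Fintype.card (KClause n K)) ^ h := by
  classical
  have : Fintype {i // i ∉ Set.range c} := Fintype.ofFinite _
  have h1 := card_filter_le_mul_prod c (fun i => clausesAt₂ K (v i) (w i))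
    (fun C => NoShortCycle (fun j => (C j).lit) g) p fun C hC => ⟨(hp C hC).2, (hp C hC).1⟩
  have h2 : (univ.filter fun C : {i // i ∉ Set.range c} → KClause n K =>
      NoShortCycle (fun j => (C j).lit) g).card = acyclicCount n K g (Fin (m - h)) := by
    rw [card_filter_acyclic]
    refine acyclicCount_congr (Fintype.equivFinOfCardEq ?_)
    rw [card_notMem_range hc, Fintype.card_fin]
  rw [h2] at h1
  calc ((univ.filter p).card : ℝ) ≤ acyclicCount n K g (Fin (m - h)) *
        ∏ i, ((clausesAt₂ K (v i) (w i)).card : ℝ) := by exact_mod_cast h1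
    _ ≤ _ := by
      gcongr
      calc _ ≤ ∏ _i : Fin h, ((K : ℝ) ^ 2 / (n : ℝ) ^ 2 * Fintype.card (KClause n K)) :=
            prod_le_prod (fun _ _ => Nat.cast_nonneg _) fun i _ => card_clausesAt₂_le (hv i)
        _ = _ := by simp

/-- Few sequences of clauses without short cycles acquire a cycle when a clause is added: when
the cycle is given, the clauses outside of it are still without short cycles and independent of
it. -/
theorem acyclicCount_succ_ge (g m : ℕ) :
    (Fintype.card (KClause n K) : ℝ) * acyclicCount n K g (Fin m) ≤
      acyclicCount n K g (Fin (m + 1)) + ∑ h ∈ Icc 1 (min g (m + 1)),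
        (h * ((m + 1) ^ (h - 1) * n ^ h) * (acyclicCount n K g (Fin (m + 1 - h)) *
          ((K : ℝ) ^ 2 / (n : ℝ) ^ 2 * Fintype.card (KClause n K)) ^ h)) := by
  classical
  -- `Bad h c v`: the cycle of length `h` given by `c` and `v` is present, and the clauses outside
  -- of it have no short cycles; `P h`: the cycles of length `h` through the new clause `0`
  let Bad : ∀ h : ℕ, (Fin h → Fin (m + 1)) → (Fin h → Fin n) →
      Finset (Fin (m + 1) → KClause n K) := fun h c v => univ.filter fun C =>
    (∀ i, C (c i) ∈ clausesAt₂ K (v i) (v (cyclicSucc i))) ∧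
      NoShortCycle (fun j : {i // i ∉ Set.range c} => (C j.1).lit) g
  let P : ∀ h : ℕ,
      Finset ((Σ i₀ : Fin h, {c : Fin h → Fin (m + 1) // c i₀ = 0}) × (Fin h → Fin n)) :=
    fun h => univ.filter fun p => Function.Injective p.1.2.1 ∧ ∀ i, p.2 i ≠ p.2 (cyclicSucc i)
  have hP : ∀ h, ((P h).card : ℝ) ≤ h * ((m + 1) ^ (h - 1) * n ^ h) := by
    intro h
    have h1 : (P h).card ≤ h * ((m + 1) ^ (h - 1) * n ^ h) := by
      refine (card_le_univ _).trans (le_of_eq ?_)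
      rw [Fintype.card_prod, Fintype.card_sigma]
      simp only [Fintype.card_subtype, card_functions_with_value]
      simp [mul_assoc]
    exact_mod_cast h1
  have hsub : (univ.filter fun C : Fin (m + 1) → KClause n K =>
      NoShortCycle (fun j : Fin m => (C j.succ).lit) g) ⊆
      (univ.filter fun C : Fin (m + 1) → KClause n K => NoShortCycle (fun j => (C j).lit) g) ∪
        (Icc 1 (min g (m + 1))).biUnion fun h => (P h).biUnion fun p => Bad h p.1.2.1 p.2 := by
    intro C hC
    have hC := (mem_filter.1 hC).2
    by_cases hg : NoShortCycle (fun j => (C j).lit) g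
    · exact mem_union_left _ (mem_filter.2 ⟨mem_univ _, hg⟩)
    · obtain ⟨h, hh, i₀, c, v, h0, hc, hv, h1, h2⟩ := exists_cycle_through_zero hC hg
      have hm : h ≤ m + 1 := by simpa using Fintype.card_le_of_injective c hc
      exact mem_union_right _ (mem_biUnion.2 ⟨h, mem_Icc.2 ⟨(mem_Icc.1 hh).1,
        le_min (mem_Icc.1 hh).2 hm⟩, mem_biUnion.2 ⟨(⟨i₀, c, h0⟩, v),
        mem_filter.2 ⟨mem_univ _, hc, hv⟩, mem_filter.2 ⟨mem_univ _, h1, h2⟩⟩⟩)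
  have hcard := (card_le_card hsub).trans ((card_union_le _ _).trans
    (Nat.add_le_add_left (card_biUnion_le.trans (sum_le_sum fun h _ => card_biUnion_le)) _))
  rw [card_acyclic_tail, card_filter_acyclic] at hcard
  have hcard' : (Fintype.card (KClause n K) : ℝ) * acyclicCount n K g (Fin m) ≤
      acyclicCount n K g (Fin (m + 1)) +
        ∑ h ∈ Icc 1 (min g (m + 1)), ∑ p ∈ P h, ((Bad h p.1.2.1 p.2).card : ℝ) := by
    exact_mod_cast hcard
  refine hcard'.trans (add_le_add le_rfl (sum_le_sum fun h _ => ?_))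
  calc ∑ p ∈ P h, ((Bad h p.1.2.1 p.2).card : ℝ)
      ≤ ∑ _p ∈ P h, (acyclicCount n K g (Fin (m + 1 - h)) *
          ((K : ℝ) ^ 2 / (n : ℝ) ^ 2 * Fintype.card (KClause n K)) ^ h) := by
        refine sum_le_sum fun p hp => ?_
        obtain ⟨h1, h2⟩ := (mem_filter.1 hp).2
        exact card_with_cycle_le h1 h2 _ fun C hC => hC
    _ ≤ _ := by
        rw [sum_const, nsmul_eq_mul]
        exact mul_le_mul_of_nonneg_right (hP h) (by positivity)

end Counting

section Decay

open Finset

/-- If `a (m + 1)` is at least `a m` up to a small combination of the last terms, then `a` decays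
at most geometrically. -/
theorem pow_mul_le_of_le_add_sum {a w : ℕ → ℝ} {g M : ℕ} {lam : ℝ} (ha : ∀ m, 0 ≤ a m)
    (hw : ∀ h, 0 ≤ w h) (hlam : ∑ h ∈ Icc 1 g, 2 * w h ≤ lam) (hg : lam * g ≤ 1 / 2)
    (hlam1 : lam ≤ 1)
    (hrec : ∀ m < M, a m ≤ a (m + 1) + ∑ h ∈ Icc 1 (min g (m + 1)), w h * a (m + 1 - h)) :
    (1 - lam) ^ M * a 0 ≤ a M := by
  have hl0 : 0 ≤ lam := (sum_nonneg fun h _ => by have := hw h; positivity).trans hlam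
  have hstep : ∀ m, m < M → (1 - lam) * a m ≤ a (m + 1) := by
    intro m
    induction m using Nat.strong_induction_on with
    | _ m ih =>
    intro hm
    have hback : ∀ i j, j + i ≤ m → (1 - lam) ^ i * a j ≤ a (j + i) := by
      intro i j hij
      induction i with
      | zero => simp
      | succ i ihi =>
        have h1 := ih (j + i) (by omega) (by omega)
        calc (1 - lam) ^ (i + 1) * a j = (1 - lam) * ((1 - lam) ^ i * a j) := by ring
          _ ≤ (1 - lam) * a (j + i) :=
            mul_le_mul_of_nonneg_left (ihi (by omega)) (by linarith)
          _ ≤ _ := h1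
    have hhalf : ∀ h ∈ Icc 1 (min g (m + 1)), a (m + 1 - h) ≤ 2 * a m := by
      intro h hh
      obtain ⟨h1, h2⟩ := mem_Icc.1 hh
      have h3 := hback (h - 1) (m + 1 - h) (by omega)
      rw [show m + 1 - h + (h - 1) = m by omega] at h3
      have h4 : 1 - lam * g ≤ (1 - lam) ^ (h - 1) := by
        have h5 := one_add_mul_le_pow (a := -lam) (by linarith) (h - 1)
        have h6 : ((h - 1 : ℕ) : ℝ) ≤ g := by exact_mod_cast (by omega : h - 1 ≤ g)
        have h7 := mul_le_mul_of_nonneg_left h6 hl0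
        rw [← sub_eq_add_neg] at h5
        linarith
      have h8 := mul_le_mul_of_nonneg_right (show (1 : ℝ) / 2 ≤ (1 - lam) ^ (h - 1) by linarith)
        (ha (m + 1 - h))
      linarith
    have hsum : ∑ h ∈ Icc 1 (min g (m + 1)), w h * a (m + 1 - h) ≤ lam * a m := by
      calc _ ≤ ∑ h ∈ Icc 1 (min g (m + 1)), 2 * w h * a m := by
            refine sum_le_sum fun h hh => ?_
            have := mul_le_mul_of_nonneg_left (hhalf h hh) (hw h)
            linarith
        _ ≤ ∑ h ∈ Icc 1 g, 2 * w h * a m := by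
            refine sum_le_sum_of_subset_of_nonneg
              (Icc_subset_Icc le_rfl (min_le_left _ _)) fun h _ _ => ?_
            have := hw h
            have := ha m
            positivity
        _ = (∑ h ∈ Icc 1 g, 2 * w h) * a m := by rw [sum_mul]
        _ ≤ lam * a m := mul_le_mul_of_nonneg_right hlam (ha m)
    have := hrec m hm
    linarith
  clear hrec
  induction M with
  | zero => simp
  | succ M ih =>
    have h1 := ih fun m hm => hstep m (by omega)
    have h2 := mul_le_mul_of_nonneg_left h1 (sub_nonneg.2 hlam1)
    have h3 := hstep M (by omega)
    rw [pow_succ]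
    linarith

theorem exp_neg_two_mul_le {x : ℝ} (h0 : 0 ≤ x) (h1 : x ≤ 1 / 2) : Real.exp (-(2 * x)) ≤ 1 - x := by
  rw [Real.exp_neg]
  have h2 : 1 + 2 * x ≤ Real.exp (2 * x) := by linarith [Real.add_one_le_exp (2 * x)]
  calc (Real.exp (2 * x))⁻¹ ≤ (1 + 2 * x)⁻¹ := inv_anti₀ (by linarith) h2
    _ ≤ 1 - x := by
      rw [inv_le_iff_one_le_mul₀ (by linarith)]
      nlinarith

/-- The random clauses have no cycles of length at most `g` with probability bounded away
from `0`. -/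
theorem exists_le_acyclicCount (K g : ℕ) (d : ℝ) (hd : 0 < d) :
    ∃ c > 0, ∃ n₀ : ℕ, ∀ n ≥ n₀, c * (Fintype.card (KClause n K) : ℝ) ^ ⌊d * n⌋₊ ≤
      acyclicCount n K g (Fin ⌊d * n⌋₊) := by
  classical
  set W : ℝ := ∑ h ∈ Icc 1 g, 2 * (h * d ^ (h - 1) * (K : ℝ) ^ (2 * h)) with hW
  have hW0 : 0 ≤ W := sum_nonneg fun h _ => by positivity
  refine ⟨Real.exp (-(2 * W * d)), Real.exp_pos _, ⌈2 * W * (g + 1)⌉₊ + 1, fun n hn => ?_⟩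
  have hn1 : (0 : ℝ) < n := by exact_mod_cast (by omega : 0 < n)
  have hnW : 2 * W * (g + 1) ≤ n := (Nat.le_ceil _).trans (Nat.cast_le.2 (by omega))
  rcases Nat.eq_zero_or_pos (Fintype.card (KClause n K)) with hN | hN
  · rcases Nat.eq_zero_or_pos ⌊d * n⌋₊ with hM | hM
    · rw [hM]
      have h1 : acyclicCount n K g (Fin 0) = 1 := by
        have : Unique {C : Fin 0 → KClause n K // NoShortCycle (fun j => (C j).lit) g} :=
          { default := ⟨Fin.elim0, fun h h0 _ ⟨c, _⟩ => (c ⟨0, h0⟩).elim0⟩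
            uniq := fun C => Subtype.ext (Subsingleton.elim _ _) }
        exact Nat.card_unique
      rw [h1]
      simp only [pow_zero, mul_one, Nat.cast_one, Real.exp_le_one_iff, Left.neg_nonpos_iff]
      positivity
    · rw [hN, Nat.cast_zero, zero_pow hM.ne', mul_zero]
      exact Nat.cast_nonneg _
  set Nc : ℝ := (Fintype.card (KClause n K) : ℝ) with hNc
  have hNc0 : 0 < Nc := Nat.cast_pos.2 hN
  have hMd : (⌊d * n⌋₊ : ℝ) ≤ d * n := Nat.floor_le (by positivity)
  have hx0 : 0 ≤ W / n := by positivity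
  have hxg : W / n * (g + 1) ≤ 1 / 2 := by
    rw [div_mul_eq_mul_div, div_le_iff₀ hn1]; linarith
  have hx1 : W / n ≤ 1 / 2 := by
    refine le_trans ?_ hxg
    exact le_mul_of_one_le_right hx0 (by linarith [Nat.cast_nonneg (α := ℝ) g])
  -- the recursion for the probabilities: a cycle of length `h` through the new clause has about
  -- `(d n) ^ (h - 1) n ^ h` possible places, and each has probability at most `(K ^ 2 / n ^ 2) ^ h`
  have key := pow_mul_le_of_le_add_sum (a := fun m => acyclicCount n K g (Fin m) / Nc ^ m)
    (w := fun h => h * d ^ (h - 1) * (K : ℝ) ^ (2 * h) / n) (g := g) (M := ⌊d * n⌋₊)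
    (lam := W / n) (fun m => by positivity) (fun h => by positivity)
    (by rw [hW, sum_div]; exact le_of_eq (sum_congr rfl fun h _ => by ring))
    (by nlinarith) (by linarith) ?_
  · have h1 : (1 : ℝ) ≤ acyclicCount n K g (Fin 0) / Nc ^ 0 := by
      have : Nonempty {C : Fin 0 → KClause n K // NoShortCycle (fun j => (C j).lit) g} :=
        ⟨⟨Fin.elim0, fun h h0 _ ⟨c, _⟩ => (c ⟨0, h0⟩).elim0⟩⟩
      have : 0 < acyclicCount n K g (Fin 0) := Nat.card_pos
      rw [pow_zero, div_one]
      exact_mod_cast this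
    have h2 : Real.exp (-(2 * W * d)) ≤ (1 - W / n) ^ ⌊d * n⌋₊ := by
      calc Real.exp (-(2 * W * d)) ≤ Real.exp (⌊d * n⌋₊ * (-(2 * (W / n)))) := by
            refine Real.exp_le_exp.2 ?_
            have : W / n * ⌊d * n⌋₊ ≤ W / n * (d * n) := mul_le_mul_of_nonneg_left hMd hx0
            have h3 : W / n * (d * n) = W * d := by field_simp
            linarith
        _ = Real.exp (-(2 * (W / n))) ^ ⌊d * n⌋₊ := Real.exp_nat_mul _ _
        _ ≤ _ := pow_le_pow_left₀ (Real.exp_pos _).le (exp_neg_two_mul_le hx0 hx1) _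
    have h3 := (h2.trans (le_mul_of_one_le_right (pow_nonneg (by linarith) _) h1)).trans key
    rwa [le_div_iff₀ (by positivity)] at h3
  · intro m hm
    have h1 := acyclicCount_succ_ge (n := n) (K := K) g m
    rw [← hNc] at h1
    have hm1 : ((m : ℝ) + 1) ≤ d * n := le_trans (by exact_mod_cast hm) hMd
    refine le_of_mul_le_mul_right ?_ (pow_pos hNc0 (m + 1))
    rw [add_mul, sum_mul, div_mul_cancel₀ _ (pow_pos hNc0 _).ne']
    calc (acyclicCount n K g (Fin m) : ℝ) / Nc ^ m * Nc ^ (m + 1)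
        = Nc * acyclicCount n K g (Fin m) := by rw [pow_succ]; field_simp
      _ ≤ _ := h1
      _ ≤ _ := by
        refine add_le_add le_rfl (sum_le_sum fun h hh => ?_)
        obtain ⟨hh1, hh2⟩ := mem_Icc.1 hh
        have hh3 : h ≤ m + 1 := hh2.trans (min_le_right _ _)
        have e1 : (acyclicCount n K g (Fin (m + 1 - h)) : ℝ) / Nc ^ (m + 1 - h) * Nc ^ (m + 1) =
            acyclicCount n K g (Fin (m + 1 - h)) * Nc ^ h := by
          rw [← Nat.sub_add_cancel hh3, pow_add, Nat.sub_add_cancel hh3]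
          field_simp
        have e2 : ((m : ℝ) + 1) ^ (h - 1) ≤ (d * n) ^ (h - 1) :=
          pow_le_pow_left₀ (by positivity) hm1 _
        have e3 : (n : ℝ) ^ (h - 1) * (n : ℝ) ^ h * ((1 : ℝ) / (n : ℝ) ^ 2) ^ h = 1 / n := by
          obtain ⟨i, rfl⟩ : ∃ i, h = i + 1 := ⟨h - 1, by omega⟩
          rw [Nat.add_sub_cancel, div_pow, one_pow, ← pow_mul]
          field_simp
          ring
        rw [mul_assoc (_ / _), e1]
        calc (h : ℝ) * ((m + 1) ^ (h - 1) * n ^ h) * (acyclicCount n K g (Fin (m + 1 - h)) *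
              ((K : ℝ) ^ 2 / (n : ℝ) ^ 2 * Nc) ^ h)
            ≤ (h : ℝ) * ((d * n) ^ (h - 1) * n ^ h) * (acyclicCount n K g (Fin (m + 1 - h)) *
              ((K : ℝ) ^ 2 / (n : ℝ) ^ 2 * Nc) ^ h) := by gcongr
          _ = h * d ^ (h - 1) * (K : ℝ) ^ (2 * h) *
              ((n : ℝ) ^ (h - 1) * (n : ℝ) ^ h * ((1 : ℝ) / (n : ℝ) ^ 2) ^ h) *
              (acyclicCount n K g (Fin (m + 1 - h)) * Nc ^ h) := by
            rw [pow_mul]; ring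
          _ = _ := by rw [e3]; ring

end Decay

/-! ### Random clauses have few pairs of nearby variables -/

section Pairs

open Finset

variable {n K M : ℕ}

/-- A shortest path uses distinct clauses. -/
theorem exists_path_of_within_linked {C : Fin M → Fin n → Option Bool} {x y : Fin n} {t : ℕ}
    (hxy : Within (Linked C) x t y) :
    ∃ h ≤ t, ∃ (c : Fin h → Fin M) (w : Fin (h + 1) → Fin n), Function.Injective c ∧ w 0 = x ∧
      w (Fin.last h) = y ∧ ∀ i : Fin h, w i.castSucc ≠ w i.succ ∧
        C (c i) (w i.castSucc) ≠ none ∧ C (c i) (w i.succ) ≠ none := by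
  classical
  have hex : ∃ h, Within (Linked C) x h y := ⟨t, hxy⟩
  obtain ⟨h, hh, hmin⟩ : ∃ h, Within (Linked C) x h y ∧ ∀ h', Within (Linked C) x h' y → h ≤ h' :=
    ⟨Nat.find hex, Nat.find_spec hex, fun h' h1 => Nat.find_min' hex h1⟩
  obtain ⟨h', hle, w, w0, wh, hw⟩ := hh.exists_path
  have hpath : Within (Linked C) x h' y := by
    have := Within.of_path hw (Nat.zero_le h') le_rfl
    rwa [w0, wh] at this
  obtain rfl : h = h' := le_antisymm (hmin _ hpath) hle
  choose c hc1 hc2 using hw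
  -- any way to get from `w i` to `w (j + 1)` in one hop, for `i < j`, would shorten the path
  have hshort : ∀ i j, i < j → j < h → ¬Linked C (w i) (w (j + 1)) := by
    intro i j hij hj hl
    have hw' : ∀ i < h, Linked C (w i) (w (i + 1)) := fun i hi => ⟨c i hi, hc1 i hi, hc2 i hi⟩
    have h1 := ((Within.of_path hw' (Nat.zero_le i) (by omega)).step hl).trans
      (Within.of_path hw' (show j + 1 ≤ h by omega) le_rfl)
    rw [w0, wh] at h1
    have := hmin _ h1
    omega
  refine ⟨h, hmin _ hxy, fun i => c i i.2, fun i => w i, ?_, w0, by simpa using wh, fun i => ?_⟩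
  · intro i j hij
    rcases lt_trichotomy i j with hlt | he | hlt
    · exact absurd ⟨c j j.2, by have := hc1 i i.2; simp only at hij; rwa [hij] at this, hc2 j j.2⟩
        (hshort i j hlt j.2)
    · exact he
    · exact absurd ⟨c i i.2, by have := hc1 j j.2; simp only at hij; rwa [← hij] at this, hc2 i i.2⟩
        (hshort j i hlt i.2)
  · refine ⟨fun he => ?_, hc1 i i.2, hc2 i i.2⟩
    have hw' : ∀ i < h, Linked C (w i) (w (i + 1)) := fun i hi => ⟨c i hi, hc1 i hi, hc2 i hi⟩
    have h1 := Within.of_path hw' (Nat.zero_le (i : ℕ)) i.2.le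
    have h2 := Within.of_path hw' (show (i : ℕ) + 1 ≤ h by omega) le_rfl
    have he' : w i = w (i + 1) := by simpa using he
    rw [← he'] at h2
    have h3 := h1.trans h2
    rw [w0, wh] at h3
    have := hmin _ h3
    omega

/-- The expected number of pairs of variables at bounded distance is linear. -/
theorem sum_pairCount_le {d : ℝ} (hn : 0 < n) (hM : (M : ℝ) ≤ d * n) (t : ℕ) :
    ∑ C : Fin M → KClause n K, (pairCount (fun j => (C j).lit) t : ℝ) ≤
      (∑ h ∈ range (t + 1), (d * (K : ℝ) ^ 2) ^ h) * n *
        (Fintype.card (KClause n K) : ℝ) ^ M := by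
  classical
  set Nc : ℝ := (Fintype.card (KClause n K) : ℝ) with hNc
  let Good : ∀ h : ℕ, (Fin h → Fin M) → (Fin (h + 1) → Fin n) → Finset (Fin M → KClause n K) :=
    fun h c w => univ.filter fun C => ∀ i, C (c i) ∈ clausesAt₂ K (w i.castSucc) (w i.succ)
  let P : ∀ h : ℕ, Finset ((Fin h → Fin M) × (Fin (h + 1) → Fin n)) :=
    fun h => univ.filter fun p => Function.Injective p.1 ∧ ∀ i : Fin h, p.2 i.castSucc ≠ p.2 i.succ
  have hGood : ∀ h, ∀ p ∈ P h, ((Good h p.1 p.2).card : ℝ) ≤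
      ((K : ℝ) ^ 2 / (n : ℝ) ^ 2) ^ h * Nc ^ M := by
    intro h p hp
    obtain ⟨hinj, hne⟩ := (mem_filter.1 hp).2
    have hhM : h ≤ M := by simpa using Fintype.card_le_of_injective _ hinj
    have : Fintype {i // i ∉ Set.range p.1} := Fintype.ofFinite _
    have h1 := card_filter_le_mul_prod p.1
      (fun i => clausesAt₂ K (p.2 i.castSucc) (p.2 i.succ)) (fun _ => True)
      (fun C : Fin M → KClause n K => ∀ i, C (p.1 i) ∈ clausesAt₂ K (p.2 i.castSucc) (p.2 i.succ))
      fun C hC => ⟨trivial, hC⟩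
    rw [filter_true, card_univ, Fintype.card_fun, card_notMem_range hinj, Fintype.card_fin] at h1
    calc ((Good h p.1 p.2).card : ℝ) ≤ Nc ^ (M - h) *
          ∏ i : Fin h, ((clausesAt₂ K (p.2 i.castSucc) (p.2 i.succ)).card : ℝ) := by
            rw [hNc]; exact_mod_cast h1
      _ ≤ Nc ^ (M - h) * ∏ _i : Fin h, ((K : ℝ) ^ 2 / (n : ℝ) ^ 2 * Nc) := by
          gcongr with i
          exact card_clausesAt₂_le (hne i)
      _ = ((K : ℝ) ^ 2 / (n : ℝ) ^ 2) ^ h * (Nc ^ (M - h) * Nc ^ h) := by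
          simp only [prod_const, card_univ, Fintype.card_fin]; ring
      _ = _ := by rw [← pow_add, Nat.sub_add_cancel hhM]
  have hsub : (univ.filter fun q : (Fin M → KClause n K) × (Fin n × Fin n) =>
      Within (Linked fun j => (q.1 j).lit) q.2.1 t q.2.2) ⊆
      (range (t + 1)).biUnion fun h => (P h).biUnion fun p =>
        (Good h p.1 p.2).image fun C => (C, (p.2 0, p.2 (Fin.last h))) := by
    intro q hq
    obtain ⟨h, hh, c, w, hc, hx, hy, hw⟩ := exists_path_of_within_linked (mem_filter.1 hq).2
    refine mem_biUnion.2 ⟨h, mem_range.2 (by omega), mem_biUnion.2 ⟨(c, w),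
      mem_filter.2 ⟨mem_univ _, hc, fun i => (hw i).1⟩, mem_image.2 ⟨q.1,
        mem_filter.2 ⟨mem_univ _, fun i => mem_clausesAt₂.2 (hw i).2⟩, ?_⟩⟩⟩
    dsimp only
    rw [hx, hy]
  have hsum : ∑ C : Fin M → KClause n K, pairCount (fun j => (C j).lit) t =
      (univ.filter fun q : (Fin M → KClause n K) × (Fin n × Fin n) =>
        Within (Linked fun j => (q.1 j).lit) q.2.1 t q.2.2).card := by
    rw [card_filter, Fintype.sum_prod_type]
    refine sum_congr rfl fun C _ => ?_
    rw [pairCount, card_filter]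
  have hcard := (card_le_card hsub).trans (card_biUnion_le.trans
    (sum_le_sum fun h _ => card_biUnion_le.trans (sum_le_sum fun p _ => card_image_le)))
  rw [← hsum] at hcard
  have hcard' : ∑ C : Fin M → KClause n K, (pairCount (fun j => (C j).lit) t : ℝ) ≤
      ∑ h ∈ range (t + 1), ∑ p ∈ P h, ((Good h p.1 p.2).card : ℝ) := by exact_mod_cast hcard
  refine hcard'.trans ?_
  rw [sum_mul, sum_mul]
  refine sum_le_sum fun h _ => ?_
  have hP : ((P h).card : ℝ) ≤ (d * n) ^ h * (n : ℝ) ^ (h + 1) := by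
    calc ((P h).card : ℝ) ≤ ((M ^ h * n ^ (h + 1) : ℕ) : ℝ) := by
          refine Nat.cast_le.2 ((card_le_univ _).trans (le_of_eq ?_))
          simp
      _ ≤ _ := by push_cast; gcongr
  have hn' : (n : ℝ) ≠ 0 := by positivity
  calc ∑ p ∈ P h, ((Good h p.1 p.2).card : ℝ)
      ≤ ∑ _p ∈ P h, ((K : ℝ) ^ 2 / (n : ℝ) ^ 2) ^ h * Nc ^ M := sum_le_sum (hGood h)
    _ = (P h).card * (((K : ℝ) ^ 2 / (n : ℝ) ^ 2) ^ h * Nc ^ M) := by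
        rw [sum_const, nsmul_eq_mul]
    _ ≤ ((d * n) ^ h * (n : ℝ) ^ (h + 1)) * (((K : ℝ) ^ 2 / (n : ℝ) ^ 2) ^ h * Nc ^ M) := by
        gcongr
    _ = _ := by
        rw [pow_succ (n : ℝ) h, ← mul_assoc, ← mul_assoc]
        congr 1
        rw [mul_right_comm _ (n : ℝ), ← mul_pow, ← mul_pow]
        congr 2
        field_simp

/-- Markov's inequality for the number of pairs of nearby variables. -/
theorem card_lt_pairCount_le {d : ℝ} (hn : 0 < n) (hM : (M : ℝ) ≤ d * n) (t : ℕ) {B : ℝ}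
    [DecidablePred fun C : Fin M → KClause n K => B * n < pairCount (fun j => (C j).lit) t] :
    B * ((univ.filter fun C : Fin M → KClause n K =>
      B * n < pairCount (fun j => (C j).lit) t).card : ℝ) ≤
      (∑ h ∈ range (t + 1), (d * (K : ℝ) ^ 2) ^ h) * (Fintype.card (KClause n K) : ℝ) ^ M := by
  have hn' : (0 : ℝ) < n := by exact_mod_cast hn
  refine le_of_mul_le_mul_right ?_ hn'
  calc _ = ∑ C ∈ univ.filter fun C : Fin M → KClause n K =>
        B * n < pairCount (fun j => (C j).lit) t, (B * n) := by
          rw [sum_const, nsmul_eq_mul]; ring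
    _ ≤ ∑ C ∈ univ.filter fun C : Fin M → KClause n K =>
        B * n < pairCount (fun j => (C j).lit) t, (pairCount (fun j => (C j).lit) t : ℝ) :=
          sum_le_sum fun C hC => (mem_filter.1 hC).2.le
    _ ≤ ∑ C : Fin M → KClause n K, (pairCount (fun j => (C j).lit) t : ℝ) :=
          sum_le_sum_of_subset_of_nonneg (filter_subset _ _) fun _ _ _ => Nat.cast_nonneg _
    _ ≤ _ := (sum_pairCount_le hn hM t).trans (le_of_eq (by ring))

end Pairs

/-! ### Isolated copies of a hypertree -/

section Copies

open Finset

variable {n m s e K ρ q q' : ℕ} {T : Fin e → Fin s → Option Bool}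
  {C C' : Fin m → Fin n → Option Bool} {f f' : Fin s → Fin n} {g g' : Fin e → Fin m}

/-- The clauses `T` appear in `C`, with the variables renamed by `f` and the clauses by `g`, and no
other clause of `C` contains one of these variables. -/
structure IsIsolatedCopy (T : Fin e → Fin s → Option Bool) (C : Fin m → Fin n → Option Bool)
    (f : Fin s → Fin n) (g : Fin e → Fin m) : Prop where
  var_inj : Function.Injective f
  clause_inj : Function.Injective g
  lit : ∀ i u, C (g i) (f u) = T i u
  scope : ∀ i v, C (g i) v ≠ none → v ∈ Set.range f
  isolated : ∀ j u, C j (f u) ≠ none → j ∈ Set.range g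

/-- On an isolated copy, the algorithm takes the same decisions as on the hypertree itself, as soon
as the seeds suffice for each of them. -/
theorem IsIsolatedCopy.run_eq {τ : LocalRule K (2 * (ρ + 1))} (h : IsIsolatedCopy T C f g)
    (hT : IsUniform K T) (hC : IsUniform K C) {ord : Fin n → ℕ}
    (hord : ∀ u u', ord (f u) < ord (f u') ↔ u < u') {σT : Fin s → Bool} {σ : Fin n → Bool}
    {dec : Fin n → ℝ → Bool} (hσ : IsRun τ C ord dec σ)
    (hdec : ∀ u, dec (f u) (τ.prob (residual T (before (fun i => i) u) σT) u) = σT u)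
    (u : Fin s) : σ (f u) = σT u := by
  induction u using WellFoundedLT.induction with
  | _ u ih =>
  have hp : τ.prob (residual T (before (fun i => i) u) σT) u =
      τ.prob (residual C (before ord (f u)) σ) (f u) := by
    refine prob_residual_eq τ hT hC f g notMem_before_self ?_ ?_ (fun _ _ _ _ he => h.var_inj he)
      (fun _ _ _ _ he => h.clause_inj he) ?_ ?_
    · refine fun w _ i _ => ⟨fun v _ => h.lit i v, fun v' hv' => ?_⟩
      obtain ⟨v, rfl⟩ := h.scope i v' hv'
      exact ⟨v, by rwa [h.lit] at hv', rfl⟩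
    · intro w _ j hj
      obtain ⟨i, rfl⟩ := h.isolated j w hj
      exact ⟨i, by rwa [h.lit] at hj, rfl⟩
    · intro v _
      rw [mem_before, mem_before, hord]
      exact Iff.rfl
    · intro v _ hv
      exact ih v (mem_before.1 hv)
  rw [hσ (f u), ← hp, hdec u]

theorem IsIsolatedCopy.satisfies (h : IsIsolatedCopy T C f g) {σT : Fin s → Bool}
    {σ : Fin n → Bool} (hσ : ∀ u, σ (f u) = σT u) (hsat : Satisfies C σ) : Satisfies T σT := by
  intro i
  obtain ⟨⟨v, hv⟩, v', hv'⟩ := hsat (g i)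
  obtain ⟨u, rfl⟩ := h.scope i v (by rw [hv]; simp)
  obtain ⟨u', rfl⟩ := h.scope i v' (by rw [hv']; simp)
  rw [h.lit, hσ] at hv hv'
  exact ⟨⟨u, hv⟩, u', hv'⟩

/-- Isolated copies of a connected hypertree are equal or disjoint. -/
theorem IsIsolatedCopy.range_subset (h : IsIsolatedCopy T C f g) (h' : IsIsolatedCopy T C f' g')
    (hT : IsHypertree K T) {u u' : Fin s} (hu : f u = f' u') (v : Fin s) :
    f v ∈ Set.range f' := by
  refine hT.connected {v | f v ∈ Set.range f'} ⟨u, u', hu.symm⟩ ?_ v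
  rintro i w w' hw hw' ⟨z, hz⟩
  obtain ⟨i', hi'⟩ := h'.isolated (g i) z (by rwa [hz, h.lit])
  exact h'.scope i' _ (by rwa [hi', h.lit])

theorem exists_mem_scope (hK : 0 < K) (hT : IsUniform K C) (i : Fin m) : ∃ u, C i u ≠ none := by
  have h1 : 0 < (univ.filter fun u => C i u ≠ none).card := by rw [hT i]; exact hK
  obtain ⟨u, hu⟩ := card_pos.1 h1
  exact ⟨u, (mem_filter.1 hu).2⟩

/-- The choice of one element in each of `s` consecutive blocks of `q` elements. -/
def blockMap (h : s * q ≤ n) (a : Fin s → Fin q) (i : Fin s) : Fin n :=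
  Fin.castLE h (finProdFinEquiv (i, a i))

theorem blockMap_eq {h : s * q ≤ n} {a a' : Fin s → Fin q} {i i' : Fin s}
    (he : blockMap h a i = blockMap h a' i') : i = i' ∧ a i = a' i' := by
  have := finProdFinEquiv.injective (Fin.castLE_injective h he)
  exact Prod.mk.inj this

theorem blockMap_injective (h : s * q ≤ n) (a : Fin s → Fin q) :
    Function.Injective (blockMap h a) := fun _ _ he => (blockMap_eq he).1

theorem blockMap_lt {h : s * q ≤ n} {a : Fin s → Fin q} {i i' : Fin s} :
    blockMap h a i < blockMap h a i' ↔ i < i' := by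
  have key : ∀ i i' : Fin s, i < i' → blockMap h a i < blockMap h a i' := by
    intro i i' hlt
    change ((a i : ℕ) + q * i) < (a i' : ℕ) + q * i'
    have h1 : q * (i + 1) ≤ q * i' := Nat.mul_le_mul_left q hlt
    have h2 := (a i).2
    rw [mul_add, mul_one] at h1
    omega
  refine ⟨fun hlt => ?_, key i i'⟩
  rcases lt_trichotomy i i' with h1 | rfl | h1
  · exact h1
  · exact absurd hlt (lt_irrefl _)
  · exact absurd hlt (key i' i h1).asymm

open Classical in
/-- The isolated copies of `T` in `C` whose `i`-th variable is, in the order given by the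
permutation `π`, in the `i`-th block of variables, and whose `i`-th clause is in the `i`-th block
of clauses. -/
noncomputable def copySet (T : Fin e → Fin s → Option Bool) (hn : s * q ≤ n) (hm : e * q' ≤ m)
    (π : Equiv.Perm (Fin n)) (C : Fin m → Fin n → Option Bool) :
    Finset ((Fin s → Fin q) × (Fin e → Fin q')) :=
  univ.filter fun p => IsIsolatedCopy T C (fun u => π (blockMap hn p.1 u)) (blockMap hm p.2)

variable {hn : s * q ≤ n} {hm : e * q' ≤ m} {π : Equiv.Perm (Fin n)}

theorem mem_copySet {p : (Fin s → Fin q) × (Fin e → Fin q')} : p ∈ copySet T hn hm π C ↔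
    IsIsolatedCopy T C (fun u => π (blockMap hn p.1 u)) (blockMap hm p.2) := by
  simp [copySet]

theorem copySet_disjoint (hK : 0 < K) (hT : IsHypertree K T)
    {p p' : (Fin s → Fin q) × (Fin e → Fin q')}
    (hp : p ∈ copySet T hn hm π C) (hp' : p' ∈ copySet T hn hm π C) {u u' : Fin s}
    (he : π (blockMap hn p.1 u) = π (blockMap hn p'.1 u')) : p = p' := by
  have h := mem_copySet.1 hp
  have h' := mem_copySet.1 hp'
  refine Prod.ext (funext fun v => ?_) (funext fun i => ?_)
  · obtain ⟨v', hv'⟩ := h.range_subset h' hT he v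
    obtain ⟨h1, h2⟩ := blockMap_eq (π.injective hv')
    rw [← h2, h1]
  · obtain ⟨v, hv⟩ := exists_mem_scope hK hT.uniform i
    obtain ⟨v', hv'⟩ := h.range_subset h' hT he v
    obtain ⟨i', hi'⟩ := h'.isolated (blockMap hm p.2 i) v' (by
      have := h.lit i v
      dsimp only at hv' this
      rw [hv', this]; exact hv)
    obtain ⟨h1, h2⟩ := blockMap_eq hi'
    rw [← h2, h1]

/-- Changing a clause affects only the copies that meet the old or the new clause. -/
theorem card_copySet_sdiff_le (hK : 0 < K) (hT : IsHypertree K T) (hC : IsUniform K C)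
    (hC' : IsUniform K C') {j : Fin m} (hj : ∀ i ≠ j, C i = C' i) :
    (copySet T hn hm π C \ copySet T hn hm π C').card ≤ 2 * K := by
  classical
  -- by disjointness, a variable of the old or the new clause lies in at most one lost copy
  have hmeet : ∀ p ∈ copySet T hn hm π C \ copySet T hn hm π C', ∃ u,
      C j (π (blockMap hn p.1 u)) ≠ none ∨ C' j (π (blockMap hn p.1 u)) ≠ none := by
    intro p hp
    obtain ⟨h1, h2⟩ := mem_sdiff.1 hp
    have h := mem_copySet.1 h1
    by_contra hne
    push Not at hne
    have hjg : ∀ i, blockMap hm p.2 i ≠ j := by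
      rintro i hi
      obtain ⟨u, hu⟩ := exists_mem_scope hK hT.uniform i
      refine hu ?_
      rw [← h.lit i u, hi]
      exact (hne u).1
    refine h2 (mem_copySet.2 ⟨h.var_inj, h.clause_inj, fun i u => ?_, fun i v hv => ?_,
      fun i u hi => ?_⟩)
    · rw [← hj _ (hjg i)]; exact h.lit i u
    · rw [← hj _ (hjg i)] at hv; exact h.scope i v hv
    · have hij : i ≠ j := by
        rintro rfl
        exact hi (hne u).2
      rw [← hj i hij] at hi
      exact h.isolated i u hi
  have : Nonempty (Fin s) := ⟨⟨0, by have := hT.card; omega⟩⟩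
  choose! u hu using hmeet
  have hle : (copySet T hn hm π C \ copySet T hn hm π C').card ≤
      ((univ.filter fun v => C j v ≠ none) ∪ univ.filter fun v => C' j v ≠ none).card := by
    refine card_le_card_of_injOn (fun p => π (blockMap hn p.1 (u p))) ?_ ?_
    · intro p hp
      rcases hu p hp with h | h
      · exact mem_union_left _ (mem_filter.2 ⟨mem_univ _, h⟩)
      · exact mem_union_right _ (mem_filter.2 ⟨mem_univ _, h⟩)
    · intro p hp p' hp' he
      exact copySet_disjoint hK hT (mem_sdiff.1 hp).1 (mem_sdiff.1 hp').1 he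
  refine hle.trans ((card_union_le _ _).trans ?_)
  rw [hC j, hC' j, two_mul]

theorem abs_card_copySet_sub_le (hK : 0 < K) (hT : IsHypertree K T) (hC : IsUniform K C)
    (hC' : IsUniform K C') {j : Fin m} (hj : ∀ i ≠ j, C i = C' i) :
    |((copySet T hn hm π C).card : ℝ) - (copySet T hn hm π C').card| ≤ 2 * K := by
  have h1 := card_copySet_sdiff_le (hn := hn) (hm := hm) (π := π) hK hT hC hC' hj
  have h2 := card_copySet_sdiff_le (hn := hn) (hm := hm) (π := π) hK hT hC' hC
    fun i hi => (hj i hi).symm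
  have h3 := card_le_card_sdiff_add_card (s := copySet T hn hm π C') (t := copySet T hn hm π C)
  have h4 := card_le_card_sdiff_add_card (s := copySet T hn hm π C) (t := copySet T hn hm π C')
  have h3' : ((copySet T hn hm π C).card : ℝ) ≤ 2 * K + (copySet T hn hm π C').card := by
    exact_mod_cast (by omega)
  have h4' : ((copySet T hn hm π C').card : ℝ) ≤ 2 * K + (copySet T hn hm π C).card := by
    exact_mod_cast (by omega)
  rw [abs_le]
  constructor <;> linarith

end Copies

/-! ### Random clauses contain many isolated copies -/

section Concentration

open Finset
open scoped BigOperators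

variable {n m s e K q q' : ℕ} {T : Fin e → Fin s → Option Bool}

theorem card_kClause_le (n K : ℕ) : Fintype.card (KClause n K) ≤ (2 * n) ^ K := by
  classical
  have hcard : ∀ c : KClause n K, (univ.filter fun i => c.lit i ≠ none).card = K :=
    KClause.card_lit
  -- a clause is determined by the increasing list of its variables, with their polarities
  let F : KClause n K → Fin K → Bool × Fin n := fun c i =>
    ((c.lit ((univ.filter fun i => c.lit i ≠ none).orderEmbOfFin (hcard c) i)).getD true,
      (univ.filter fun i => c.lit i ≠ none).orderEmbOfFin (hcard c) i)
  have hF : ∀ c c' : KClause n K, F c = F c' → ∀ v, c.lit v ≠ none → c'.lit v = c.lit v := by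
    intro c c' he v hv
    have hr := range_orderEmbOfFin _ (hcard c)
    obtain ⟨i, hi⟩ : v ∈ Set.range
        ((univ.filter fun i => c.lit i ≠ none).orderEmbOfFin (hcard c)) := by
      rw [hr]; simpa using hv
    have h1 : (F c i).2 = v := hi
    have h2 : (F c' i).2 = v := by rw [← he]; exact h1
    have h3 : c'.lit v ≠ none := by
      have := orderEmbOfFin_mem _ (hcard c') i
      rw [← h2]
      exact (mem_filter.1 this).2
    have h4 : (F c i).1 = (c.lit v).getD true := by rw [← h1]
    have h5 : (F c' i).1 = (c'.lit v).getD true := by rw [← h2]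
    rw [he, h5] at h4
    obtain ⟨b, hb⟩ := Option.ne_none_iff_exists'.1 hv
    obtain ⟨b', hb'⟩ := Option.ne_none_iff_exists'.1 h3
    rw [hb, hb'] at h4 ⊢
    exact congrArg _ h4
  have hinj : Function.Injective F := by
    intro c c' he
    refine KClause.lit_injective (funext fun v => ?_)
    by_cases hv : c.lit v = none
    · by_contra hne
      have hv' : c'.lit v ≠ none := fun h => hne (by rw [hv, h])
      exact hne (hF c' c he.symm v hv')
    · exact (hF c c' he v hv).symm
  refine (Fintype.card_le_of_injective F hinj).trans (le_of_eq ?_)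
  simp

/-- At least a proportion of `1 - s K / n` of the clauses avoid `s` given variables. -/
theorem le_card_avoid (f : Fin s → Fin n) :
    (1 - s * K / n : ℝ) * Fintype.card (KClause n K) ≤
      ((univ.filter fun c : KClause n K => ∀ u, c.lit (f u) = none).card : ℝ) := by
  classical
  rcases Nat.eq_zero_or_pos s with rfl | hs
  · simp only [CharP.cast_eq_zero, zero_mul, zero_div, sub_zero, one_mul, IsEmpty.forall_iff,
      filter_true, card_univ, le_refl]
  have hn : (0 : ℝ) < n := by exact_mod_cast (f ⟨0, hs⟩).pos
  have h1 : (univ : Finset (KClause n K)) ⊆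
      (univ.filter fun c : KClause n K => ∀ u, c.lit (f u) = none) ∪
        univ.biUnion fun u => clausesAt K (f u) := by
    intro c _
    by_cases h : ∀ u, c.lit (f u) = none
    · exact mem_union_left _ (mem_filter.2 ⟨mem_univ _, h⟩)
    · push Not at h
      obtain ⟨u, hu⟩ := h
      exact mem_union_right _ (mem_biUnion.2 ⟨u, mem_univ _, mem_clausesAt.2 hu⟩)
  have h2 := (card_le_card h1).trans ((card_union_le _ _).trans
    (Nat.add_le_add_left card_biUnion_le _))
  have h3 : (Fintype.card (KClause n K) : ℝ) ≤
      ((univ.filter fun c : KClause n K => ∀ u, c.lit (f u) = none).card : ℝ) +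
        ∑ u, ((clausesAt K (f u)).card : ℝ) := by
    rw [card_univ] at h2
    exact_mod_cast h2
  have h4 : ∀ u, ((clausesAt K (f u)).card : ℝ) = K / n * Fintype.card (KClause n K) := by
    intro u
    have : ((clausesAt K (f u)).card : ℝ) * n = K * Fintype.card (KClause n K) := by
      exact_mod_cast card_clausesAt_mul (f u)
    field_simp
    linarith
  simp only [h4, sum_const, card_univ, Fintype.card_fin, nsmul_eq_mul] at h3
  have h5 : (s * K / n : ℝ) * Fintype.card (KClause n K) =
      s * (K / n * Fintype.card (KClause n K)) := by ring
  linarith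

/-- The clause obtained from a clause of `T` by renaming its variables. -/
theorem exists_pushforward (hT : IsUniform K T) {f : Fin s → Fin n} (hf : Function.Injective f)
    (i : Fin e) : ∃ c : KClause n K, (∀ u, c.lit (f u) = T i u) ∧
      ∀ v, c.lit v ≠ none → v ∈ Set.range f := by
  classical
  have hcard :
      (univ.filter fun v => Function.extend f (T i) (fun _ => none) v ≠ none).card = K := by
    rw [← hT i]
    symm
    refine card_bij (fun u _ => f u) ?_ (fun u _ u' _ he => hf he) ?_
    · intro u hu
      simpa [hf.extend_apply] using hu
    · intro v hv
      have hv := (mem_filter.1 hv).2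
      by_cases hr : ∃ u, f u = v
      · obtain ⟨u, rfl⟩ := hr
        exact ⟨u, by simpa [hf.extend_apply] using hv, rfl⟩
      · exact absurd (Function.extend_apply' _ _ _ hr) hv
  refine ⟨⟨_, hcard⟩, fun u => ?_, fun v hv => ?_⟩
  · change Function.extend f (T i) (fun _ => none) (f u) = T i u
    exact hf.extend_apply _ _ u
  · change Function.extend f (T i) (fun _ => none) v ≠ none at hv
    by_contra hr
    exact hv (Function.extend_apply' _ _ _ hr)

/-- The number of sequences of clauses which contain a given isolated copy. -/
theorem le_card_isIsolatedCopy (hT : IsUniform K T) {f : Fin s → Fin n} {g : Fin e → Fin m}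
    (hf : Function.Injective f) (hg : Function.Injective g) (hs : (s * K : ℝ) ≤ n)
    [DecidablePred fun C : Fin m → KClause n K => IsIsolatedCopy T (fun j => (C j).lit) f g] :
    ((1 - s * K / n : ℝ) * Fintype.card (KClause n K)) ^ (m - e) ≤
      ((univ.filter fun C : Fin m → KClause n K =>
        IsIsolatedCopy T (fun j => (C j).lit) f g).card : ℝ) := by
  classical
  choose c hc1 hc2 using fun i => exists_pushforward hT hf i
  let t : Fin m → Finset (KClause n K) := fun j =>
    if h : ∃ i, g i = j then {c h.choose} else univ.filter fun c => ∀ u, c.lit (f u) = none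
  have hsub : Fintype.piFinset t ⊆ univ.filter fun C : Fin m → KClause n K =>
      IsIsolatedCopy T (fun j => (C j).lit) f g := by
    intro C hC
    have hC := Fintype.mem_piFinset.1 hC
    have hCg : ∀ i, C (g i) = c i := by
      intro i
      have h1 : ∃ i', g i' = g i := ⟨i, rfl⟩
      have := hC (g i)
      simp only [t, dif_pos h1, mem_singleton] at this
      rw [this, hg h1.choose_spec]
    refine mem_filter.2 ⟨mem_univ _, hf, hg, fun i u => ?_, fun i v => ?_, fun j u hj => ?_⟩
    · simp only [hCg, hc1]
    · simp only [hCg]; exact hc2 i v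
    · by_contra hne
      change ¬∃ i, g i = j at hne
      have := hC j
      simp only [t] at this
      rw [dif_neg hne] at this
      exact hj ((mem_filter.1 this).2 u)
  have hnn : 0 ≤ (1 - s * K / n : ℝ) * Fintype.card (KClause n K) := by
    refine mul_nonneg (sub_nonneg.2 (div_le_one_of_le₀ hs (Nat.cast_nonneg _))) (Nat.cast_nonneg _)
  calc ((1 - s * K / n : ℝ) * Fintype.card (KClause n K)) ^ (m - e)
      ≤ ((univ.filter fun c : KClause n K => ∀ u, c.lit (f u) = none).card : ℝ) ^ (m - e) :=
        pow_le_pow_left₀ hnn (le_card_avoid f) _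
    _ = ∏ j, ((t j).card : ℝ) := by
        have h1 : ∀ j, ((t j).card : ℝ) = if j ∈ univ.image g then (1 : ℝ) else
            ((univ.filter fun c : KClause n K => ∀ u, c.lit (f u) = none).card : ℝ) := by
          intro j
          by_cases hj : ∃ i, g i = j
          · rw [if_pos (by simpa using hj)]; simp [t, dif_pos hj]
          · rw [if_neg (by simpa using hj)]; simp only [t]; rw [dif_neg hj]
        simp only [h1, prod_ite, prod_const_one, one_mul, prod_const]
        congr 1
        rw [filter_not, filter_mem_eq_inter, univ_inter, card_univ_sdiff,
          card_image_of_injective _ hg]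
        simp
    _ = ((Fintype.piFinset t).card : ℝ) := by rw [Fintype.card_piFinset]; push_cast; rfl
    _ ≤ _ := Nat.cast_le.2 (card_le_card hsub)

/-- The expected number of isolated copies. -/
theorem le_expect_card_copySet [Nonempty (KClause n K)] (hT : IsUniform K T) (hn : s * q ≤ n)
    (hm : e * q' ≤ m) (hem : e ≤ m) (hs : (s * K : ℝ) ≤ n) (π : Equiv.Perm (Fin n)) :
    (q : ℝ) ^ s * (q' : ℝ) ^ e * (1 - s * K / n) ^ m / (Fintype.card (KClause n K) : ℝ) ^ e ≤
      𝔼 C : Fin m → KClause n K, ((copySet T hn hm π fun j => (C j).lit).card : ℝ) := by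
  classical
  set Nc : ℝ := (Fintype.card (KClause n K) : ℝ) with hNc
  have hNc0 : 0 < Nc := Nat.cast_pos.2 Fintype.card_pos
  have hx0 : 0 ≤ (1 - s * K / n : ℝ) := sub_nonneg.2 (div_le_one_of_le₀ hs (Nat.cast_nonneg _))
  have hx1 : (1 - s * K / n : ℝ) ≤ 1 := sub_le_self _ (by positivity)
  have hsum : ∑ C : Fin m → KClause n K, ((copySet T hn hm π fun j => (C j).lit).card : ℝ) =
      ∑ p : (Fin s → Fin q) × (Fin e → Fin q'), ((univ.filter fun C : Fin m → KClause n K =>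
        IsIsolatedCopy T (fun j => (C j).lit) (fun u => π (blockMap hn p.1 u))
          (blockMap hm p.2)).card : ℝ) := by
    have h1 : ∀ C : Fin m → KClause n K, ((copySet T hn hm π fun j => (C j).lit).card : ℝ) =
        ∑ p : (Fin s → Fin q) × (Fin e → Fin q'), if IsIsolatedCopy T (fun j => (C j).lit)
          (fun u => π (blockMap hn p.1 u)) (blockMap hm p.2) then (1 : ℝ) else 0 := by
      intro C
      rw [copySet, card_filter]; push_cast; rfl
    simp only [h1]
    rw [sum_comm]
    refine sum_congr rfl fun p _ => ?_
    rw [card_filter]; push_cast; rfl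
  have hlow : (q : ℝ) ^ s * (q' : ℝ) ^ e * ((1 - s * K / n : ℝ) * Nc) ^ (m - e) ≤
      ∑ C : Fin m → KClause n K, ((copySet T hn hm π fun j => (C j).lit).card : ℝ) := by
    rw [hsum]
    calc (q : ℝ) ^ s * (q' : ℝ) ^ e * ((1 - s * K / n : ℝ) * Nc) ^ (m - e) =
        ∑ _p : (Fin s → Fin q) × (Fin e → Fin q'), ((1 - s * K / n : ℝ) * Nc) ^ (m - e) := by
          simp
      _ ≤ _ := sum_le_sum fun p _ => le_card_isIsolatedCopy hT
          (π.injective.comp (blockMap_injective hn p.1)) (blockMap_injective hm p.2) hs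
  rw [Fintype.expect_eq_sum_div_card, Fintype.card_fun, Fintype.card_fin, Nat.cast_pow, ← hNc,
    div_le_div_iff₀ (by positivity) (by positivity)]
  calc (q : ℝ) ^ s * (q' : ℝ) ^ e * (1 - s * K / n) ^ m * Nc ^ m
      ≤ (q : ℝ) ^ s * (q' : ℝ) ^ e * (1 - s * K / n) ^ (m - e) * Nc ^ m := by
        gcongr ?_ * _
        refine mul_le_mul_of_nonneg_left ?_ (by positivity)
        exact pow_le_pow_of_le_one hx0 hx1 (Nat.sub_le _ _)
    _ = (q : ℝ) ^ s * (q' : ℝ) ^ e * ((1 - s * K / n : ℝ) * Nc) ^ (m - e) * Nc ^ e := by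
        have h1 : Nc ^ m = Nc ^ (m - e) * Nc ^ e := by rw [← pow_add, Nat.sub_add_cancel hem]
        rw [mul_pow, h1]
        ring
    _ ≤ _ := mul_le_mul_of_nonneg_right hlow (by positivity)

/-- Chebyshev's inequality for the number of isolated copies. -/
theorem card_copySet_lt_le [Nonempty (KClause n K)] (hK : 0 < K) (hT : IsHypertree K T)
    (hn : s * q ≤ n) (hm : e * q' ≤ m) (π : Equiv.Perm (Fin n)) {R : ℝ}
    (hR : 2 * R ≤ 𝔼 C : Fin m → KClause n K, ((copySet T hn hm π fun j => (C j).lit).card : ℝ))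
    [DecidablePred fun C : Fin m → KClause n K =>
      ((copySet T hn hm π fun j => (C j).lit).card : ℝ) < R] :
    R ^ 2 * ((univ.filter fun C : Fin m → KClause n K =>
      ((copySet T hn hm π fun j => (C j).lit).card : ℝ) < R).card : ℝ) ≤
      m * (2 * K) ^ 2 * (Fintype.card (KClause n K) : ℝ) ^ m := by
  classical
  set F : (Fin m → KClause n K) → ℝ := fun C => ((copySet T hn hm π fun j => (C j).lit).card : ℝ)
  have hu : ∀ C : Fin m → KClause n K, IsUniform K fun j => (C j).lit := fun C j => (C j).card_lit
  have hvar := variance_le_sum_sq F (fun _ => 2 * K) fun C j c =>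
    abs_card_copySet_sub_le hK hT (hu _) (hu _) (j := j) fun i hi => by
      simp only [Function.update_of_ne hi]
  simp only [sum_const, card_univ, Fintype.card_fin, nsmul_eq_mul] at hvar
  have hN : (0 : ℝ) < (Fintype.card (Fin m → KClause n K) : ℝ) := Nat.cast_pos.2 Fintype.card_pos
  rw [Fintype.expect_eq_sum_div_card, div_le_iff₀ hN, Fintype.card_fun, Fintype.card_fin,
    Nat.cast_pow] at hvar
  refine le_trans ?_ hvar
  calc _ = ∑ C ∈ univ.filter fun C : Fin m → KClause n K => F C < R, R ^ 2 := by
        rw [sum_const, nsmul_eq_mul, mul_comm]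
    _ ≤ ∑ C ∈ univ.filter fun C : Fin m → KClause n K => F C < R, (F C - 𝔼 C, F C) ^ 2 := by
        refine sum_le_sum fun C hC => ?_
        have h1 : F C < R := (mem_filter.1 hC).2
        have h2 : (0 : ℝ) ≤ F C := Nat.cast_nonneg _
        have h3 : 2 * R ≤ 𝔼 C, F C := hR
        rw [← neg_sq (F C - _)]
        exact pow_le_pow_left₀ (by linarith) (by linarith) 2
    _ ≤ _ := sum_le_sum_of_subset_of_nonneg (filter_subset _ _) fun _ _ _ => sq_nonneg _

end Concentration

section ManyCopies

open Finset
open scoped BigOperators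

variable {s e K : ℕ} {T : Fin e → Fin s → Option Bool}

theorem nonempty_kClause {n K : ℕ} (h : K ≤ n) : Nonempty (KClause n K) := by
  obtain ⟨t, -, ht⟩ :=
    exists_subset_card_eq (s := (univ : Finset (Fin n))) (n := K) (by simpa using h)
  refine ⟨⟨fun i => if i ∈ t then some true else none, ?_⟩⟩
  rw [← ht]
  congr 1
  ext i
  by_cases hi : i ∈ t <;> simp [hi]

theorem half_div_le {a b : ℕ} (hb : 0 < b) (hab : b ≤ a) : (a : ℝ) / (2 * b) ≤ (a / b : ℕ) := by
  have h1 : a ≤ 2 * b * (a / b) := by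
    have h2 := Nat.div_add_mod a b
    have h3 := Nat.mod_lt a hb
    have h4 : b * 1 ≤ b * (a / b) := Nat.mul_le_mul_left _ (Nat.div_pos hab hb)
    have h5 : 2 * b * (a / b) = b * (a / b) + b * (a / b) := by ring
    omega
  rw [div_le_iff₀ (by positivity)]
  calc (a : ℝ) ≤ (2 * b * (a / b) : ℕ) := Nat.cast_le.2 h1
    _ = _ := by push_cast; ring

theorem half_le_floor {x : ℝ} (hx : 1 ≤ x) : x / 2 ≤ ⌊x⌋₊ := by
  have h1 := Nat.lt_floor_add_one x
  have h2 : (1 : ℝ) ≤ ⌊x⌋₊ := by exact_mod_cast Nat.le_floor (by simpa using hx)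
  linarith

/-- The expected number of isolated copies of a hypertree is at least linear. -/
theorem exists_le_expect_copies (hK : 0 < K) (hT : IsHypertree K T) (he : 0 < e) {d : ℝ}
    (hd : 0 < d) : ∃ c > 0, ∃ n₀ : ℕ, ∀ n ≥ n₀, ∃ (q q' : ℕ) (hn : s * q ≤ n)
      (hm : e * q' ≤ ⌊d * n⌋₊), ∀ π, c * n ≤
        𝔼 C : Fin ⌊d * n⌋₊ → KClause n K, ((copySet T hn hm π fun j => (C j).lit).card : ℝ) := by
  have hs : 0 < s := by have := hT.card; omega
  -- this makes the number `n ^ (s + e)` of possible places, times the probability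
  -- `n ^ (-(K * e))` of a copy at a given place, linear in `n`
  have hse : s + e = K * e + 1 := by
    obtain ⟨k, rfl⟩ : ∃ k, K = k + 1 := ⟨K - 1, by omega⟩
    rw [hT.card, Nat.add_sub_cancel]; ring
  refine ⟨(1 / (2 * s)) ^ s * (d / (4 * e)) ^ e * Real.exp (-(2 * (s * K) * d)) / 2 ^ (K * e),
    by positivity, ⌈2 * (s * K : ℝ)⌉₊ + ⌈2 * e / d⌉₊ + s + K + 1, fun n hn => ?_⟩
  have hn0 : (0 : ℝ) < n := by exact_mod_cast (by omega : 0 < n)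
  have hnK : 2 * (s * K : ℝ) ≤ n := (Nat.le_ceil _).trans (Nat.cast_le.2 (by omega))
  have hne : 2 * e / d ≤ (n : ℝ) := (Nat.le_ceil _).trans (Nat.cast_le.2 (by omega))
  rw [div_le_iff₀ hd, mul_comm (n : ℝ)] at hne
  have he1 : (1 : ℝ) ≤ e := by exact_mod_cast he
  have hfl : d * n / 2 ≤ ⌊d * n⌋₊ := half_le_floor (by linarith)
  have hem : e ≤ ⌊d * n⌋₊ := Nat.le_floor (by linarith)
  have hMd : (⌊d * n⌋₊ : ℝ) ≤ d * n := Nat.floor_le (by positivity)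
  have : Nonempty (KClause n K) := nonempty_kClause (by omega)
  refine ⟨n / s, ⌊d * n⌋₊ / e, Nat.mul_div_le _ _, Nat.mul_div_le _ _, fun π => ?_⟩
  refine le_trans ?_ (le_expect_card_copySet hT.uniform _ _ hem (by linarith [hn0]) π)
  have hq : (n : ℝ) * (1 / (2 * s)) ≤ (n / s : ℕ) := by
    rw [mul_one_div]; exact half_div_le hs (by omega)
  have hq' : (n : ℝ) * (d / (4 * e)) ≤ (⌊d * n⌋₊ / e : ℕ) := by
    refine le_trans ?_ (half_div_le he hem)
    rw [le_div_iff₀ (by positivity)]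
    calc (n : ℝ) * (d / (4 * e)) * (2 * e) = d * n / 2 := by field_simp; norm_num
      _ ≤ _ := hfl
  have hx1 : (s * K / n : ℝ) ≤ 1 / 2 := by rw [div_le_iff₀ hn0]; linarith
  have hx0 : (0 : ℝ) ≤ s * K / n := by positivity
  have hexp : Real.exp (-(2 * (s * K) * d)) ≤ (1 - s * K / n) ^ ⌊d * n⌋₊ := by
    calc Real.exp (-(2 * (s * K) * d)) ≤ Real.exp (⌊d * n⌋₊ * (-(2 * (s * K / n)))) := by
          refine Real.exp_le_exp.2 ?_
          have h1 : (s * K / n : ℝ) * ⌊d * n⌋₊ ≤ s * K / n * (d * n) :=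
            mul_le_mul_of_nonneg_left hMd hx0
          have h2 : (s * K / n : ℝ) * (d * n) = s * K * d := by field_simp
          linarith
      _ = Real.exp (-(2 * (s * K / n))) ^ ⌊d * n⌋₊ := Real.exp_nat_mul _ _
      _ ≤ _ := pow_le_pow_left₀ (Real.exp_pos _).le (exp_neg_two_mul_le hx0 hx1) _
  have hNc : (Fintype.card (KClause n K) : ℝ) ^ e ≤ ((2 * n : ℝ) ^ K) ^ e :=
    pow_le_pow_left₀ (Nat.cast_nonneg _) (by exact_mod_cast card_kClause_le n K) _
  have hNc0 : (0 : ℝ) < Fintype.card (KClause n K) := Nat.cast_pos.2 Fintype.card_pos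
  calc _ = ((n : ℝ) * (1 / (2 * s))) ^ s * ((n : ℝ) * (d / (4 * e))) ^ e *
        Real.exp (-(2 * (s * K) * d)) / ((2 * n : ℝ) ^ K) ^ e := by
        have h1 : (n : ℝ) ^ s * (n : ℝ) ^ e = (n : ℝ) ^ (K * e) * n := by
          rw [← pow_add, hse, pow_succ]
        rw [← pow_mul, mul_pow (n : ℝ), mul_pow (n : ℝ), mul_pow (2 : ℝ),
          div_mul_eq_mul_div, div_eq_div_iff (by positivity) (by positivity)]
        linear_combination (-(1 / (2 * s : ℝ)) ^ s * (d / (4 * e)) ^ e *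
          Real.exp (-(2 * (s * K) * d)) * 2 ^ (K * e)) * h1
    _ ≤ _ := by
        gcongr
        exact mul_nonneg (by positivity) (pow_nonneg (by linarith) _)

/-- With high probability, the random clauses contain many isolated copies of a given
hypertree. -/
theorem exists_card_few_copies_le (hK : 0 < K) (hT : IsHypertree K T) (he : 0 < e) {d : ℝ}
    (hd : 0 < d) (R : ℕ) {ε : ℝ} (hε : 0 < ε) : ∃ n₀ : ℕ, ∀ n ≥ n₀, ∃ (q q' : ℕ) (hn : s * q ≤ n)
      (hm : e * q' ≤ ⌊d * n⌋₊), ∀ π : Equiv.Perm (Fin n),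
        ((univ.filter fun C : Fin ⌊d * n⌋₊ → KClause n K =>
          (copySet T hn hm π fun j => (C j).lit).card < R).card : ℝ) ≤
        ε * (Fintype.card (KClause n K) : ℝ) ^ ⌊d * n⌋₊ := by
  classical
  obtain ⟨c, hc, n₁, h1⟩ := exists_le_expect_copies hK hT he hd
  refine ⟨n₁ + ⌈2 * R / c⌉₊ + ⌈16 * d * K ^ 2 / (c ^ 2 * ε)⌉₊ + K + 1, fun n hn => ?_⟩
  obtain ⟨q, q', hnq, hm, h2⟩ := h1 n (by omega)
  refine ⟨q, q', hnq, hm, fun π => ?_⟩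
  have hn0 : (0 : ℝ) < n := by exact_mod_cast (by omega : 0 < n)
  have hnR : 2 * R / c ≤ (n : ℝ) := (Nat.le_ceil _).trans (Nat.cast_le.2 (by omega))
  have hnε : 16 * d * K ^ 2 / (c ^ 2 * ε) ≤ (n : ℝ) :=
    (Nat.le_ceil _).trans (Nat.cast_le.2 (by omega))
  rw [div_le_iff₀ hc] at hnR
  rw [div_le_iff₀ (by positivity)] at hnε
  have hMd : (⌊d * n⌋₊ : ℝ) ≤ d * n := Nat.floor_le (by positivity)
  have : Nonempty (KClause n K) := nonempty_kClause (by omega)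
  have h3 := card_copySet_lt_le (R := c * n / 2) hK hT hnq hm π (by linarith [h2 π])
  set Nc : ℝ := (Fintype.card (KClause n K) : ℝ) ^ ⌊d * n⌋₊ with hNc
  have hNc0 : 0 < Nc := pow_pos (Nat.cast_pos.2 Fintype.card_pos) _
  have h4 : ((univ.filter fun C : Fin ⌊d * n⌋₊ → KClause n K =>
      (copySet T hnq hm π fun j => (C j).lit).card < R).card : ℝ) ≤
      ((univ.filter fun C : Fin ⌊d * n⌋₊ → KClause n K =>
        ((copySet T hnq hm π fun j => (C j).lit).card : ℝ) < c * n / 2).card : ℝ) := by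
    refine Nat.cast_le.2 (card_le_card fun C hC => ?_)
    have h5 : (((copySet T hnq hm π fun j => (C j).lit).card : ℕ) : ℝ) < R :=
      Nat.cast_lt.2 (mem_filter.1 hC).2
    exact mem_filter.2 ⟨mem_univ _, by linarith⟩
  refine h4.trans (le_of_mul_le_mul_left (h3.trans ?_) (show 0 < (c * n / 2) ^ 2 by positivity))
  calc (⌊d * n⌋₊ : ℝ) * (2 * K) ^ 2 * Nc ≤ (d * n) * (2 * K) ^ 2 * Nc := by gcongr
    _ = (16 * d * K ^ 2) * (n / 4) * Nc := by ring
    _ ≤ (n * (c ^ 2 * ε)) * (n / 4) * Nc := by gcongr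
    _ = _ := by ring

end ManyCopies

/-! ### The sequential algorithm as a run -/

section Bridge

variable {n m K ρ : ℕ}

/-- Two instances with the same variables, clauses and literals, and with the same signs on their
clauses. -/
structure Agree (Φ Ψ : Formula n m) : Prop where
  vars : Φ.vars = Ψ.vars
  clauses : Φ.clauses = Ψ.clauses
  lit : Φ.lit = Ψ.lit
  sign : ∀ j ∈ Φ.clauses, Φ.sign j = Ψ.sign j

variable {Φ Ψ Θ : Formula n m}

theorem Agree.trans (h : Agree Φ Ψ) (h' : Agree Ψ Θ) : Agree Φ Θ where
  vars := h.vars.trans h'.vars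
  clauses := h.clauses.trans h'.clauses
  lit := h.lit.trans h'.lit
  sign j hj := (h.sign j hj).trans (h'.sign j (h.clauses ▸ hj))

theorem Agree.scope (h : Agree Φ Ψ) (j : Fin m) : Φ.scope j = Ψ.scope j := by
  unfold Formula.scope
  rw [h.vars, h.lit]

theorem Agree.isReduced (h : Agree Φ Ψ) (hΨ : Ψ.IsReduced K) : Φ.IsReduced K := by
  intro j hj
  rw [h.scope, h.sign j hj]
  exact hΨ j (h.clauses ▸ hj)

theorem Agree.prob_eq (τ : LocalRule K (2 * (ρ + 1))) (h : Agree Φ Ψ) (hΨ : Ψ.IsReduced K)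
    {x : Fin n} (hx : x ∈ Ψ.vars) : τ.prob Φ x = τ.prob Ψ x := by
  have hx' : x ∈ Φ.vars := h.vars ▸ hx
  refine τ.prob_eq_of_iso (h.isReduced hΨ) hΨ hx' hx ?_
  refine Formula.ball_iso id id hx' hx ?_ ?_ (fun _ _ _ _ he => he) fun _ _ _ _ _ _ he => he
  · intro u _ j hj _
    refine ⟨h.clauses ▸ hj, (h.sign j hj).symm, fun v hv => ⟨h.scope j ▸ hv, ?_⟩, fun v' hv' =>
      ⟨v', by rw [h.scope]; exact hv', rfl⟩⟩
    rw [h.lit]; rfl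
  · intro u _ j' hj' hu
    exact ⟨j', by rwa [h.clauses], by rwa [h.scope], rfl⟩

theorem Agree.assign (h : Agree Φ Ψ) (x : Fin n) (v : Bool) :
    Agree (Φ.assign x v) (Ψ.assign x v) := by
  have hns : ∀ j, Φ.newSign x v j = Ψ.newSign x v j := fun j => by
    unfold Formula.newSign
    rw [h.lit]
  refine ⟨?_, ?_, h.lit, fun j hj => ?_⟩
  · simp only [Formula.assign, h.vars]
  · ext j
    simp only [Formula.assign, Finset.mem_filter, h.scope, hns, ← h.clauses]
    refine and_congr_right fun hj => ?_
    rw [h.sign j hj]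
  · have hj' : j ∈ Φ.clauses := (Finset.mem_filter.1 hj).1
    simp only [Formula.assign, h.scope, hns, h.sign j hj']

/-- Fixing one more variable in the closed form of the reduced instance. -/
theorem agree_assign_residual {C : Fin m → Fin n → Option Bool} {P : Finset (Fin n)}
    {σ : Fin n → Bool} {x : Fin n} (hx : x ∉ P) (v : Bool) :
    Agree ((residual C P σ).assign x v) (residual C (insert x P) (Function.update σ x v)) := by
  have hval : ∀ j (f : Bool → Bool),
      (∃ i ∈ insert x P, C j i = some (f (Function.update σ x v i))) ↔
        C j x = some (f v) ∨ ∃ i ∈ P, C j i = some (f (σ i)) := by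
    intro j f
    rw [Finset.exists_mem_insert, Function.update_self]
    refine or_congr Iff.rfl (exists_congr fun i => and_congr_right fun hi => ?_)
    rw [Function.update_of_ne (ne_of_mem_of_not_mem hi hx)]
  have hA := fun j => hval j id
  have hB := fun j => hval j not
  simp only [id] at hA
  have hscope : ∀ j, x ∈ (residual C P σ).scope j ↔ C j x ≠ none := fun j => by
    rw [mem_residual_scope]; exact and_iff_right hx
  -- a clause containing `x` keeps an unset variable iff `x` is not its only variable
  have hone : ∀ j, C j x ≠ none → ((∃ i ∉ insert x P, C j i ≠ none) ↔
      (residual C P σ).scope j ≠ {x}) := by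
    intro j hj
    constructor
    · rintro ⟨i, hi, hji⟩ he
      have h1 : i ∈ (residual C P σ).scope j :=
        mem_residual_scope.2 ⟨fun h => hi (Finset.mem_insert_of_mem h), hji⟩
      rw [he, Finset.mem_singleton] at h1
      exact hi (h1 ▸ Finset.mem_insert_self _ _)
    · intro hne
      by_contra hcon
      push Not at hcon
      refine hne (Finset.eq_singleton_iff_unique_mem.2 ⟨(hscope j).2 hj, fun i hi => ?_⟩)
      obtain ⟨h1, h2⟩ := mem_residual_scope.1 hi
      by_contra hix
      exact h2 (hcon i (by simp [hix, h1]))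
  have hcl : ∀ j, j ∈ ((residual C P σ).assign x v).clauses ↔
      j ∈ (residual C (insert x P) (Function.update σ x v)).clauses := by
    intro j
    have h0 : j ∈ ((residual C P σ).assign x v).clauses ↔ j ∈ (residual C P σ).clauses ∧
        (C j x ≠ none → ((residual C P σ).sign j = 0 ∨
          (residual C P σ).sign j = (residual C P σ).newSign x v j) ∧
            (residual C P σ).scope j ≠ {x}) := by
      rw [← hscope]
      simp [Formula.assign]
    rw [h0, mem_residual_clauses, mem_residual_clauses, hA, hB]
    rcases eq_or_ne (C j x) none with hj | hj
    · have h1 : (∃ i ∉ insert x P, C j i ≠ none) ↔ ∃ i ∉ P, C j i ≠ none := by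
        constructor
        · rintro ⟨i, hi, h⟩
          exact ⟨i, fun hP => hi (Finset.mem_insert_of_mem hP), h⟩
        · rintro ⟨i, hi, h⟩
          refine ⟨i, fun hP => ?_, h⟩
          rcases Finset.mem_insert.1 hP with rfl | hP
          · exact h hj
          · exact hi hP
      rw [h1, hj]
      simp
    · rw [hone j hj]
      have h1 : ∃ i ∉ P, C j i ≠ none := ⟨x, hx, hj⟩
      have hns : (residual C P σ).newSign x v j = if C j x = some v then 1 else -1 := rfl
      rw [hns]
      simp only [residual]
      rcases eq_some_or_eq_some_not hj v with h2 | h2 <;>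
        by_cases hPA : ∃ i ∈ P, C j i = some (σ i) <;>
        by_cases hPB : ∃ i ∈ P, C j i = some (!σ i) <;>
        simp [h2, hPA, hPB, h1]
  refine ⟨?_, Finset.ext hcl, rfl, fun j hj => ?_⟩
  · ext i
    simp [Formula.assign, residual]
  · have hj' := mem_residual_clauses.1 ((hcl j).1 hj)
    rw [hA, hB] at hj'
    have h1 : ((residual C P σ).assign x v).sign j = if C j x ≠ none then
        (if C j x = some v then 1 else -1) else (residual C P σ).sign j := by
      simp only [← hscope]; rfl
    rw [h1]
    simp only [residual, hA, hB]
    rcases eq_or_ne (C j x) none with hn | hn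
    · simp [hn]
    · rcases eq_some_or_eq_some_not hn v with h2 | h2
      · simp [h2]
      · have h3 : ¬∃ i ∈ P, C j i = some (σ i) := fun h => hj'.2 ⟨Or.inr h, Or.inl h2⟩
        simp [h2, h3]

/-- The state of the algorithm after the variables in the list `l` have been processed. -/
theorem foldl_step (τ : LocalRule K (2 * (ρ + 1))) (hK : 0 < K) (C : Fin m → KClause n K)
    (u : Fin n → unitInterval) (σ₀ : Fin n → Bool) (l : List (Fin n)) (hl : l.Nodup) :
    Agree (l.foldl (τ.step u) (toFormula C, σ₀)).1
      (residual (fun j => (C j).lit) l.toFinset (l.foldl (τ.step u) (toFormula C, σ₀)).2) ∧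
    ∀ l₁ x l₂, l = l₁ ++ x :: l₂ → (l.foldl (τ.step u) (toFormula C, σ₀)).2 x =
      decide ((u x : ℝ) < τ.prob (residual (fun j => (C j).lit) l₁.toFinset
        (l.foldl (τ.step u) (toFormula C, σ₀)).2) x) := by
  have hC : IsUniform K fun j => (C j).lit := fun j => (C j).card_lit
  induction l using List.reverseRecOn with
  | nil =>
    refine ⟨⟨?_, ?_, rfl, fun j _ => ?_⟩, fun l₁ x l₂ h => by simp at h⟩
    · simp [toFormula, residual]
    · ext j
      have := exists_mem_scope hK hC j
      simpa [toFormula, residual] using this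
    · simp [toFormula, residual]
  | append_singleton l y ih =>
    have hyl : y ∉ l := by
      have := List.nodup_append.1 hl
      exact fun h => this.2.2 y h y (by simp) rfl
    obtain ⟨ih1, ih2⟩ := ih (List.nodup_append.1 hl).1
    rw [List.foldl_append, List.foldl_cons, List.foldl_nil]
    set S := l.foldl (τ.step u) (toFormula C, σ₀) with hS
    set v : Bool := decide ((u y : ℝ) < τ.prob S.1 y) with hv
    have hstep : τ.step u S y = (S.1.assign y v, Function.update S.2 y v) := rfl
    rw [hstep]
    have hyl' : y ∉ l.toFinset := by simpa using hyl
    have hcong : ∀ l₁ : List (Fin n), y ∉ l₁ → residual (fun j => (C j).lit) l₁.toFinset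
        (Function.update S.2 y v) = residual (fun j => (C j).lit) l₁.toFinset S.2 := by
      intro l₁ hy
      refine residual_congr fun w hw => Function.update_of_ne ?_ _ _
      rintro rfl
      exact hy (List.mem_toFinset.1 hw)
    refine ⟨?_, fun l₁ x l₂ h => ?_⟩
    · have h1 := (ih1.assign y v).trans (agree_assign_residual hyl' v)
      have h2 : (l ++ [y]).toFinset = insert y l.toFinset := by
        ext; simp
      rw [h2]
      exact h1
    · rcases List.eq_nil_or_concat l₂ with rfl | ⟨l₂, z, rfl⟩
      · obtain ⟨rfl, h2⟩ := List.append_inj' h rfl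
        obtain rfl : y = x := by simpa using h2
        dsimp only
        rw [hcong _ hyl, Function.update_self, hv, ih1.prob_eq τ (isReduced_residual hC)
          (Finset.mem_compl.2 hyl')]
      · rw [List.concat_eq_append, ← List.cons_append, ← List.append_assoc] at h
        obtain ⟨rfl, h2⟩ := List.append_inj' h rfl
        have hy1 : y ∉ l₁ := fun h => hyl (by simp [h])
        have hxy : x ≠ y := fun h => hyl (by simp [h])
        dsimp only
        rw [hcong _ hy1, Function.update_of_ne hxy]
        exact ih2 l₁ x l₂ rfl

/-- The output of the algorithm is a run in which the order is given by the labels, and the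
decisions are made by comparing the seeds with the probabilities given by `τ`. -/
theorem isRun_output (τ : LocalRule K (2 * (ρ + 1))) (hK : 0 < K) (C : Fin m → KClause n K)
    (z u : Fin n → unitInterval) :
    IsRun τ (fun j => (C j).lit)
      (fun x => ((Tuple.sort fun i => OrderDual.toDual (z i)).symm x : Fin n))
      (fun x p => decide ((u x : ℝ) < p)) (τ.output (toFormula C) z u) := by
  set π := Tuple.sort fun i => OrderDual.toDual (z i) with hπ
  have hnd : (List.ofFn π).Nodup := List.nodup_ofFn.2 π.injective
  intro x
  obtain ⟨-, h⟩ := foldl_step τ hK C u (fun _ => false) (List.ofFn π) hnd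
  have hlen : (π.symm x : ℕ) < (List.ofFn π).length := by simp
  have hsplit : List.ofFn π = (List.ofFn π).take (π.symm x) ++
      x :: (List.ofFn π).drop (π.symm x + 1) := by
    conv_lhs => rw [← List.take_append_drop (π.symm x) (List.ofFn π),
      List.drop_eq_getElem_cons hlen]
    simp
  have h1 := h _ x _ hsplit
  have h2 : ((List.ofFn π).take (π.symm x)).toFinset =
      before (fun x => ((π.symm x : Fin n) : ℕ)) x := by
    ext y
    rw [List.mem_toFinset, mem_before, List.mem_take_iff_getElem]
    constructor
    · rintro ⟨i, hi, rfl⟩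
      simp at hi ⊢
      omega
    · intro hy
      exact ⟨π.symm y, by simpa using hy, by simp⟩
  rw [h2] at h1
  exact h1

end Bridge

/-! ### A rule that fails on a hypertree fails with high probability -/

section Failure

open Finset

variable {n m s e K ρ q q' : ℕ} {T : Fin e → Fin s → Option Bool}

theorem iIndepFun_eval : iIndepFun (fun (x : Fin n) (u : Fin n → unitInterval) => u x)
    (volume : Measure (Fin n → unitInterval)) :=
  iIndepFun_pi (X := fun _ x => x) fun _ => aemeasurable_id

theorem measurableSet_forall_mem {ι : Type*} (h : Fin s → ι) {G : Fin s → Set unitInterval}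
    (hG : ∀ i, MeasurableSet (G i)) :
    MeasurableSet {v : ι → unitInterval | ∀ i, v (h i) ∈ G i} := by
  have h1 : {v : ι → unitInterval | ∀ i, v (h i) ∈ G i} = ⋂ i, (fun v => v (h i)) ⁻¹' G i := by
    ext; simp
  rw [h1]
  exact MeasurableSet.iInter fun i => measurable_pi_apply (h i) (hG i)

theorem volume_forall_mem {f : Fin s → Fin n} (hf : Function.Injective f)
    {G : Fin s → Set unitInterval} (hG : ∀ i, MeasurableSet (G i)) :
    (volume : Measure (Fin n → unitInterval)) {u | ∀ i, u (f i) ∈ G i} = ∏ i, volume (G i) := by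
  have h1 := (iIndepFun_eval.precomp hf).measure_inter_preimage_eq_mul univ (sets := G)
    fun i _ => hG i
  have h2 : {u : Fin n → unitInterval | ∀ i, u (f i) ∈ G i} =
      ⋂ i ∈ (univ : Finset (Fin s)), (fun u : Fin n → unitInterval => u (f i)) ⁻¹' G i := by
    ext u; simp
  rw [h2, h1]
  refine prod_congr rfl fun i _ => ?_
  exact (measurePreserving_eval (fun _ => volume) (f i)).measure_preimage (hG i).nullMeasurableSet

/-- Disjoint groups of seeds are independent. -/
theorem volume_forall_not {J : Type*} (S : Finset J) (f : J → Fin s → Fin n)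
    (hinj : ∀ p ∈ S, Function.Injective (f p))
    (hdis : ∀ p ∈ S, ∀ p' ∈ S, ∀ u u', f p u = f p' u' → p = p')
    {G : Fin s → Set unitInterval} (hG : ∀ i, MeasurableSet (G i)) :
    (volume : Measure (Fin n → unitInterval)) {u | ∀ p ∈ S, ¬∀ i, u (f p i) ∈ G i} =
      (1 - ∏ i, volume (G i)) ^ S.card := by
  classical
  induction S using Finset.induction_on with
  | empty => simp
  | insert a S ha ih =>
    have hA : MeasurableSet {v : (univ.image (f a) : Finset (Fin n)) → unitInterval |
        ¬∀ i, v ⟨f a i, mem_image_of_mem _ (mem_univ _)⟩ ∈ G i} :=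
      (measurableSet_forall_mem (ι := (univ.image (f a) : Finset (Fin n)))
        (fun i => ⟨f a i, mem_image_of_mem _ (mem_univ _)⟩) hG).compl
    have hmem : ∀ p (_ : p ∈ S) i, f p i ∈ S.biUnion fun p => univ.image (f p) := fun p hp i =>
      mem_biUnion.2 ⟨p, hp, mem_image_of_mem _ (mem_univ _)⟩
    have hB : MeasurableSet {v : (S.biUnion fun p => univ.image (f p) : Finset (Fin n)) →
        unitInterval | ∀ p (hp : p ∈ S), ¬∀ i, v ⟨f p i, hmem p hp i⟩ ∈ G i} := by
      have h1 : {v : (S.biUnion fun p => univ.image (f p) : Finset (Fin n)) →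
          unitInterval | ∀ p (hp : p ∈ S), ¬∀ i, v ⟨f p i, hmem p hp i⟩ ∈ G i} =
          ⋂ p : S, {v | ¬∀ i, v ⟨f p.1 i, hmem p.1 p.2 i⟩ ∈ G i} := by
        ext v; simp
      rw [h1]
      exact MeasurableSet.iInter fun p =>
        (measurableSet_forall_mem
          (ι := (S.biUnion fun p => univ.image (f p) : Finset (Fin n)))
          (fun i => ⟨f p.1 i, hmem p.1 p.2 i⟩) hG).compl
    have hdisj : Disjoint (univ.image (f a)) (S.biUnion fun p => univ.image (f p)) := by
      rw [disjoint_left]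
      intro x hx hx'
      obtain ⟨i, -, rfl⟩ := mem_image.1 hx
      obtain ⟨p, hp, hx'⟩ := mem_biUnion.1 hx'
      obtain ⟨i', -, hi'⟩ := mem_image.1 hx'
      have := hdis p (mem_insert_of_mem hp) a (mem_insert_self _ _) _ _ hi'
      exact ha (this ▸ hp)
    have hind := (iIndepFun_eval (n := n)).indepFun_finset _ _ hdisj fun i =>
      measurable_pi_apply i
    have hprod := hind.measure_inter_preimage_eq_mul _ _ hA hB
    have e1 : {u : Fin n → unitInterval | ∀ p ∈ insert a S, ¬∀ i, u (f p i) ∈ G i} =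
        {u | ¬∀ i, u (f a i) ∈ G i} ∩ {u | ∀ p ∈ S, ¬∀ i, u (f p i) ∈ G i} := by
      ext u
      simp only [mem_insert, forall_eq_or_imp, Set.mem_ofPred_eq, Set.mem_inter_iff]
    have e2 : (volume : Measure (Fin n → unitInterval)) {u | ¬∀ i, u (f a i) ∈ G i} =
        1 - ∏ i, volume (G i) := by
      rw [← volume_forall_mem (hinj a (mem_insert_self _ _)) hG]
      exact prob_compl_eq_one_sub (measurableSet_forall_mem (f a) hG)
    rw [card_insert_of_notMem ha, pow_succ', e1, ← ih (fun p hp => hinj p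
      (mem_insert_of_mem hp)) fun p hp p' hp' => hdis p (mem_insert_of_mem hp) p'
      (mem_insert_of_mem hp'), ← e2]
    exact hprod

instance : MeasurableSingletonClass (KClause n K) := ⟨fun _ => trivial⟩

theorem formulaLaw_singleton [Nonempty (KClause n K)] (d : ℝ)
    (C : Fin ⌊d * n⌋₊ → KClause n K) :
    formulaLaw K d n {C} = ((Fintype.card (KClause n K) : ENNReal) ^ ⌊d * n⌋₊)⁻¹ := by
  rw [formulaLaw, Measure.pi_singleton]
  simp [uniformOn_univ, ENNReal.inv_pow]

theorem formulaLaw_eq [Nonempty (KClause n K)] (d : ℝ)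
    (p : (Fin ⌊d * n⌋₊ → KClause n K) → Prop) [DecidablePred p] :
    formulaLaw K d n {C | p C} = ((univ.filter p).card : ENNReal) *
      ((Fintype.card (KClause n K) : ENNReal) ^ ⌊d * n⌋₊)⁻¹ := by
  have h1 : {C | p C} = (univ.filter p : Finset (Fin ⌊d * n⌋₊ → KClause n K)) := by ext; simp
  have : SigmaFinite (formulaLaw K d n) := by unfold formulaLaw; infer_instance
  rw [h1, ← sum_measure_singleton]
  simp only [formulaLaw_singleton, sum_const, nsmul_eq_mul]

theorem measurableSet_sort (π : Equiv.Perm (Fin n)) :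
    MeasurableSet
      {z : Fin n → unitInterval | (Tuple.sort fun i => OrderDual.toDual (z i)) = π} := by
  have h1 : {z : Fin n → unitInterval | (Tuple.sort fun i => OrderDual.toDual (z i)) = π} =
      {z | (∀ i j, i ≤ j → z (π j) ≤ z (π i)) ∧ ∀ i j, i < j → z (π i) = z (π j) → π i < π j} := by
    ext z
    simp only [Set.mem_ofPred_eq]
    rw [eq_comm, Tuple.eq_sort_iff]
    refine and_congr ⟨fun h i j hij => h hij, fun h i j hij => h i j hij⟩ ?_
    simp only [EmbeddingLike.apply_eq_iff_eq]
  rw [h1]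
  simp only [Set.ofPred_and, Set.ofPred_forall]
  refine MeasurableSet.inter ?_ ?_
  · exact MeasurableSet.iInter fun i => MeasurableSet.iInter fun j => MeasurableSet.iInter fun _ =>
      measurableSet_le (measurable_pi_apply _) (measurable_pi_apply _)
  · refine MeasurableSet.iInter fun i => MeasurableSet.iInter fun j => MeasurableSet.iInter fun _ =>
      ?_
    by_cases h : π i < π j
    · simp [h]
    · simp only [h, imp_false]
      exact (measurableSet_eq_fun (f := fun z : Fin n → unitInterval => z (π i))
        (g := fun z => z (π j)) (measurable_pi_apply _) (measurable_pi_apply _)).compl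

/-- If the algorithm succeeds, then on no isolated copy do the seeds lead to the decisions that
violate a clause of the hypertree. -/
theorem forall_copySet_not_of_mem_SAT (τ : LocalRule K (2 * (ρ + 1))) (hK : 0 < K)
    (hT : IsHypertree K T) {σT : Fin s → Bool} (hσT : ¬Satisfies T σT) {hn : s * q ≤ n}
    {hm : e * q' ≤ m} {C : Fin m → KClause n K} {z u : Fin n → unitInterval}
    (hsat : τ.output (toFormula C) z u ∈ (toFormula C).SAT)
    (p : (Fin s → Fin q) × (Fin e → Fin q'))
    (hp : p ∈ copySet T hn hm (Tuple.sort fun i => OrderDual.toDual (z i)) fun j => (C j).lit) :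
    ¬∀ i, u ((Tuple.sort fun i => OrderDual.toDual (z i)) (blockMap hn p.1 i)) ∈
      {t : unitInterval | decide ((t : ℝ) <
        τ.prob (residual T (before (fun i => i) i) σT) i) = σT i} := by
  intro hu
  have hcopy := mem_copySet.1 hp
  refine hσT (hcopy.satisfies (σ := τ.output (toFormula C) z u) ?_ (mem_SAT_toFormula.1 hsat))
  refine hcopy.run_eq hT.uniform (fun j => (C j).card_lit) ?_ (isRun_output τ hK C z u) hu
  intro i i'
  simp only [Equiv.symm_apply_apply, Fin.val_fin_lt]
  exact blockMap_lt

/-- The probability of success is small if there are many isolated copies with high probability. -/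
theorem successProb_le [Nonempty (KClause n K)] (τ : LocalRule K (2 * (ρ + 1))) (hK : 0 < K)
    (hT : IsHypertree K T) {σT : Fin s → Bool} (hσT : ¬Satisfies T σT) {d : ℝ} {hn : s * q ≤ n}
    {hm : e * q' ≤ ⌊d * n⌋₊} {R : ℕ} {ε : ℝ}
    (hfew : ∀ π : Equiv.Perm (Fin n), ((univ.filter fun C : Fin ⌊d * n⌋₊ → KClause n K =>
        (copySet T hn hm π fun j => (C j).lit).card < R).card : ℝ) ≤
      ε * (Fintype.card (KClause n K) : ℝ) ^ ⌊d * n⌋₊) :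
    successProb τ d n ≤ ENNReal.ofReal ε + (1 - ∏ i, volume {t : unitInterval | decide ((t : ℝ) <
        τ.prob (residual T (before (fun i => i) i) σT) i) = σT i}) ^ R := by
  classical
  set G : Fin s → Set unitInterval := fun i => {t : unitInterval | decide ((t : ℝ) <
        τ.prob (residual T (before (fun i => i) i) σT) i) = σT i} with hGdef
  have hG : ∀ i, MeasurableSet (G i) := by
    intro i
    have h1 : MeasurableSet {t : unitInterval | (t : ℝ) <
        τ.prob (residual T (before (fun i => i) i) σT) i} :=
      measurableSet_lt measurable_subtype_coe measurable_const
    rcases hb : σT i with - | -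
    · simpa [hGdef, hb, Set.compl_ofPred] using h1.compl
    · simpa [hGdef, hb] using h1
  set x : ENNReal := 1 - ∏ i, volume (G i) with hx
  have hx1 : x ≤ 1 := tsub_le_self
  set a : ENNReal := ((Fintype.card (KClause n K) : ENNReal) ^ ⌊d * n⌋₊)⁻¹ with ha
  have hNc0 : (Fintype.card (KClause n K) : ENNReal) ^ ⌊d * n⌋₊ ≠ 0 :=
    pow_ne_zero _ (Nat.cast_ne_zero.2 Fintype.card_ne_zero)
  have hNct : (Fintype.card (KClause n K) : ENNReal) ^ ⌊d * n⌋₊ ≠ ⊤ :=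
    ENNReal.pow_ne_top (ENNReal.natCast_ne_top _)
  let Z : Equiv.Perm (Fin n) → Set (Fin n → unitInterval) := fun π =>
    {z | (Tuple.sort fun i => OrderDual.toDual (z i)) = π}
  let N : Equiv.Perm (Fin n) → (Fin ⌊d * n⌋₊ → KClause n K) → Set (Fin n → unitInterval) :=
    fun π C => {u | ∀ p ∈ copySet T hn hm π fun j => (C j).lit,
      ¬∀ i, u (π (blockMap hn p.1 i)) ∈ G i}
  have hN : ∀ π C, (volume : Measure (Fin n → unitInterval)) (N π C) =
      x ^ (copySet T hn hm π fun j => (C j).lit).card := fun π C =>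
    volume_forall_not _ (fun (p : (Fin s → Fin q) × (Fin e → Fin q')) i =>
      π (blockMap hn p.1 i)) (fun p hp => (mem_copySet.1 hp).var_inj)
      (fun p hp p' hp' u u' he => copySet_disjoint hK hT hp hp' he) hG
  -- the clauses and the order being given, success confines the seeds to `N π C`
  have hsub : {ω : (Fin ⌊d * n⌋₊ → KClause n K) × (Fin n → unitInterval) × (Fin n → unitInterval) |
      τ.output (toFormula ω.1) ω.2.1 ω.2.2 ∈ (toFormula ω.1).SAT} ⊆
      ⋃ π ∈ (univ : Finset (Equiv.Perm (Fin n))),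
        ⋃ C ∈ (univ : Finset (Fin ⌊d * n⌋₊ → KClause n K)), {C} ×ˢ (Z π ×ˢ N π C) := by
    rintro ⟨C, z, u⟩ hω
    refine Set.mem_iUnion₂.2 ⟨Tuple.sort fun i => OrderDual.toDual (z i), mem_univ _,
      Set.mem_iUnion₂.2 ⟨C, mem_univ _, rfl, rfl, fun p hp => ?_⟩⟩
    exact forall_copySet_not_of_mem_SAT τ hK hT hσT hω p hp
  -- the average over the clauses is bounded uniformly in the order
  have hC : ∀ π, ∑ C, a * (volume : Measure (Fin n → unitInterval)) (N π C) ≤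
      ENNReal.ofReal ε + x ^ R := by
    intro π
    have hε : (((univ.filter fun C : Fin ⌊d * n⌋₊ → KClause n K =>
        (copySet T hn hm π fun j => (C j).lit).card < R).card : ℕ) : ENNReal) * a ≤
        ENNReal.ofReal ε := by
      rw [ha, ← div_eq_mul_inv]
      refine ENNReal.div_le_of_le_mul ?_
      rw [← ENNReal.ofReal_natCast, ← ENNReal.ofReal_natCast (Fintype.card (KClause n K)),
        ← ENNReal.ofReal_pow (Nat.cast_nonneg _), ← ENNReal.ofReal_mul' (by positivity)]
      exact ENNReal.ofReal_le_ofReal (hfew π)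
    calc ∑ C, a * (volume : Measure (Fin n → unitInterval)) (N π C)
        ≤ ∑ C : Fin ⌊d * n⌋₊ → KClause n K,
          ((if (copySet T hn hm π fun j => (C j).lit).card < R then a else 0) + a * x ^ R) := by
          refine sum_le_sum fun C _ => ?_
          rw [hN]
          split_ifs with h
          · exact le_add_right (mul_le_of_le_one_right' (pow_le_one' hx1 _))
          · rw [zero_add]
            exact mul_le_mul_right (pow_le_pow_right_of_le_one' hx1 (not_lt.1 h)) a
      _ = ((univ.filter fun C : Fin ⌊d * n⌋₊ → KClause n K =>
          (copySet T hn hm π fun j => (C j).lit).card < R).card : ENNReal) * a + x ^ R := by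
          rw [sum_add_distrib, ← sum_filter, sum_const, sum_const, nsmul_eq_mul, nsmul_eq_mul,
            card_univ, Fintype.card_fun, Fintype.card_fin, Nat.cast_pow, ← mul_assoc, ha,
            ENNReal.mul_inv_cancel hNc0 hNct, one_mul]
      _ ≤ _ := add_le_add hε le_rfl
  have hZ : ∑ π, (volume : Measure (Fin n → unitInterval)) (Z π) = 1 := by
    have h1 : (⋃ π ∈ (univ : Finset (Equiv.Perm (Fin n))), Z π) = Set.univ := by
      ext z; simp [Z]
    rw [← measure_biUnion_finset _ fun π _ => measurableSet_sort π, h1, measure_univ]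
    intro π _ π' _ hne
    exact Set.disjoint_left.2 fun z hz hz' => hne (hz.symm.trans hz')
  have : SFinite (formulaLaw K d n) := by unfold formulaLaw; infer_instance
  calc successProb τ d n ≤ ∑ π, ∑ C, (formulaLaw K d n).prod ((volume : Measure
        (Fin n → unitInterval)).prod (volume : Measure (Fin n → unitInterval)))
          ({C} ×ˢ (Z π ×ˢ N π C)) :=
        (measure_mono hsub).trans ((measure_biUnion_finset_le _ _).trans
          (sum_le_sum fun π _ => measure_biUnion_finset_le _ _))
    _ = ∑ π, (volume : Measure (Fin n → unitInterval)) (Z π) *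
        ∑ C, a * (volume : Measure (Fin n → unitInterval)) (N π C) := by
        refine sum_congr rfl fun π _ => ?_
        rw [mul_sum]
        refine sum_congr rfl fun C _ => ?_
        rw [Measure.prod_prod, Measure.prod_prod, formulaLaw_singleton, ← ha]
        ring
    _ ≤ ∑ π, (volume : Measure (Fin n → unitInterval)) (Z π) * (ENNReal.ofReal ε + x ^ R) :=
        sum_le_sum fun π _ => mul_le_mul_right (hC π) _
    _ = _ := by rw [← sum_mul, hZ, one_mul]

theorem volume_seed_pos {p : ℝ} (hp : p ∈ Set.Icc (0 : ℝ) 1) {b v : Bool}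
    (h : v = seedDec b p) : 0 < volume {t : unitInterval | decide ((t : ℝ) < p) = v} := by
  unfold seedDec at h
  cases v
  · have h1 : p < 1 := by
      by_contra hne
      rw [if_pos (not_lt.1 hne)] at h
      cases h
    have h2 : {t : unitInterval | decide ((t : ℝ) < p) = false} = Set.Ici ⟨p, hp⟩ := by
      ext t; simp [← Subtype.coe_le_coe]
    rw [h2, unitInterval.volume_Ici]
    simpa using h1
  · have h1 : 0 < p := by
      by_contra hne
      rw [if_neg (by linarith), if_pos (not_lt.1 hne)] at h
      cases h
    have h2 : {t : unitInterval | decide ((t : ℝ) < p) = true} = Set.Iio ⟨p, hp⟩ := by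
      ext t; simp [← Subtype.coe_lt_coe]
    rw [h2, unitInterval.volume_Iio]
    simpa using h1

/-- A rule whose probability of success does not tend to `0` never fails on hypertrees. -/
theorem treePerfect_of_limsup_pos (τ : LocalRule K (2 * (ρ + 1))) (hK : 0 < K) {d : ℝ}
    (hd : 0 < d) (hα : 0 < limsup (fun n : ℕ => successProb τ d n) atTop) : TreePerfect τ := by
  intro s e T hT b σT hrun
  by_contra hσT
  have he : 0 < e := by
    by_contra h0
    obtain rfl : e = 0 := by omega
    exact hσT fun j => j.elim0
  set x : ENNReal := 1 - ∏ i, volume {t : unitInterval | decide ((t : ℝ) <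
    τ.prob (residual T (before (fun i => i) i) σT) i) = σT i} with hx
  have hx1 : x < 1 := by
    refine ENNReal.sub_lt_self ENNReal.one_ne_top one_ne_zero (prod_ne_zero_iff.2 fun i _ => ?_)
    exact (volume_seed_pos (τ.prob_mem_Icc _ _) (hrun i)).ne'
  obtain ⟨ε, hε0, hε⟩ := exists_between hα
  have hεt : ε ≠ ⊤ := hε.ne_top
  have hε2 : 0 < ε / 2 := ENNReal.half_pos hε0.ne'
  have hε2t : ε / 2 ≠ ⊤ := ENNReal.div_ne_top hεt two_ne_zero
  obtain ⟨R, hR⟩ := ((ENNReal.tendsto_pow_atTop_nhds_zero_of_lt_one hx1).eventually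
    (eventually_le_nhds hε2)).exists
  obtain ⟨n₀, h0⟩ := exists_card_few_copies_le hK hT he hd R
    (ENNReal.toReal_pos hε2.ne' hε2t)
  refine absurd hε (not_lt.2 (limsup_le_of_le (by isBoundedDefault) ?_))
  filter_upwards [eventually_ge_atTop n₀, eventually_ge_atTop K] with n hn hnK
  obtain ⟨q, q', hnq, hm, hfew⟩ := h0 n hn
  have : Nonempty (KClause n K) := nonempty_kClause hnK
  calc successProb τ d n ≤ ENNReal.ofReal (ε / 2).toReal + x ^ R :=
        successProb_le τ hK hT hσT hfew
    _ ≤ ε / 2 + ε / 2 := by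
        rw [ENNReal.ofReal_toReal hε2t]
        exact add_le_add le_rfl hR
    _ = ε := ENNReal.add_halves ε

end Failure

/-! ### Satisfying assignments at prescribed distances in random instances -/

section Main

open Finset

variable {K ρ : ℕ}

/-- A union bound: the clauses without short cycles, except for those with too many pairs of nearby
variables, have satisfying assignments at the prescribed distances. -/
theorem le_overlapProb {n k : ℕ} [Nonempty (KClause n K)] {d β η x : ℝ} {g t t' : ℕ}
    (hn : 0 < n) (hd : 0 < d) {C₁ C₂ : ℝ}
    (hacyc : x * (Fintype.card (KClause n K) : ℝ) ^ ⌊d * n⌋₊ ≤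
      acyclicCount n K g (Fin ⌊d * n⌋₊))
    (hC₁ : C₁ * x = 4 * ∑ h ∈ range (t + 1), (d * (K : ℝ) ^ 2) ^ h) (h₁ : 0 < C₁)
    (hC₂ : C₂ * x = 4 * ∑ h ∈ range (t' + 1), (d * (K : ℝ) ^ 2) ^ h) (h₂ : 0 < C₂)
    (hov : ∀ C : Fin ⌊d * n⌋₊ → KClause n K, NoShortCycle (fun j => (C j).lit) g →
      (pairCount (fun j => (C j).lit) t : ℝ) ≤ C₁ * n →
      (pairCount (fun j => (C j).lit) t' : ℝ) ≤ C₂ * n →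
      ((toFormula C).overlapSAT β η k).Nonempty) :
    ENNReal.ofReal (x / 2) ≤ overlapProb K d β η k n := by
  classical
  set Nc : ℝ := (Fintype.card (KClause n K) : ℝ) ^ ⌊d * n⌋₊ with hNc
  have hNc0 : 0 < Nc := pow_pos (Nat.cast_pos.2 Fintype.card_pos) _
  have hM : (⌊d * n⌋₊ : ℝ) ≤ d * n := Nat.floor_le (by positivity)
  have hbad : ∀ {B : ℝ} {t : ℕ}, 0 < B → B * x = 4 * ∑ h ∈ range (t + 1), (d * (K : ℝ) ^ 2) ^ h →
      ((univ.filter fun C : Fin ⌊d * n⌋₊ → KClause n K =>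
        B * n < pairCount (fun j => (C j).lit) t).card : ℝ) ≤ x / 4 * Nc := by
    intro B t hB hBx
    refine le_of_mul_le_mul_left ((card_lt_pairCount_le hn hM t).trans (le_of_eq ?_)) hB
    rw [← hNc]
    linear_combination (-Nc / 4) * hBx
  have hsub : (univ.filter fun C : Fin ⌊d * n⌋₊ → KClause n K =>
      NoShortCycle (fun j => (C j).lit) g) ⊆
      ((univ.filter fun C : Fin ⌊d * n⌋₊ → KClause n K =>
          ((toFormula C).overlapSAT β η k).Nonempty) ∪
        univ.filter fun C : Fin ⌊d * n⌋₊ → KClause n K =>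
          C₁ * n < pairCount (fun j => (C j).lit) t) ∪
      univ.filter fun C : Fin ⌊d * n⌋₊ → KClause n K =>
          C₂ * n < pairCount (fun j => (C j).lit) t' := by
    intro C hC
    have hC := (mem_filter.1 hC).2
    simp only [mem_union, mem_filter, mem_univ, true_and]
    by_contra hne
    push Not at hne
    exact (hov C hC hne.1.2 hne.2).ne_empty hne.1.1
  have hcard := (card_le_card hsub).trans ((card_union_le _ _).trans
    (Nat.add_le_add_right (card_union_le _ _) _))
  rw [card_filter_acyclic] at hcard
  have hcard' : (acyclicCount n K g (Fin ⌊d * n⌋₊) : ℝ) ≤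
      ((univ.filter fun C : Fin ⌊d * n⌋₊ → KClause n K =>
          ((toFormula C).overlapSAT β η k).Nonempty).card : ℝ) +
        ((univ.filter fun C : Fin ⌊d * n⌋₊ → KClause n K =>
          C₁ * n < pairCount (fun j => (C j).lit) t).card : ℝ) +
        ((univ.filter fun C : Fin ⌊d * n⌋₊ → KClause n K =>
          C₂ * n < pairCount (fun j => (C j).lit) t').card : ℝ) := by
    exact_mod_cast hcard
  have hgood : x / 2 * Nc ≤ ((univ.filter fun C : Fin ⌊d * n⌋₊ → KClause n K =>
      ((toFormula C).overlapSAT β η k).Nonempty).card : ℝ) := by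
    linarith [hbad h₁ hC₁, hbad h₂ hC₂]
  rw [overlapProb, formulaLaw_eq, ← div_eq_mul_inv,
    ENNReal.le_div_iff_mul_le (Or.inl (pow_ne_zero _ (Nat.cast_ne_zero.2 Fintype.card_ne_zero)))
      (Or.inl (ENNReal.pow_ne_top (ENNReal.natCast_ne_top _))),
    ← ENNReal.ofReal_natCast (Fintype.card (KClause n K)), ← ENNReal.ofReal_pow (Nat.cast_nonneg _),
    ← ENNReal.ofReal_mul' hNc0.le, ← ENNReal.ofReal_natCast]
  exact ENNReal.ofReal_le_ofReal hgood

/-- Without short cycles a rule that never fails on hypertrees produces satisfying assignments at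
all distances, and short cycles are absent with probability bounded away from `0`. -/
theorem TreePerfect.liminf_overlapProb_pos {τ : LocalRule K (2 * (ρ + 1))} (hτ : TreePerfect τ)
    (hbal : τ.IsBalanced) (hK : 0 < K) {d : ℝ} (hd : 0 < d) {β η : ℝ} (hη : 0 < η)
    (hηβ : η < β) (hβ : β ≤ 1 / 2) (k : ℕ) :
    0 < liminf (fun n : ℕ => overlapProb K d β η k n) atTop := by
  obtain ⟨c, hc, n₁, h₁⟩ := exists_le_acyclicCount K (2 * (ρ + 1)) d hd
  have hS : ∀ t : ℕ, 0 < ∑ h ∈ range (t + 1), (d * (K : ℝ) ^ 2) ^ h := fun t =>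
    sum_pos (fun h _ => by positivity) ⟨0, by simp⟩
  -- with these constants, each of the two bounds on pair counts fails with probability at most
  -- `c / 4`
  obtain ⟨L, hL⟩ := overlapSAT_nonempty hbal hτ hK hη hηβ hβ k
    (4 * (∑ h ∈ range (ρ + 1 + 1), (d * (K : ℝ) ^ 2) ^ h) / c)
  obtain ⟨n₂, h₂⟩ := hL (4 * (∑ h ∈ range (2 * L + 1), (d * (K : ℝ) ^ 2) ^ h) / c)
  have hlim : ENNReal.ofReal (c / 2) ≤ liminf (fun n : ℕ => overlapProb K d β η k n) atTop := by
    refine le_liminf_of_le (by isBoundedDefault) ?_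
    filter_upwards [eventually_ge_atTop n₁, eventually_ge_atTop n₂, eventually_ge_atTop K]
      with n hn₁ hn₂ hnK
    have : Nonempty (KClause n K) := nonempty_kClause hnK
    have hp := hS (ρ + 1)
    have hp' := hS (2 * L)
    exact le_overlapProb (hK.trans_le hnK) hd (h₁ n hn₁) (div_mul_cancel₀ _ hc.ne')
      (by positivity) (div_mul_cancel₀ _ hc.ne') (by positivity) fun C => h₂ n hn₂ _ C
  exact lt_of_lt_of_le (ENNReal.ofReal_pos.2 (by positivity)) hlim

end Main

end NAESAT

theorem mainTheorem3 (K r : ℕ) (hK : 0 < K) (hr : 0 < r) (hr_even : Even r) (d : ℝ) (hd : 0 < d)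
    (τ : NAESAT.LocalRule K r) (hτ : τ.IsBalanced)
    (hα : 0 < limsup (fun n : ℕ => NAESAT.successProb τ d n) atTop)
    (β η : ℝ) (hη : 0 < η) (hηβ : η < β) (hβ : Set.Icc (β - η) β ⊆ Set.Icc 0 (1 / 2))
    (k : ℕ) (hk : 0 < k) :
    0 < liminf (fun n : ℕ => NAESAT.overlapProb K d β η k n) atTop := by
  obtain ⟨ρ, rfl⟩ : ∃ ρ, r = 2 * (ρ + 1) := by
    obtain ⟨t, rfl⟩ := hr_even
    exact ⟨t - 1, by omega⟩
  exact (NAESAT.treePerfect_of_limsup_pos τ hK hd hα).liminf_overlapProb_pos hτ hK hd hη hηβ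
    (hβ ⟨by linarith, le_rfl⟩).2 k
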